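/- All graphs are finite, simple and undirected. A vertex dominates itself and its neighbours. A set $S$ of vertices of $G$ is irredundant if every $v\in S$ dominates some vertex that $S\setminus\{v\}$ does not dominate, and $IR(G)$ is the largest cardinality of an inclusion-maximal irredundant set of $G$. In a graph $H=(W,F)$, a set $M\subseteq F$ is an independent edge set if no two edges of $M$ share an endpoint and the set $W(M)$ of endpoints of $M$ is independent in $(W,F\setminus M)$. Algorithms are programs of a random access machine (a register file and an indirectly addressed memory holding natural numbers, with addition, truncated subtraction, multiplication, integer division, branching and loops) under the logarithmic cost criterion, i.e. each step is charged one plus the number of bits of the numbers and addresses it handles; space is the largest number of bits occupied by nonzero cells (contents and addresses) during the computation. A graph on $\{0,\dots,n-1\}$ is given by $n$ and its adjacency matrix. Let $\alpha=1.40202$. Then the following hold. 1. There is an algorithm that, given a bipartite graph $H$ on $n$ vertices, finds an independent edge set of $H$ of maximum cardinality in time $O(\alpha^n)$ and space polynomial in $n$. 2. For every $C>0$, the function $T(n)=C\alpha^n$ $(n\in\mathbb Z)$ satisfies, for all $n$, the inequalities $T(n)\ge T(n-1)$; $T(n)\ge T(n-2)$; $T(n)\ge T(n-2)+T(n-3)$;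 $T(n)\ge T(n-1)+k\,T(n-k-2)$ for all integers $k\ge 8$; $T(n)\ge 3T(n-4)$; $$T(n)\ge T(n-d-2)+T(n-e-2)+T(n-3)+(d-k-1)(e-k-1)\,T(n-d-e-2+k)$$ for all integers $3\le d,e<8$ and $0\le k<\min(d,e)$; $$T(n)\ge 5T(n-6)+(i_1-k-1)(i_2-k-1)\,T(n-i_1-i_2+k-3)+(j_1-l-1)(j_2-l-1)\,T(n-j_1-j_2+l-6)$$ for all integers $3\le i_1,i_2<8$, $0\le k<\min(i_1,i_2)$, $1\le j_1,j_2<8$, $0\le l<\min(j_1,j_2)$; and $T(n)\ge T(n-1)+i\,T(n-i-4)$ for all integers $3\le i<8$. 3. Let $u,v$ be adjacent vertices of degree $3$ in a bipartite graph $H$, let $u_1,u_2$ be the other two neighbours of $u$ and $v_1,v_2$ the other two neighbours of $v$. Then $H$ has an independent edge set $M$ of maximum cardinality such that (a) one of $uv,uu_1,uu_2,vv_1,vv_2$ belongs to $M$, or (b) both $u_1$ and $u_2$ are endpoints of edges in $M$, or (c) both $v_1$ and $v_2$ are endpoints of edges in $M$ and neither $u_1$ nor $u_2$ is. 4. For a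 graph $G=(V,E)$ on $n$ vertices let $H$ be the graph on $V\cup V'$, where $V'$ is a disjoint copy of $V$, with an edge $\{u,v'\}$ whenever $uv\in E$ or $u=v$. Then $H$ is bipartite and has $2n$ vertices. If $M$ is an independent edge set of $H$, then $S=W(M)\cap V$ is irredundant in $G$ and $|S|=|M|$; conversely, for every irredundant set $S$ of $G$ there is an independent edge set $M$ of $H$ with $W(M)\cap V=S$ and $|M|=|S|$. Hence $IR(G)$ is the maximum cardinality of an independent edge set of $H$. 5. There is an algorithm that, given any graph $G$ on $n$ vertices, computes $IR(G)$ and an inclusion-maximal irredundant set of $G$ of cardinality $IR(G)$ in time $O(1.9657^n)$ and space polynomial in $n$. -/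

import Mathlib

universe u

/-! ## Irredundant sets -/

/-- A vertex dominates itself and all its neighbours. -/
def Dominates {V : Type*} (G : SimpleGraph V) (v u : V) : Prop :=
  u = v ∨ G.Adj v u

/-- `S` is irredundant: every `v ∈ S` dominates some vertex `u` that `S \ {v}` does not dominate. -/
def IsIrredundant {V : Type*} (G : SimpleGraph V) (S : Finset V) : Prop :=
  ∀ v ∈ S, ∃ u, Dominates G v u ∧ ∀ w ∈ S, w ≠ v → ¬ Dominates G w u

/-- `IR(G)`: the largest cardinality of an inclusion-maximal irredundant set (for finite `V`). -/
noncomputable def upperIrredundance {V : Type*} (G : SimpleGraph V) : ℕ :=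
  sSup {k : ℕ | ∃ S : Finset V, Maximal (IsIrredundant G) S ∧ S.card = k}

/-! ## Independent edge sets -/

/-- The set of all endpoints of the edges in `M`. -/
def edgeEndpoints {W : Type*} (M : Finset (Sym2 W)) : Set W :=
  {x | ∃ e ∈ M, x ∈ e}

/-- `M` is an independent set of edges of `H = (W, F)`: no two edges in `M` share an endpoint, and
the endpoints of `M` form an independent set in `(W, F \ M)`. -/
def IsIndepEdgeSet {W : Type*} (H : SimpleGraph W) (M : Finset (Sym2 W)) : Prop :=
  (∀ e ∈ M, e ∈ H.edgeSet) ∧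
  (∀ e ∈ M, ∀ f ∈ M, ∀ x : W, x ∈ e → x ∈ f → e = f) ∧
  (H.deleteEdges {e | e ∈ M}).IsIndepSet (edgeEndpoints M)

/-- `M` is an independent set of edges of maximum cardinality. -/
def IsLargestIndepEdgeSet {W : Type*} (H : SimpleGraph W) (M : Finset (Sym2 W)) : Prop :=
  IsIndepEdgeSet H M ∧ ∀ M' : Finset (Sym2 W), IsIndepEdgeSet H M' → M'.card ≤ M.card

/-- The bipartite double cover with loops: the two sides are two copies of `V`, and `u` in the first
copy is joined to `v` in the second copy iff `uv` is an edge of `G` or `u = v`. -/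
def closedDoubleCover {V : Type*} (G : SimpleGraph V) : SimpleGraph (V ⊕ V) where
  Adj x y :=
    (∃ u v : V, x = Sum.inl u ∧ y = Sum.inr v ∧ (G.Adj u v ∨ u = v)) ∨
    (∃ u v : V, y = Sum.inl u ∧ x = Sum.inr v ∧ (G.Adj u v ∨ u = v))
  symm := ⟨fun _ _ h => h.symm⟩
  loopless := ⟨by
    rintro x (⟨u, v, h, h', -⟩ | ⟨u, v, h, h', -⟩) <;> exact Sum.inl_ne_inr (h.symm.trans h')⟩

/-! ## Random access machines with logarithmic cost

A machine has a register file and a main memory, both of them arrays of natural numbers indexed by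
`ℕ` in which all but finitely many entries are `0`. A program names finitely many registers; the main
memory is addressed indirectly, through registers. -/

structure RamState where
  reg : ℕ →₀ ℕ
  mem : ℕ →₀ ℕ

/-- Arithmetic operations on `ℕ`; subtraction is truncated, division is rounded down. -/
inductive RamOp
  | add | sub | mul | div

def RamOp.eval : RamOp → ℕ → ℕ → ℕ
  | .add, a, b => a + b
  | .sub, a, b => a - b
  | .mul, a, b => a * b
  | .div, a, b => a / b

/-- `const r c` is `r := c`; `arith o r a b` is `r := a o b` on registers; `load r a` is `r := mem[a]`
and `store a b` is `mem[a] := b`, where the address is the content of register `a`. -/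
inductive RamInstr
  | const (r c : ℕ)
  | arith (o : RamOp) (r a b : ℕ)
  | load (r a : ℕ)
  | store (a b : ℕ)

noncomputable def RamInstr.apply : RamInstr → RamState → RamState
  | .const r c, s => { s with reg := s.reg.update r c }
  | .arith o r a b, s => { s with reg := s.reg.update r (o.eval (s.reg a) (s.reg b)) }
  | .load r a, s => { s with reg := s.reg.update r (s.mem (s.reg a)) }
  | .store a b, s => { s with mem := s.mem.update (s.reg a) (s.reg b) }

/-- Logarithmic cost: one plus the number of bits of all operands and addresses involved. -/
def RamInstr.cost : RamInstr → RamState → ℕ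
  | .const _ c, _ => 1 + Nat.size c
  | .arith _ _ a b, s => 1 + Nat.size (s.reg a) + Nat.size (s.reg b)
  | .load _ a, s => 1 + Nat.size (s.reg a) + Nat.size (s.mem (s.reg a))
  | .store a b, s => 1 + Nat.size (s.reg a) + Nat.size (s.reg b)

/-- The number of bits that hold an array: the bits of the nonzero entries and of their addresses. -/
def arrayBits (f : ℕ →₀ ℕ) : ℕ :=
  ∑ a ∈ f.support, (Nat.size a + Nat.size (f a))

def RamState.space (s : RamState) : ℕ :=
  arrayBits s.reg + arrayBits s.mem

/-- Programs: instructions, composition, branching on whether a register is nonzero, and repetition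
as long as a register is nonzero. -/
inductive RamProg
  | instr (i : RamInstr)
  | seq (P Q : RamProg)
  | ite (r : ℕ) (P Q : RamProg)
  | loop (r : ℕ) (P : RamProg)

/-- `RamExec P s s' t m`: the program `P`, started in state `s`, halts in state `s'`, its execution has
total cost `t`, and `m` is the largest space occupied at any moment of the execution. -/
inductive RamExec : RamProg → RamState → RamState → ℕ → ℕ → Prop
  | instr (i : RamInstr) (s : RamState) :
      RamExec (.instr i) s (i.apply s) (i.cost s) (max s.space (i.apply s).space)
  | seq {P Q : RamProg} {s s' s'' : RamState} {t t' m m' : ℕ} :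
      RamExec P s s' t m → RamExec Q s' s'' t' m' →
      RamExec (.seq P Q) s s'' (t + t') (max m m')
  | ite_nonzero {r : ℕ} {P Q : RamProg} {s s' : RamState} {t m : ℕ} :
      s.reg r ≠ 0 → RamExec P s s' t m →
      RamExec (.ite r P Q) s s' (1 + Nat.size (s.reg r) + t) m
  | ite_zero {r : ℕ} {P Q : RamProg} {s s' : RamState} {t m : ℕ} :
      s.reg r = 0 → RamExec Q s s' t m →
      RamExec (.ite r P Q) s s' (1 + Nat.size (s.reg r) + t) m
  | loop_nonzero {r : ℕ} {P : RamProg} {s s' s'' : RamState} {t t' m m' : ℕ} :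
      s.reg r ≠ 0 → RamExec P s s' t m → RamExec (.loop r P) s' s'' t' m' →
      RamExec (.loop r P) s s'' (1 + Nat.size (s.reg r) + t + t') (max m m')
  | loop_zero {r : ℕ} {P : RamProg} {s : RamState} :
      s.reg r = 0 →
      RamExec (.loop r P) s s (1 + Nat.size (s.reg r)) s.space

/-- Started in `s`, the program `P` halts within time `t` and within space `m`, in a state with
property `Q`. -/
def RamProg.HaltsWithin (P : RamProg) (s : RamState) (t m : ℕ) (Q : RamState → Prop) : Prop :=
  ∃ (s' : RamState) (t' m' : ℕ), RamExec P s s' t' m' ∧ t' ≤ t ∧ m' ≤ m ∧ Q s'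

open Classical in
/-- The initial state for a graph on `{0, …, n-1}`: all registers are `0`, cell `0` of the memory holds
`n`, and cells `1, …, n * n` hold the adjacency matrix, row by row. -/
noncomputable def graphInput {n : ℕ} (G : SimpleGraph (Fin n)) : RamState where
  reg := 0
  mem := Finsupp.onFinset (Finset.range (n * n + 1))
    (fun a => if a = 0 then n
      else if ∃ i j : Fin n, a = 1 + (i : ℕ) * n + (j : ℕ) ∧ G.Adj i j then 1 else 0)
    (by
      intro a ha
      rw [Finset.mem_range]
      by_contra hlt
      apply ha
      have h0 : a ≠ 0 := by omega
      rw [if_neg h0, if_neg]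
      rintro ⟨i, j, rfl, -⟩
      have h1 : ((i : ℕ) + 1) * n ≤ n * n := Nat.mul_le_mul_right n i.isLt
      have h2 := j.isLt
      rw [Nat.add_mul] at h1
      omega)

open Classical in
/-- Cell `0` of the memory holds the cardinality of `M`, and cells `1, …, n * n` hold the adjacency
matrix of `M`, row by row. -/
def OutputsEdgeSet {n : ℕ} (s : RamState) (M : Finset (Sym2 (Fin n))) : Prop :=
  s.mem 0 = M.card ∧
  ∀ i j : Fin n, s.mem (1 + (i : ℕ) * n + (j : ℕ)) = if s(i, j) ∈ M then 1 else 0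

/-- Cell `0` of the memory holds the cardinality of `S`, and cells `1, …, n` hold the indicator vector
of `S`. -/
def OutputsVertexSet {n : ℕ} (s : RamState) (S : Finset (Fin n)) : Prop :=
  s.mem 0 = S.card ∧ ∀ i : Fin n, s.mem (1 + (i : ℕ)) = if i ∈ S then 1 else 0

/-! ## The branching recurrences -/

/-- `T` satisfies the inequality of each branching rule, for all parameter values that can occur. -/
def SatisfiesRecurrences (T : ℤ → ℝ) : Prop :=
  ∀ n : ℤ,
    T n ≥ T (n - 1) ∧
    T n ≥ T (n - 2) ∧
    T n ≥ T (n - 2) + T (n - 3) ∧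
    (∀ k : ℕ, 8 ≤ k → T n ≥ T (n - 1) + k * T (n - k - 2)) ∧
    T n ≥ 3 * T (n - 4) ∧
    (∀ d e k : ℕ, 3 ≤ d → d < 8 → 3 ≤ e → e < 8 → k < d → k < e →
      T n ≥ T (n - d - 2) + T (n - e - 2) + T (n - 3)
        + ((d : ℝ) - k - 1) * ((e : ℝ) - k - 1) * T (n - d - e - 2 + k)) ∧
    (∀ i₁ i₂ k j₁ j₂ l : ℕ, 3 ≤ i₁ → i₁ < 8 → 3 ≤ i₂ → i₂ < 8 → k < i₁ → k < i₂ →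
      1 ≤ j₁ → j₁ < 8 → 1 ≤ j₂ → j₂ < 8 → l < j₁ → l < j₂ →
      T n ≥ 5 * T (n - 6)
        + ((i₁ : ℝ) - k - 1) * ((i₂ : ℝ) - k - 1) * T (n - i₁ - i₂ + k - 3)
        + ((j₁ : ℝ) - l - 1) * ((j₂ : ℝ) - l - 1) * T (n - j₁ - j₂ + l - 6)) ∧
    (∀ i : ℕ, 3 ≤ i → i < 8 → T n ≥ T (n - 1) + i * T (n - i - 4))

/-! An independent edge set is determined by its endpoints. The sets that arise as endpoint sets are
exactly the vertex sets `W` in which every vertex has exactly one neighbour inside `W`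
(`InducesMatching`), and `W` has twice as many elements as the edge set. So the task is to find a
largest such `W`.

The structural core is an exchange (`InducesMatching.swap`). If `u` is outside a maximum `W` and has
exactly one neighbour `a` in `W`, then `u` may replace the partner of `a`. Hence one may assume that
`u` is selected, or has no neighbour in `W`, or has at least two. If adjacent `u` and `v` are both
outside `W` and both without neighbours in it, the edge `uv` can be added, contrary to maximality.
This yields the third claim and also the completeness of the branching (`branchKeeps_of_maximum`):
at a vertex `u` of least degree it suffices to select an edge at `u` (or at a neighbour `v`), to
select two edges through two neighbours of `u` (or of `v`), or to discard `u`.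

In a bipartite graph, adjacent vertices have disjoint neighbourhoods, so each branch removes many
vertices. A branch that removes `r` vertices gets the weight `y ^ r` with `y = 1 / β`, and for `β =
701009 / 500000 = 1.402018` the weights at a pivot sum to at most `1` (`sum_branchWeight_le`). The
inequalities in `y` behind this also give the recurrences of the second claim. The nearly tight one
is `y ^ 3 + 2 * y ^ 5 + 4 * y ^ 8 ≤ 1`.

The search is a depth-first search with an explicit stack. The potential `(|X| + 1) * β ^ |X|` of a
node with undecided set `X`, summed over the stack, falls by at least `1` in each round
(`sum_potential_le`), so there are at most about `(m + 1) * β ^ m` rounds on `m` vertices. A node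
lies at a height of at most `m ^ 4` times its number of decided vertices, so the stack stays
polynomial. Since `1.402018 < 1.40202`, polynomial factors disappear in the larger base. The program
is written in a small imperative language whose compiler to random access machines is proved correct
with polynomial step bounds (`Expr.exec_compile`, `Cmd.exec_compile`, `haltsWithin_searchProg`).

For irredundance, matching each `v` in `S` to a vertex that it alone dominates turns irredundant
sets of `G` into independent edge sets of the closed double cover, and conversely. That graph has `2
* n` vertices, and `1.402018 ^ 2 < 1.9657`. -/

/-! ## Polynomially bounded functions -/

/-- A function on `ℕ` that is dominated by a polynomial. -/
def PolyBounded (f : ℕ → ℕ) : Prop :=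
  ∃ p : Polynomial ℕ, ∀ n, f n ≤ p.eval n

namespace PolyBounded

theorem const (c : ℕ) : PolyBounded fun _ => c :=
  ⟨Polynomial.C c, fun n => by simp⟩

theorem id : PolyBounded fun n => n :=
  ⟨Polynomial.X, fun n => by simp⟩

theorem add {f g : ℕ → ℕ} (hf : PolyBounded f) (hg : PolyBounded g) :
    PolyBounded fun n => f n + g n := by
  obtain ⟨p, hp⟩ := hf
  obtain ⟨q, hq⟩ := hg
  exact ⟨p + q, fun n => by rw [Polynomial.eval_add]; exact add_le_add (hp n) (hq n)⟩

theorem mul {f g : ℕ → ℕ} (hf : PolyBounded f) (hg : PolyBounded g) :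
    PolyBounded fun n => f n * g n := by
  obtain ⟨p, hp⟩ := hf
  obtain ⟨q, hq⟩ := hg
  exact ⟨p * q, fun n => by rw [Polynomial.eval_mul]; exact Nat.mul_le_mul (hp n) (hq n)⟩

theorem pow {f : ℕ → ℕ} (hf : PolyBounded f) (k : ℕ) : PolyBounded fun n => f n ^ k := by
  obtain ⟨p, hp⟩ := hf
  exact ⟨p ^ k, fun n => by rw [Polynomial.eval_pow]; exact Nat.pow_le_pow_left (hp n) k⟩

theorem comp_mul_left {f : ℕ → ℕ} (hf : PolyBounded f) (c : ℕ) :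
    PolyBounded fun n => f (c * n) := by
  obtain ⟨p, hp⟩ := hf
  refine ⟨p.comp (Polynomial.C c * Polynomial.X), fun n => ?_⟩
  simpa using hp (c * n)

/-- A polynomial factor is absorbed by an arbitrarily small increase of the base. -/
theorem isBigO_mul_pow {f : ℕ → ℕ} (hf : PolyBounded f) {r₁ r₂ : ℝ} (h₁ : 0 < r₁) (h : r₁ < r₂) :
    (fun n : ℕ => (f n : ℝ) * r₁ ^ n) =O[Filter.atTop] fun n : ℕ => r₂ ^ n := by
  obtain ⟨p, hp⟩ := hf
  have key : (fun n : ℕ => ((p.eval n : ℕ) : ℝ) * r₁ ^ n) =O[Filter.atTop] fun n : ℕ => r₂ ^ n := by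
    have hmon : ∀ k : ℕ, (fun n : ℕ => ((n : ℝ) ^ k) * r₁ ^ n) =O[Filter.atTop]
        fun n : ℕ => r₂ ^ n := fun k =>
      (isLittleO_pow_const_mul_const_pow_const_pow_of_norm_lt k
        (by rw [Real.norm_of_nonneg h₁.le]; exact h)).isBigO
    have heq : (fun n : ℕ => ((p.eval n : ℕ) : ℝ) * r₁ ^ n) =
        fun n : ℕ => ∑ k ∈ Finset.range (p.natDegree + 1),
          (p.coeff k : ℝ) * ((n : ℝ) ^ k * r₁ ^ n) := by
      funext n
      rw [Polynomial.eval_eq_sum_range]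
      push_cast
      rw [Finset.sum_mul]
      exact Finset.sum_congr rfl fun k _ => by ring
    rw [heq]
    exact Asymptotics.IsBigO.fun_sum fun k _ => (hmon k).const_mul_left _
  refine Asymptotics.IsBigO.trans (Asymptotics.IsBigO.of_bound 1 ?_) key
  refine Filter.Eventually.of_forall fun n => ?_
  have hn : (f n : ℝ) ≤ (p.eval n : ℕ) := by exact_mod_cast hp n
  have hpow : 0 ≤ r₁ ^ n := by positivity
  rw [one_mul, Real.norm_of_nonneg (by positivity), Real.norm_of_nonneg (by positivity)]
  exact mul_le_mul_of_nonneg_right hn hpow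

end PolyBounded

/-! ## Counting steps of random access machines -/

/-- A strict bound on the indices of the registers that an instruction writes, and a bound on its
constants. -/
def RamInstr.bound : RamInstr → ℕ
  | .const r c => max (r + 1) c
  | .arith _ r _ _ => r + 1
  | .load r _ => r + 1
  | .store _ _ => 0

/-- A strict bound on the indices of the registers that a program writes, and a bound on its
constants. -/
def RamProg.bound : RamProg → ℕ
  | .instr i => i.bound
  | .seq P Q => max P.bound Q.bound
  | .ite _ P Q => max P.bound Q.bound
  | .loop _ P => P.bound

/-- If the instruction is a multiplication, its second factor has at most `g` bits. -/
def RamInstr.MulSmall (g : ℕ) : RamInstr → RamState → Prop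
  | .arith .mul _ _ b, s => Nat.size (s.reg b) ≤ g
  | _, _ => True

/-- `StepExec g P s s' k`: started in `s`, the program `P` halts in `s'` after at most `k` steps, and
all its multiplications are by numbers with at most `g` bits. -/
inductive StepExec (g : ℕ) : RamProg → RamState → RamState → ℕ → Prop
  | instr (i : RamInstr) (s : RamState) (h : i.MulSmall g s) :
      StepExec g (.instr i) s (i.apply s) 1
  | seq {P Q : RamProg} {s s' s'' : RamState} {k k' : ℕ} :
      StepExec g P s s' k → StepExec g Q s' s'' k' → StepExec g (.seq P Q) s s'' (k + k')
  | ite_nonzero {r : ℕ} {P Q : RamProg} {s s' : RamState} {k : ℕ} :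
      s.reg r ≠ 0 → StepExec g P s s' k → StepExec g (.ite r P Q) s s' (1 + k)
  | ite_zero {r : ℕ} {P Q : RamProg} {s s' : RamState} {k : ℕ} :
      s.reg r = 0 → StepExec g Q s s' k → StepExec g (.ite r P Q) s s' (1 + k)
  | loop_nonzero {r : ℕ} {P : RamProg} {s s' s'' : RamState} {k k' : ℕ} :
      s.reg r ≠ 0 → StepExec g P s s' k → StepExec g (.loop r P) s' s'' k' →
      StepExec g (.loop r P) s s'' (1 + k + k')
  | loop_zero {r : ℕ} {P : RamProg} {s : RamState} :
      s.reg r = 0 → StepExec g (.loop r P) s s 1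
  | weaken {P : RamProg} {s s' : RamState} {k k' : ℕ} :
      StepExec g P s s' k → k ≤ k' → StepExec g P s s' k'

theorem nat_size_le_self (n : ℕ) : Nat.size n ≤ n :=
  Nat.size_le.2 Nat.lt_two_pow_self

theorem nat_size_add_le {a b l : ℕ} (ha : Nat.size a ≤ l) (hb : Nat.size b ≤ l) :
    Nat.size (a + b) ≤ l + 1 := by
  rw [Nat.size_le] at *
  rw [pow_succ]
  omega

theorem nat_size_mul_le {a b l g : ℕ} (ha : Nat.size a ≤ l) (hb : Nat.size b ≤ g) :
    Nat.size (a * b) ≤ l + g := by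
  rw [Nat.size_le] at *
  rw [pow_add]
  exact Nat.mul_lt_mul'' ha hb

/-- At most `c` entries are nonzero, and they and their addresses have at most `l` bits. -/
def ArrayFits (f : ℕ →₀ ℕ) (c l : ℕ) : Prop :=
  f.support.card ≤ c ∧ ∀ a, f a ≠ 0 → Nat.size a ≤ l ∧ Nat.size (f a) ≤ l

theorem ArrayFits.size_le {f : ℕ →₀ ℕ} {c l : ℕ} (h : ArrayFits f c l) (a : ℕ) :
    Nat.size (f a) ≤ l := by
  by_cases ha : f a = 0
  · simp [ha]
  · exact (h.2 a ha).2

theorem ArrayFits.mono {f : ℕ →₀ ℕ} {c l c' l' : ℕ} (h : ArrayFits f c l) (hc : c ≤ c')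
    (hl : l ≤ l') : ArrayFits f c' l' :=
  ⟨h.1.trans hc, fun a ha => ⟨(h.2 a ha).1.trans hl, (h.2 a ha).2.trans hl⟩⟩

theorem ArrayFits.update {f : ℕ →₀ ℕ} {c l l' a v : ℕ} (h : ArrayFits f c l) (hl : l ≤ l')
    (ha : Nat.size a ≤ l') (hv : Nat.size v ≤ l') : ArrayFits (f.update a v) (c + 1) l' := by
  classical
  constructor
  · have hsub : (f.update a v).support ⊆ insert a f.support := by
      intro x hx
      rw [Finsupp.mem_support_iff, Finsupp.update_apply] at hx
      rw [Finset.mem_insert, Finsupp.mem_support_iff]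
      by_cases hxa : x = a
      · exact Or.inl hxa
      · rw [if_neg hxa] at hx; exact Or.inr hx
    exact (Finset.card_le_card hsub).trans
      ((Finset.card_insert_le _ _).trans (Nat.add_le_add_right h.1 1))
  · intro x hx
    rw [Finsupp.update_apply] at hx ⊢
    by_cases hxa : x = a
    · subst hxa; simpa using ⟨ha, hv⟩
    · rw [if_neg hxa] at hx ⊢
      exact ⟨(h.2 x hx).1.trans hl, (h.2 x hx).2.trans hl⟩

theorem ArrayFits.arrayBits_le {f : ℕ →₀ ℕ} {c l : ℕ} (h : ArrayFits f c l) :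
    arrayBits f ≤ c * (2 * l) := by
  unfold arrayBits
  refine (Finset.sum_le_card_nsmul _ _ (2 * l) fun a ha => ?_).trans ?_
  · have := h.2 a (Finsupp.mem_support_iff.1 ha)
    omega
  · rw [smul_eq_mul]; exact Nat.mul_le_mul_right _ h.1

/-- The register file and the memory both fit. -/
def RamState.Fits (s : RamState) (c l : ℕ) : Prop :=
  ArrayFits s.reg c l ∧ ArrayFits s.mem c l

theorem RamState.Fits.mono {s : RamState} {c l c' l' : ℕ} (h : s.Fits c l) (hc : c ≤ c')
    (hl : l ≤ l') : s.Fits c' l' :=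
  ⟨h.1.mono hc hl, h.2.mono hc hl⟩

theorem RamState.Fits.space_le {s : RamState} {c l : ℕ} (h : s.Fits c l) :
    s.space ≤ 4 * c * l := by
  have h1 := h.1.arrayBits_le
  have h2 := h.2.arrayBits_le
  unfold RamState.space
  calc _ ≤ c * (2 * l) + c * (2 * l) := add_le_add h1 h2
    _ = _ := by ring

/-- Bit lengths grow additively because one factor of every product has at most `g` bits;
unrestricted squaring would double them. The summand `g + 1` covers the carry of an addition, such a
product, and the constants and register indices in the program text. -/
theorem RamInstr.fits_apply {g c l : ℕ} {i : RamInstr} {s : RamState} (hi : i.MulSmall g s)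
    (hb : i.bound ≤ g) (h : s.Fits c l) : (i.apply s).Fits (c + 1) (l + (g + 1)) := by
  have hmem : ArrayFits s.mem (c + 1) (l + (g + 1)) := h.2.mono (by omega) (by omega)
  have hreg : ArrayFits s.reg (c + 1) (l + (g + 1)) := h.1.mono (by omega) (by omega)
  have hup : ∀ r v, r + 1 ≤ g → Nat.size v ≤ l + (g + 1) →
      ArrayFits (s.reg.update r v) (c + 1) (l + (g + 1)) := fun r v hr hv =>
    h.1.update (by omega) ((nat_size_le_self r).trans (by omega)) hv
  cases i with
  | const r k =>
    have hb' : max (r + 1) k ≤ g := hb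
    exact ⟨hup r k (le_trans (le_max_left _ _) hb')
      ((nat_size_le_self k).trans (le_trans (le_trans (le_max_right _ _) hb') (by omega))), hmem⟩
  | arith o r a b =>
    have ha := h.1.size_le a
    have hb' := h.1.size_le b
    refine ⟨hup r _ hb ?_, hmem⟩
    cases o with
    | add => exact (nat_size_add_le ha hb').trans (by omega)
    | sub => exact (Nat.size_le_size (Nat.sub_le _ _)).trans (by omega)
    | mul => exact (nat_size_mul_le ha hi).trans (by omega)
    | div => exact (Nat.size_le_size (Nat.div_le_self _ _)).trans (by omega)
  | load r a =>
    exact ⟨hup r _ hb ((h.2.size_le _).trans (by omega)), hmem⟩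
  | store a b =>
    exact ⟨hreg, h.2.update (by omega) ((h.1.size_le a).trans (by omega))
      ((h.1.size_le b).trans (by omega))⟩

theorem RamInstr.cost_le {g c l : ℕ} {i : RamInstr} {s : RamState} (hb : i.bound ≤ g)
    (h : s.Fits c l) : i.cost s ≤ 1 + g + 2 * l := by
  cases i with
  | const r k =>
    have hb' : max (r + 1) k ≤ g := hb
    have := (nat_size_le_self k).trans (le_trans (le_max_right _ _) hb')
    show 1 + Nat.size k ≤ _
    omega
  | arith o r a b =>
    have ha := h.1.size_le a
    have hb' := h.1.size_le b
    show 1 + Nat.size (s.reg a) + Nat.size (s.reg b) ≤ _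
    omega
  | load r a =>
    have ha := h.1.size_le a
    have hb' := h.2.size_le (s.reg a)
    show 1 + Nat.size (s.reg a) + Nat.size (s.mem (s.reg a)) ≤ _
    omega
  | store a b =>
    have ha := h.1.size_le a
    have hb' := h.1.size_le b
    show 1 + Nat.size (s.reg a) + Nat.size (s.reg b) ≤ _
    omega

/-- An execution with few steps is fast and needs little space. -/
theorem StepExec.ramExec {g k : ℕ} {P : RamProg} {s s' : RamState} (h : StepExec g P s s' k)
    (hP : P.bound ≤ g) : ∀ {c l : ℕ}, s.Fits c l →
    ∃ t m, RamExec P s s' t m ∧ t ≤ k * (1 + g + 2 * (l + k * (g + 1))) ∧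
      m ≤ 4 * (c + k) * (l + k * (g + 1)) ∧ s'.Fits (c + k) (l + k * (g + 1)) := by
  -- Concatenation: the second run starts from the enlarged size bounds that the first one leaves
  -- behind.
  have two : ∀ {c l k k' t t' m m' : ℕ},
      t ≤ k * (1 + g + 2 * (l + k * (g + 1))) → m ≤ 4 * (c + k) * (l + k * (g + 1)) →
      t' ≤ k' * (1 + g + 2 * ((l + k * (g + 1)) + k' * (g + 1))) →
      m' ≤ 4 * ((c + k) + k') * ((l + k * (g + 1)) + k' * (g + 1)) →
      t + t' ≤ (k + k') * (1 + g + 2 * (l + (k + k') * (g + 1))) ∧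
      max m m' ≤ 4 * (c + (k + k')) * (l + (k + k') * (g + 1)) := by
    intro c l k k' t t' m m' ht hm ht' hm'
    have e1 : (l + k * (g + 1)) + k' * (g + 1) = l + (k + k') * (g + 1) := by ring
    have e2 : l + k * (g + 1) ≤ l + (k + k') * (g + 1) := by rw [← e1]; omega
    rw [e1] at ht' hm'
    constructor
    · rw [Nat.add_mul]
      exact add_le_add (ht.trans (Nat.mul_le_mul_left _ (by omega))) ht'
    · refine max_le (hm.trans (Nat.mul_le_mul ?_ e2)) (hm'.trans (Nat.mul_le_mul_right _ ?_)) <;>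
        omega
  -- A test costs at most `1 + g + 2 * l'`, so it may be charged as one more step. The same estimate
  -- covers the weakening of a step bound.
  have one : ∀ {c l k t m c' l' t' m' k' : ℕ}, c ≤ c' → l ≤ l' → k ≤ k' →
      t ≤ k * (1 + g + 2 * (l + k * (g + 1))) → m ≤ 4 * (c + k) * (l + k * (g + 1)) →
      t' ≤ t + (k' - k) * (1 + g + 2 * l') → m' ≤ m →
      t' ≤ k' * (1 + g + 2 * (l' + k' * (g + 1))) ∧
      m' ≤ 4 * (c' + k') * (l' + k' * (g + 1)) := by
    intro c l k t m c' l' t' m' k' hc hl hk ht hm ht' hm'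
    have e2 : k * (g + 1) ≤ k' * (g + 1) := Nat.mul_le_mul_right _ hk
    obtain ⟨d, rfl⟩ := Nat.exists_eq_add_of_le hk
    constructor
    · rw [Nat.add_mul]
      refine ht'.trans (add_le_add (ht.trans (Nat.mul_le_mul_left _ (by omega))) ?_)
      rw [Nat.add_sub_cancel_left]
      exact Nat.mul_le_mul_left _ (by omega)
    · exact hm'.trans (hm.trans (Nat.mul_le_mul (by omega) (by omega)))
  have mono_one : ∀ {s : RamState} {c l k : ℕ}, s.Fits (c + k) (l + k * (g + 1)) →
      s.Fits (c + (1 + k)) (l + (1 + k) * (g + 1)) := by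
    intro s c l k hs
    refine hs.mono (by omega) ?_
    rw [Nat.add_mul]
    omega
  induction h with
  | instr i s h =>
    intro c l hs
    have hf := RamInstr.fits_apply h hP hs
    refine ⟨_, _, RamExec.instr i s, ?_, ?_, by simpa using hf⟩
    · have := RamInstr.cost_le hP hs
      omega
    · refine max_le ?_ ?_
      · exact (hs.mono (by omega) (by omega)).space_le
      · simpa using hf.space_le
  | seq h1 h2 ih1 ih2 =>
    intro c l hs
    obtain ⟨t, m, hx, ht, hm, hf⟩ := ih1 (le_trans (le_max_left _ _) hP) hs
    obtain ⟨t', m', hx', ht', hm', hf'⟩ := ih2 (le_trans (le_max_right _ _) hP) hf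
    obtain ⟨h3, h4⟩ := two ht hm ht' hm'
    exact ⟨_, _, RamExec.seq hx hx', h3, h4, hf'.mono (by omega) (by ring_nf; omega)⟩
  | @ite_nonzero r P Q s s' k h0 h1 ih =>
    intro c l hs
    obtain ⟨t, m, hx, ht, hm, hf⟩ := ih (le_trans (le_max_left _ _) hP) hs
    obtain ⟨h3, h4⟩ := one le_rfl le_rfl (Nat.le_add_left _ 1) ht hm
      (t' := 1 + Nat.size (s.reg r) + t) (m' := m)
      (by have := hs.1.size_le r; rw [Nat.add_sub_cancel]; omega) le_rfl
    exact ⟨_, _, RamExec.ite_nonzero h0 hx, h3, h4, mono_one hf⟩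
  | @ite_zero r P Q s s' k h0 h1 ih =>
    intro c l hs
    obtain ⟨t, m, hx, ht, hm, hf⟩ := ih (le_trans (le_max_right _ _) hP) hs
    obtain ⟨h3, h4⟩ := one le_rfl le_rfl (Nat.le_add_left _ 1) ht hm
      (t' := 1 + Nat.size (s.reg r) + t) (m' := m)
      (by have := hs.1.size_le r; rw [Nat.add_sub_cancel]; omega) le_rfl
    exact ⟨_, _, RamExec.ite_zero h0 hx, h3, h4, mono_one hf⟩
  | @loop_nonzero r P s s' s'' k k' h0 h1 h2 ih1 ih2 =>
    intro c l hs
    obtain ⟨t, m, hx, ht, hm, hf⟩ := ih1 hP hs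
    obtain ⟨t', m', hx', ht', hm', hf'⟩ := ih2 hP (mono_one hf)
    obtain ⟨h3, h4⟩ := one le_rfl le_rfl (Nat.le_add_left _ 1) ht hm
      (t' := 1 + Nat.size (s.reg r) + t) (m' := m)
      (by have := hs.1.size_le r; rw [Nat.add_sub_cancel]; omega) le_rfl
    obtain ⟨h5, h6⟩ := two h3 h4 ht' hm'
    exact ⟨_, _, RamExec.loop_nonzero h0 hx hx', h5, h6, hf'.mono (by omega) (by ring_nf; omega)⟩
  | @loop_zero r P s h0 =>
    intro c l hs
    refine ⟨_, _, RamExec.loop_zero h0, ?_, ?_, hs.mono (by omega) (by omega)⟩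
    · rw [h0]; simp; omega
    · exact (hs.mono (by omega) (by omega)).space_le
  | weaken h hk ih =>
    intro c l hs
    obtain ⟨t, m, hx, ht, hm, hf⟩ := ih hP hs
    obtain ⟨h3, h4⟩ := one le_rfl le_rfl hk ht hm (Nat.le_add_right _ _) le_rfl
    exact ⟨_, _, hx, h3, h4, hf.mono (by omega) (by gcongr)⟩

/-- Registers beyond the bound of a program are not written. -/
theorem StepExec.reg_eq {g k : ℕ} {P : RamProg} {s s' : RamState} (h : StepExec g P s s' k)
    {r : ℕ} (hr : P.bound ≤ r) : s'.reg r = s.reg r := by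
  have up : ∀ (f : ℕ →₀ ℕ) (a v : ℕ), a + 1 ≤ r → f.update a v r = f r := fun f a v ha => by
    rw [Finsupp.update_apply, if_neg (by omega)]
  induction h with
  | instr i s h =>
    cases i with
    | const r' c => exact up _ _ _ (le_trans (le_max_left _ _) hr)
    | arith o r' a b => exact up _ _ _ hr
    | load r' a => exact up _ _ _ hr
    | store a b => rfl
  | seq h1 h2 ih1 ih2 =>
    rw [ih2 (le_trans (le_max_right _ _) hr), ih1 (le_trans (le_max_left _ _) hr)]
  | ite_nonzero h0 h1 ih => exact ih (le_trans (le_max_left _ _) hr)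
  | ite_zero h0 h1 ih => exact ih (le_trans (le_max_right _ _) hr)
  | loop_nonzero h0 h1 h2 ih1 ih2 => rw [ih2 hr, ih1 hr]
  | loop_zero h0 => rfl
  | weaken h hk ih => exact ih hr

/-! ## A small imperative language and its compiler -/

/-- Sixteen variables, four unbounded arrays, and the array that holds the input and the output. -/
structure Store where
  var : Fin 16 → ℕ
  arr : Fin 4 → ℕ → ℕ
  io : ℕ → ℕ

namespace Store

def setVar (σ : Store) (x : Fin 16) (v : ℕ) : Store :=
  { σ with var := Function.update σ.var x v }

def setArr (σ : Store) (k : Fin 4) (i v : ℕ) : Store :=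
  { σ with arr := Function.update σ.arr k (Function.update (σ.arr k) i v) }

def setIo (σ : Store) (i v : ℕ) : Store :=
  { σ with io := Function.update σ.io i v }

end Store

/-- Expressions. They refer to a size parameter `m`: `size` is `m`, `scale e` is `e * m`, and
`sum x e` is the sum of `e` over all values of `x` below `m`. -/
inductive Expr
  | const (c : ℕ)
  | size
  | var (x : Fin 16)
  | arr (k : Fin 4) (e : Expr)
  | io (e : Expr)
  | add (e₁ e₂ : Expr)
  | sub (e₁ e₂ : Expr)
  | scale (e : Expr)
  | half (e : Expr)
  | ite (c e₁ e₂ : Expr)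
  | sum (x : Fin 16) (e : Expr)

namespace Expr

def eval (m : ℕ) : Expr → Store → ℕ
  | const c, _ => c
  | size, _ => m
  | var x, σ => σ.var x
  | arr k e, σ => σ.arr k (e.eval m σ)
  | io e, σ => σ.io (e.eval m σ)
  | add e₁ e₂, σ => e₁.eval m σ + e₂.eval m σ
  | sub e₁ e₂, σ => e₁.eval m σ - e₂.eval m σ
  | scale e, σ => e.eval m σ * m
  | half e, σ => e.eval m σ / 2
  | ite c e₁ e₂, σ => if c.eval m σ ≠ 0 then e₁.eval m σ else e₂.eval m σ
  | sum x e, σ => ∑ i ∈ Finset.range m, e.eval m (σ.setVar x i)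

end Expr

/-- Commands. `loop x P` runs `P` for all values of `x` below `m`, from the largest to the smallest. -/
inductive Cmd
  | skip
  | assign (x : Fin 16) (e : Expr)
  | store (k : Fin 4) (i e : Expr)
  | storeIo (i e : Expr)
  | seq (P Q : Cmd)
  | ite (c : Expr) (P Q : Cmd)
  | loop (x : Fin 16) (P : Cmd)

/-- Run `f` for the values of `x` below `k`, from the largest to the smallest. -/
def Store.iterDown (f : Store → Store) (x : Fin 16) : ℕ → Store → Store
  | 0, σ => σ
  | k + 1, σ => Store.iterDown f x k (f (σ.setVar x k))

/-- The effect of a command for the size parameter `m`, with an input array of length `N`. -/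
def Cmd.run (m N : ℕ) : Cmd → Store → Store
  | .skip, σ => σ
  | .assign x e, σ => σ.setVar x (e.eval m σ)
  | .store k i e, σ => σ.setArr k (i.eval m σ) (e.eval m σ)
  | .storeIo i e, σ => if i.eval m σ < N then σ.setIo (i.eval m σ) (e.eval m σ) else σ
  | .seq P Q, σ => Q.run m N (P.run m N σ)
  | .ite c P Q, σ => if c.eval m σ ≠ 0 then P.run m N σ else Q.run m N σ
  | .loop x P, σ => Store.iterDown (P.run m N) x m σ

/-! ### Compilation -/

/-- `r := a`, using the register `t`. -/
def RamProg.move (r a t : ℕ) : RamProg :=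
  .seq (.instr (.const t 0)) (.instr (.arith .add r a t))

/-- Replace the index in register `t` by the address of that entry of array `k`. -/
def RamProg.address (k t : ℕ) : RamProg :=
  .seq (.instr (.const (t + 1) 4)) (.seq (.instr (.arith .mul t t (t + 1)))
    (.seq (.instr (.const (t + 1) k)) (.seq (.instr (.arith .add t t (t + 1)))
      (.instr (.arith .add t t 1)))))

namespace Expr

/-- Compute an expression into the register `t`, using registers above `t` for intermediate results.
-/
def compile : Expr → ℕ → RamProg
  | const c, t => .instr (.const t c)
  | size, t => .move t 0 t
  | var x, t => .move t (2 + x) t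
  | arr k e, t => .seq (e.compile t) (.seq (.address k t) (.instr (.load t t)))
  | io e, t => .seq (e.compile t) (.seq (.instr (.arith .sub (t + 1) 1 t))
      (.ite (t + 1) (.instr (.load t t)) (.instr (.const t 0))))
  | add e₁ e₂, t => .seq (e₁.compile t) (.seq (e₂.compile (t + 1))
      (.instr (.arith .add t t (t + 1))))
  | sub e₁ e₂, t => .seq (e₁.compile t) (.seq (e₂.compile (t + 1))
      (.instr (.arith .sub t t (t + 1))))
  | scale e, t => .seq (e.compile t) (.instr (.arith .mul t t 0))
  | half e, t => .seq (e.compile t) (.seq (.instr (.const (t + 1) 2))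
      (.instr (.arith .div t t (t + 1))))
  | ite c e₁ e₂, t => .seq (c.compile t) (.ite t (e₁.compile t) (e₂.compile t))
  | sum x e, t => .seq (.move t (2 + x) t) (.seq (.instr (.const (t + 1) 0))
      (.seq (.move (2 + x) 0 (t + 2))
        (.seq (.loop (2 + x) (.seq (.instr (.const (t + 2) 1))
          (.seq (.instr (.arith .sub (2 + x) (2 + x) (t + 2)))
            (.seq (e.compile (t + 2)) (.instr (.arith .add (t + 1) (t + 1) (t + 2)))))))
        (.seq (.move (2 + x) t (t + 2)) (.move t (t + 1) (t + 2))))))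

/-- A bound on the number of steps of a compiled expression. -/
def steps (m : ℕ) : Expr → ℕ
  | const _ => 1
  | size => 2
  | var _ => 2
  | arr _ e => e.steps m + 6
  | io e => e.steps m + 3
  | add e₁ e₂ => e₁.steps m + (e₂.steps m + 1)
  | sub e₁ e₂ => e₁.steps m + (e₂.steps m + 1)
  | scale e => e.steps m + 1
  | half e => e.steps m + 2
  | ite c e₁ e₂ => c.steps m + (1 + (e₁.steps m + e₂.steps m))
  | sum _ e => m * (e.steps m + 4) + 10

theorem polyBounded_steps (e : Expr) : PolyBounded fun m => e.steps m := by
  induction e with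
  | const c => exact .const _
  | size => exact .const _
  | var x => exact .const _
  | arr k e ih => exact ih.add (.const _)
  | io e ih => exact ih.add (.const _)
  | add e₁ e₂ ih₁ ih₂ => exact ih₁.add (ih₂.add (.const _))
  | sub e₁ e₂ ih₁ ih₂ => exact ih₁.add (ih₂.add (.const _))
  | scale e ih => exact ih.add (.const _)
  | half e ih => exact ih.add (.const _)
  | ite c e₁ e₂ ih ih₁ ih₂ => exact ih.add (.add (.const _) (ih₁.add ih₂))
  | sum x e ih => exact (PolyBounded.id.mul (ih.add (.const _))).add (.const _)

end Expr

namespace Cmd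

def compile : Cmd → ℕ → RamProg
  | skip, t => .instr (.const t 0)
  | assign x e, t => .seq (e.compile t) (.move (2 + x) t (t + 1))
  | store k i e, t => .seq (i.compile t) (.seq (.address k t)
      (.seq (e.compile (t + 1)) (.instr (.store t (t + 1)))))
  | storeIo i e, t => .seq (i.compile t) (.seq (.instr (.arith .sub (t + 1) 1 t))
      (.ite (t + 1) (.seq (e.compile (t + 1)) (.instr (.store t (t + 1))))
        (.instr (.const t 0))))
  | seq P Q, t => .seq (P.compile t) (Q.compile t)
  | ite c P Q, t => .seq (c.compile t) (.ite t (P.compile t) (Q.compile t))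
  | loop x P, t => .seq (.move t 0 t) (.loop t (.seq (.instr (.const (t + 1) 1))
      (.seq (.instr (.arith .sub t t (t + 1))) (.seq (.move (2 + x) t (t + 1))
        (P.compile (t + 1))))))

/-- A bound on the number of steps of a compiled command. -/
def steps (m : ℕ) : Cmd → ℕ
  | skip => 1
  | assign _ e => e.steps m + 2
  | store _ i e => i.steps m + (5 + (e.steps m + 1))
  | storeIo i e => i.steps m + (1 + (1 + (e.steps m + 1)))
  | seq P Q => P.steps m + Q.steps m
  | ite c P Q => c.steps m + (1 + (P.steps m + Q.steps m))
  | loop _ P => 2 + (m * (5 + P.steps m) + 1)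

theorem polyBounded_steps (P : Cmd) : PolyBounded fun m => P.steps m := by
  induction P with
  | skip => exact .const _
  | assign x e => exact e.polyBounded_steps.add (.const _)
  | store k i e => exact i.polyBounded_steps.add (.add (.const _)
      (e.polyBounded_steps.add (.const _)))
  | storeIo i e => exact i.polyBounded_steps.add (.add (.const _) (.add (.const _)
      (e.polyBounded_steps.add (.const _))))
  | seq P Q ih₁ ih₂ => exact ih₁.add ih₂
  | ite c P Q ih₁ ih₂ => exact c.polyBounded_steps.add (.add (.const _) (ih₁.add ih₂))
  | loop x P ih =>
    exact .add (.const _) (.add (PolyBounded.id.mul (.add (.const _) ih)) (.const _))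

end Cmd

/-! ### Correctness of the compiler -/

/-- The machine state `s` represents the store `σ`. -/
structure Represents (m N : ℕ) (s : RamState) (σ : Store) : Prop where
  size : s.reg 0 = m
  length : s.reg 1 = N
  var : ∀ x : Fin 16, s.reg (2 + x) = σ.var x
  arr : ∀ (k : Fin 4) (i : ℕ), s.mem (N + (4 * i + k)) = σ.arr k i
  io : ∀ i < N, s.mem i = σ.io i
  io_zero : ∀ i, N ≤ i → σ.io i = 0

theorem Represents.congr {m N : ℕ} {s s' : RamState} {σ : Store} (h : Represents m N s σ)
    (hmem : s'.mem = s.mem) (hreg : ∀ r < 18, s'.reg r = s.reg r) : Represents m N s' σ where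
  size := by rw [hreg 0 (by omega), h.size]
  length := by rw [hreg 1 (by omega), h.length]
  var x := by rw [hreg _ (by omega), h.var]
  arr k i := by rw [hmem, h.arr]
  io i hi := by rw [hmem, h.io i hi]
  io_zero := h.io_zero

theorem Represents.setVar {m N : ℕ} {s s' : RamState} {σ : Store} (h : Represents m N s σ)
    {x : Fin 16} {v : ℕ} (hmem : s'.mem = s.mem) (hx : s'.reg (2 + x) = v)
    (hreg : ∀ r : ℕ, r < 18 → r ≠ 2 + x → s'.reg r = s.reg r) : Represents m N s' (σ.setVar x v) where
  size := by rw [hreg 0 (by omega) (by omega), h.size]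
  length := by rw [hreg 1 (by omega) (by omega), h.length]
  var y := by
    by_cases hy : y = x
    · subst hy; simp [Store.setVar, hx]
    · rw [hreg _ (by omega) (by have := Fin.val_ne_of_ne hy; omega), h.var]
      simp [Store.setVar, hy]
  arr k i := by rw [hmem, h.arr]; rfl
  io i hi := by rw [hmem, h.io i hi]; rfl
  io_zero := h.io_zero

/-- The four arrays are interleaved behind the `N` cells of input and output. As `k < 4`, the
address `N + (4 * i + k)` determines both `i` and `k`, so a write changes one entry of one array
only. -/
theorem Represents.setArr {m N : ℕ} {s s' : RamState} {σ : Store} (h : Represents m N s σ)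
    {k : Fin 4} {i v : ℕ} (hmem : s'.mem = s.mem.update (N + (4 * i + k)) v)
    (hreg : ∀ r < 18, s'.reg r = s.reg r) : Represents m N s' (σ.setArr k i v) where
  size := by rw [hreg 0 (by omega), h.size]
  length := by rw [hreg 1 (by omega), h.length]
  var x := by rw [hreg _ (by omega), h.var]; rfl
  arr k' i' := by
    rw [hmem, Finsupp.update_apply]
    by_cases hk : k' = k
    · subst hk
      by_cases hi : i' = i
      · subst hi; simp [Store.setArr]
      · rw [if_neg (by omega), h.arr]; simp [Store.setArr, hi]
    · have := Fin.val_ne_of_ne hk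
      rw [if_neg (by omega), h.arr]; simp [Store.setArr, hk]
  io i' hi' := by rw [hmem, Finsupp.update_apply, if_neg (by omega), h.io i' hi']; rfl
  io_zero := h.io_zero

theorem Represents.setIo {m N : ℕ} {s s' : RamState} {σ : Store} (h : Represents m N s σ)
    {i v : ℕ} (hi : i < N) (hmem : s'.mem = s.mem.update i v)
    (hreg : ∀ r < 18, s'.reg r = s.reg r) : Represents m N s' (σ.setIo i v) where
  size := by rw [hreg 0 (by omega), h.size]
  length := by rw [hreg 1 (by omega), h.length]
  var x := by rw [hreg _ (by omega), h.var]; rfl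
  arr k' i' := by
    rw [hmem, Finsupp.update_apply, if_neg (by omega), h.arr]; rfl
  io i' hi' := by
    rw [hmem, Finsupp.update_apply]
    by_cases h' : i' = i
    · subst h'; simp [Store.setIo]
    · rw [if_neg h', h.io i' hi']; simp [Store.setIo, h']
  io_zero i' hi' := by
    have : i' ≠ i := by omega
    simp [Store.setIo, this, h.io_zero i' hi']

theorem StepExec.move {g r a t : ℕ} (h : a ≠ t) (s : RamState) :
    ∃ s', StepExec g (.move r a t) s s' 2 ∧ s'.mem = s.mem ∧ s'.reg r = s.reg a ∧
      ∀ q, q ≠ r → q ≠ t → s'.reg q = s.reg q := by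
  refine ⟨_, (StepExec.instr _ _ (by exact trivial)).seq (StepExec.instr _ _ (by exact trivial)), rfl, ?_, ?_⟩
  · simp [RamInstr.apply, RamOp.eval, Finsupp.update_apply, h]
  · intro q hq hq'
    simp [RamInstr.apply, Finsupp.update_apply, hq, hq']

theorem StepExec.address {g k t N : ℕ} (hg : 4 ≤ g) (ht : 2 ≤ t) (s : RamState)
    (hN : s.reg 1 = N) :
    ∃ s', StepExec g (.address k t) s s' 5 ∧ s'.mem = s.mem ∧
      s'.reg t = N + (4 * s.reg t + k) ∧ ∀ q < t, s'.reg q = s.reg q := by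
  refine ⟨_, (StepExec.instr _ _ (by exact trivial)).seq ((StepExec.instr _ _ ?_).seq
    ((StepExec.instr _ _ (by exact trivial)).seq ((StepExec.instr _ _ (by exact trivial)).seq
      (StepExec.instr _ _ (by exact trivial))))), rfl, ?_, ?_⟩
  · show Nat.size _ ≤ g
    simp only [RamInstr.apply, Finsupp.update_apply, if_true]
    exact (nat_size_le_self 4).trans hg
  · have h1 : (1 : ℕ) ≠ t := by omega
    have h2 : (1 : ℕ) ≠ t + 1 := by omega
    have h3 : t ≠ 0 := by omega
    simp [RamInstr.apply, RamOp.eval, Finsupp.update_apply, h1, h3, hN]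
    ring
  · intro q hq
    have h1 : q ≠ t := by omega
    have h2 : q ≠ t + 1 := by omega
    simp [RamInstr.apply, Finsupp.update_apply, h1, h2]

/-- Expressions have no side effects: memory and all registers below `t` end as they began. This
lets a second operand be compiled at `t + 1` without destroying the first one in `t`. Registers `0`
to `17` hold the size, the input length and the sixteen variables, whence `18 ≤ t`. -/
theorem Expr.exec_compile {g m N : ℕ} (hg : 4 ≤ g) (hm : Nat.size m ≤ g) (e : Expr) :
    ∀ {t : ℕ} {s : RamState} {σ : Store}, 18 ≤ t → Represents m N s σ →
    ∃ s', StepExec g (e.compile t) s s' (e.steps m) ∧ s'.mem = s.mem ∧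
      (∀ r < t, s'.reg r = s.reg r) ∧ s'.reg t = e.eval m σ := by
  induction e with
  | const c =>
    intro t s σ ht hs
    refine ⟨_, StepExec.instr _ _ (by exact trivial), rfl, fun r hr => ?_, ?_⟩ <;>
      simp [RamInstr.apply, Finsupp.update_apply, Expr.eval]
    omega
  | size =>
    intro t s σ ht hs
    obtain ⟨s', h1, h2, h3, h4⟩ := StepExec.move (g := g) (r := t) (a := 0) (t := t) (by omega) s
    exact ⟨s', h1, h2, fun r hr => h4 r (by omega) (by omega), by rw [h3, hs.size]; rfl⟩
  | var x =>
    intro t s σ ht hs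
    obtain ⟨s', h1, h2, h3, h4⟩ :=
      StepExec.move (g := g) (r := t) (a := 2 + x) (t := t) (by omega) s
    exact ⟨s', h1, h2, fun r hr => h4 r (by omega) (by omega), by rw [h3, hs.var]; rfl⟩
  | arr k e ih =>
    intro t s σ ht hs
    obtain ⟨s', h1, h2, h3, h4⟩ := ih ht hs
    obtain ⟨s'', h5, h6, h7, h8⟩ := StepExec.address (g := g) (k := k) (t := t) hg (by omega) s'
      (by rw [h3 1 (by omega), hs.length])
    refine ⟨_, h1.seq (h5.seq (StepExec.instr _ _ (by exact trivial))), ?_, fun r hr => ?_, ?_⟩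
    · rw [← h2, ← h6]; rfl
    · have : r ≠ t := by omega
      simp [RamInstr.apply, Finsupp.update_apply, this, h8 r hr, h3 r hr]
    · simp [RamInstr.apply, Finsupp.update_apply, h7, h6, h2, h4, hs.arr, Expr.eval]
  | io e ih =>
    intro t s σ ht hs
    obtain ⟨s', h1, h2, h3, h4⟩ := ih ht hs
    have hN : s'.reg 1 = N := by rw [h3 1 (by omega), hs.length]
    -- Truncated subtraction makes this register nonzero exactly for indices inside the block.
    -- Beyond the block the memory holds the interleaved arrays, so the result must be set to `0`
    -- there instead of being loaded.
    have hc : ((RamInstr.arith .sub (t + 1) 1 t).apply s').reg (t + 1) = N - e.eval m σ := by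
      simp [RamInstr.apply, RamOp.eval, Finsupp.update_apply, hN, h4]
    by_cases hlt : e.eval m σ < N
    · refine ⟨_, (h1.seq ((StepExec.instr _ _ (by exact trivial)).seq (.ite_nonzero (by rw [hc]; omega)
        (StepExec.instr _ _ (by exact trivial))))), h2, fun r hr => ?_, ?_⟩
      · have hr1 : r ≠ t := by omega
        have hr2 : r ≠ t + 1 := by omega
        simp [RamInstr.apply, Finsupp.update_apply, hr1, hr2, h3 r hr]
      · simp [RamInstr.apply, Finsupp.update_apply, h2, h4, hs.io _ hlt, Expr.eval]
    · refine ⟨_, (h1.seq ((StepExec.instr _ _ (by exact trivial)).seq (.ite_zero (by rw [hc]; omega)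
        (StepExec.instr _ _ (by exact trivial))))), h2, fun r hr => ?_, ?_⟩
      · have hr1 : r ≠ t := by omega
        have hr2 : r ≠ t + 1 := by omega
        simp [RamInstr.apply, Finsupp.update_apply, hr1, hr2, h3 r hr]
      · simp [RamInstr.apply, Finsupp.update_apply, Expr.eval, hs.io_zero _ (not_lt.1 hlt)]
  | add e₁ e₂ ih₁ ih₂ =>
    intro t s σ ht hs
    obtain ⟨s', h1, h2, h3, h4⟩ := ih₁ ht hs
    obtain ⟨s'', h5, h6, h7, h8⟩ := ih₂ (t := t + 1) (by omega)
      (hs.congr h2 fun r hr => h3 r (by omega))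
    refine ⟨_, h1.seq (h5.seq (StepExec.instr _ _ (by exact trivial))), by rw [← h2, ← h6]; rfl,
      fun r hr => ?_, ?_⟩
    · have hr1 : r ≠ t := by omega
      simp [RamInstr.apply, Finsupp.update_apply, hr1, h7 r (by omega), h3 r hr]
    · simp [RamInstr.apply, RamOp.eval, Finsupp.update_apply, h8, h7 t (by omega), h4, Expr.eval]
  | sub e₁ e₂ ih₁ ih₂ =>
    intro t s σ ht hs
    obtain ⟨s', h1, h2, h3, h4⟩ := ih₁ ht hs
    obtain ⟨s'', h5, h6, h7, h8⟩ := ih₂ (t := t + 1) (by omega)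
      (hs.congr h2 fun r hr => h3 r (by omega))
    refine ⟨_, h1.seq (h5.seq (StepExec.instr _ _ (by exact trivial))), by rw [← h2, ← h6]; rfl,
      fun r hr => ?_, ?_⟩
    · have hr1 : r ≠ t := by omega
      simp [RamInstr.apply, Finsupp.update_apply, hr1, h7 r (by omega), h3 r hr]
    · simp [RamInstr.apply, RamOp.eval, Finsupp.update_apply, h8, h7 t (by omega), h4, Expr.eval]
  | scale e ih =>
    intro t s σ ht hs
    obtain ⟨s', h1, h2, h3, h4⟩ := ih ht hs
    have h0 : s'.reg 0 = m := by rw [h3 0 (by omega), hs.size]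
    refine ⟨_, h1.seq (StepExec.instr _ _ ?_), by rw [← h2]; rfl, fun r hr => ?_, ?_⟩
    · show Nat.size _ ≤ g
      rw [h0]; exact hm
    · have hr1 : r ≠ t := by omega
      simp [RamInstr.apply, Finsupp.update_apply, hr1, h3 r hr]
    · simp [RamInstr.apply, RamOp.eval, Finsupp.update_apply, h0, h4, Expr.eval]
  | half e ih =>
    intro t s σ ht hs
    obtain ⟨s', h1, h2, h3, h4⟩ := ih ht hs
    refine ⟨_, h1.seq ((StepExec.instr _ _ (by exact trivial)).seq (StepExec.instr _ _ (by exact trivial))),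
      by rw [← h2]; rfl, fun r hr => ?_, ?_⟩
    · have hr1 : r ≠ t := by omega
      have hr2 : r ≠ t + 1 := by omega
      simp [RamInstr.apply, Finsupp.update_apply, hr1, hr2, h3 r hr]
    · simp [RamInstr.apply, RamOp.eval, Finsupp.update_apply, h4, Expr.eval]
  | ite c e₁ e₂ ih ih₁ ih₂ =>
    intro t s σ ht hs
    obtain ⟨s', h1, h2, h3, h4⟩ := ih ht hs
    have hs' : Represents m N s' σ := hs.congr h2 fun r hr => h3 r (by omega)
    by_cases hc : c.eval m σ = 0
    · obtain ⟨s'', h5, h6, h7, h8⟩ := ih₂ ht hs'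
      refine ⟨s'', h1.seq (.ite_zero (by rw [h4]; exact hc) (h5.weaken (Nat.le_add_left _ _))),
        by rw [h6, h2], fun r hr => by rw [h7 r hr, h3 r hr], ?_⟩
      rw [h8, Expr.eval, if_neg (not_not.2 hc)]
    · obtain ⟨s'', h5, h6, h7, h8⟩ := ih₁ ht hs'
      refine ⟨s'', h1.seq (.ite_nonzero (by rw [h4]; exact hc) (h5.weaken (Nat.le_add_right _ _))),
        by rw [h6, h2], fun r hr => by rw [h7 r hr, h3 r hr], ?_⟩
      rw [h8, Expr.eval, if_pos hc]
  | sum x e ih =>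
    intro t s σ ht hs
    obtain ⟨s₁, a1, a2, a3, a4⟩ :=
      StepExec.move (g := g) (r := t) (a := 2 + x) (t := t) (by omega) s
    set s₂ := (RamInstr.const (t + 1) 0).apply s₁ with hs₂
    have b1 : StepExec g (.instr (.const (t + 1) 0)) s₁ s₂ 1 := StepExec.instr _ _ (by exact trivial)
    have b2 : s₂.mem = s₁.mem := rfl
    have b3 : s₂.reg (t + 1) = 0 := by simp [hs₂, RamInstr.apply, Finsupp.update_apply]
    have b4 : ∀ q, q ≠ t + 1 → s₂.reg q = s₁.reg q := fun q hq => by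
      simp [hs₂, RamInstr.apply, Finsupp.update_apply, hq]
    obtain ⟨s₃, c1, c2, c3, c4⟩ :=
      StepExec.move (g := g) (r := 2 + x) (a := 0) (t := t + 2) (by omega) s₂
    -- The bound variable itself counts down. Its old value is kept in `t`, the partial sum in `t +
    -- 1`, and the summand is computed in `t + 2`; afterwards the variable is restored from `t`.
    have main : ∀ k (s : RamState), s.mem = s₃.mem → s.reg (2 + x) = k →
        (∀ r : ℕ, r < t + 1 → r ≠ 2 + x → s.reg r = s₃.reg r) →
        ∃ s', StepExec g (.loop (2 + x) (.seq (.instr (.const (t + 2) 1))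
          (.seq (.instr (.arith .sub (2 + x) (2 + x) (t + 2)))
            (.seq (e.compile (t + 2)) (.instr (.arith .add (t + 1) (t + 1) (t + 2)))))))
          s s' (k * (e.steps m + 4) + 1) ∧ s'.mem = s₃.mem ∧
          (∀ r : ℕ, r < t + 1 → r ≠ 2 + x → s'.reg r = s₃.reg r) ∧
          s'.reg (t + 1) = s.reg (t + 1) +
            ∑ i ∈ Finset.range k, e.eval m (σ.setVar x i) := by
      intro k
      induction k with
      | zero =>
        intro s h1 h2 h3
        exact ⟨s, (StepExec.loop_zero h2).weaken (by omega), h1, h3, by simp⟩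
      | succ k ihk =>
        intro s h1 h2 h3
        set u₁ := (RamInstr.const (t + 2) 1).apply s with hu₁
        set u₂ := (RamInstr.arith .sub (2 + x) (2 + x) (t + 2)).apply u₁ with hu₂
        have d1 : u₂.reg (2 + x) = k := by
          have : (2 + x : ℕ) ≠ t + 2 := by omega
          simp [hu₂, hu₁, RamInstr.apply, RamOp.eval, Finsupp.update_apply, h2, this]
        have d2 : ∀ r : ℕ, r < t + 2 → r ≠ 2 + x → u₂.reg r = s.reg r := fun r hr hr' => by
          have : r ≠ t + 2 := by omega
          simp [hu₂, hu₁, RamInstr.apply, Finsupp.update_apply, this, hr']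
        have d3 : u₂.mem = s.mem := rfl
        have hrep : Represents m N u₂ (σ.setVar x k) := by
          refine hs.setVar (by rw [d3, h1, c2, b2, a2]) d1 fun r hr hr' => ?_
          rw [d2 r (by omega) hr', h3 r (by omega) hr', c4 r hr' (by omega), b4 r (by omega),
            a4 r (by omega) (by omega)]
        obtain ⟨u₃, f1, f2, f3, f4⟩ := ih (t := t + 2) (by omega) hrep
        set u₄ := (RamInstr.arith .add (t + 1) (t + 1) (t + 2)).apply u₃ with hu₄
        have e1 : u₄.reg (t + 1) = s.reg (t + 1) + e.eval m (σ.setVar x k) := by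
          simp [hu₄, RamInstr.apply, RamOp.eval, Finsupp.update_apply, f4, f3 (t + 1) (by omega),
            d2 (t + 1) (by omega) (by omega)]
        have e2 : ∀ r < t + 2, r ≠ t + 1 → u₄.reg r = u₂.reg r := fun r hr hr' => by
          simp [hu₄, RamInstr.apply, Finsupp.update_apply, hr', f3 r hr]
        obtain ⟨s', g1, g2, g3, g4⟩ := ihk u₄ (by rw [← h1, ← d3, ← f2]; rfl)
          (by rw [e2 _ (by omega) (by omega), d1])
          (fun r hr hr' => by rw [e2 r (by omega) (by omega), d2 r (by omega) hr', h3 r hr hr'])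
        refine ⟨s', (StepExec.loop_nonzero (by omega) ((StepExec.instr _ _ (by exact trivial)).seq
          ((StepExec.instr _ _ (by exact trivial)).seq (f1.seq (StepExec.instr _ _ (by exact trivial))))) g1).weaken
          ?_, g2, g3, ?_⟩
        · rw [Nat.add_mul]; omega
        · rw [g4, e1, Finset.sum_range_succ]; ring
    obtain ⟨s₄, i1, i2, i3, i4⟩ := main m s₃ rfl
      (by rw [c3, b4 0 (by omega), a4 0 (by omega) (by omega), hs.size]) (fun _ _ _ => rfl)
    obtain ⟨s₅, j1, j2, j3, j4⟩ :=
      StepExec.move (g := g) (r := 2 + x) (a := t) (t := t + 2) (by omega) s₄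
    obtain ⟨s₆, k1, k2, k3, k4⟩ :=
      StepExec.move (g := g) (r := t) (a := t + 1) (t := t + 2) (by omega) s₅
    refine ⟨s₆, (a1.seq (b1.seq (c1.seq (i1.seq (j1.seq k1))))).weaken ?_,
      by rw [k2, j2, i2, c2, b2, a2], fun r hr => ?_, ?_⟩
    · show _ ≤ m * (e.steps m + 4) + 10
      omega
    · rw [k4 r (by omega) (by omega)]
      by_cases hr' : r = 2 + x
      · rw [hr', j3, i3 t (by omega) (by omega), c4 t (by omega) (by omega), b4 t (by omega), a3]
      · rw [j4 r hr' (by omega), i3 r (by omega) hr', c4 r hr' (by omega), b4 r (by omega),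
          a4 r (by omega) (by omega)]
    · rw [k3, j4 _ (by omega) (by omega), i4, c4 _ (by omega) (by omega), b3, zero_add]
      rfl

/-- The preservation of the registers from `18` up to `t` is what makes nested loops work: a loop
keeps its counter in `t` and compiles its body at `t + 1`. -/
theorem Cmd.exec_compile {g m N : ℕ} (hg : 4 ≤ g) (hm : Nat.size m ≤ g) (P : Cmd) :
    ∀ {t : ℕ} {s : RamState} {σ : Store}, 18 ≤ t → Represents m N s σ →
    ∃ s', StepExec g (P.compile t) s s' (P.steps m) ∧ Represents m N s' (P.run m N σ) ∧
      ∀ r < t, 18 ≤ r → s'.reg r = s.reg r := by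
  induction P with
  | skip =>
    intro t s σ ht hs
    refine ⟨_, StepExec.instr _ _ (by exact trivial), hs.congr rfl fun r hr => ?_, fun r hr _ => ?_⟩ <;>
    · have : r ≠ t := by omega
      simp [RamInstr.apply, Finsupp.update_apply, this]
  | assign x e =>
    intro t s σ ht hs
    obtain ⟨s', h1, h2, h3, h4⟩ := e.exec_compile hg hm ht hs
    obtain ⟨s'', h5, h6, h7, h8⟩ :=
      StepExec.move (g := g) (r := 2 + x) (a := t) (t := t + 1) (by omega) s'
    refine ⟨s'', h1.seq h5, hs.setVar (by rw [h6, h2]) (by rw [h7, h4]) fun r hr hr' => ?_,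
      fun r hr hr' => ?_⟩ <;>
    rw [h8 r (by omega) (by omega), h3 r (by omega)]
  | store k i e =>
    intro t s σ ht hs
    obtain ⟨s', h1, h2, h3, h4⟩ := i.exec_compile hg hm ht hs
    obtain ⟨s'', h5, h6, h7, h8⟩ := StepExec.address (g := g) (k := k) (t := t) hg (by omega) s'
      (by rw [h3 1 (by omega), hs.length])
    have hs'' : Represents m N s'' σ := hs.congr (by rw [h6, h2]) fun r hr => by
      rw [h8 r (by omega), h3 r (by omega)]
    obtain ⟨s₃, h9, h10, h11, h12⟩ := e.exec_compile hg hm (t := t + 1) (by omega) hs''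
    refine ⟨_, h1.seq (h5.seq (h9.seq (StepExec.instr _ _ (by exact trivial)))), ?_, fun r hr _ => ?_⟩
    · refine hs''.setArr ?_ fun r hr => h11 r (by omega)
      show s₃.mem.update _ _ = _
      rw [h11 t (by omega), h7, h4, h12, h10]
    · show s₃.reg r = _
      rw [h11 r (by omega), h8 r hr, h3 r hr]
  | storeIo i e =>
    intro t s σ ht hs
    obtain ⟨s', h1, h2, h3, h4⟩ := i.exec_compile hg hm ht hs
    have hN : s'.reg 1 = N := by rw [h3 1 (by omega), hs.length]
    set s₂ := (RamInstr.arith .sub (t + 1) 1 t).apply s' with hs₂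
    have hc : s₂.reg (t + 1) = N - i.eval m σ := by
      simp [hs₂, RamInstr.apply, RamOp.eval, Finsupp.update_apply, hN, h4]
    have hc' : ∀ r < t + 1, s₂.reg r = s'.reg r := fun r hr => by
      have : r ≠ t + 1 := by omega
      simp [hs₂, RamInstr.apply, Finsupp.update_apply, this]
    have hrep : Represents m N s₂ σ := hs.congr h2 fun r hr => by
      rw [hc' r (by omega), h3 r (by omega)]
    by_cases hlt : i.eval m σ < N
    · obtain ⟨s₃, h9, h10, h11, h12⟩ := e.exec_compile hg hm (t := t + 1) (by omega) hrep
      refine ⟨_, h1.seq ((StepExec.instr _ _ (by exact trivial)).seq (.ite_nonzero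
        (by rw [← hs₂, hc]; omega) (h9.seq (StepExec.instr _ _ (by exact trivial))))), ?_, fun r hr _ => ?_⟩
      · rw [Cmd.run, if_pos hlt]
        refine hrep.setIo hlt ?_ fun r hr => h11 r (by omega)
        show s₃.mem.update _ _ = _
        rw [h11 t (by omega), hc' t (by omega), h4, h12, h10]
      · show s₃.reg r = _
        rw [h11 r (by omega), hc' r (by omega), h3 r hr]
    · refine ⟨_, (h1.seq ((StepExec.instr _ _ (by exact trivial)).seq (.ite_zero
        (by rw [← hs₂, hc]; omega) (StepExec.instr _ _ (by exact trivial))))).weaken ?_, ?_, fun r hr _ => ?_⟩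
      · show _ ≤ i.steps m + (1 + (1 + (e.steps m + 1)))
        omega
      · rw [Cmd.run, if_neg hlt]
        refine hrep.congr rfl fun r hr => ?_
        have h5 : r ≠ t := by omega
        have h6 : r ≠ t + 1 := by omega
        simp [hs₂, RamInstr.apply, Finsupp.update_apply, h5, h6]
      · have h5 : r ≠ t := by omega
        have h6 : r ≠ t + 1 := by omega
        simp [RamInstr.apply, Finsupp.update_apply, h5, h6, h3 r hr]
  | seq P Q ih₁ ih₂ =>
    intro t s σ ht hs
    obtain ⟨s', h1, h2, h3⟩ := ih₁ ht hs
    obtain ⟨s'', h4, h5, h6⟩ := ih₂ ht h2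
    exact ⟨s'', h1.seq h4, h5, fun r hr hr' => by rw [h6 r hr hr', h3 r hr hr']⟩
  | ite c P Q ih₁ ih₂ =>
    intro t s σ ht hs
    obtain ⟨s', h1, h2, h3, h4⟩ := c.exec_compile hg hm ht hs
    have hs' : Represents m N s' σ := hs.congr h2 fun r hr => h3 r (by omega)
    by_cases hc : c.eval m σ = 0
    · obtain ⟨s'', h5, h6, h7⟩ := ih₂ ht hs'
      refine ⟨s'', h1.seq (.ite_zero (by rw [h4]; exact hc) (h5.weaken (Nat.le_add_left _ _))),
        ?_, fun r hr hr' => by rw [h7 r hr hr', h3 r hr]⟩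
      rw [Cmd.run, if_neg (not_not.2 hc)]; exact h6
    · obtain ⟨s'', h5, h6, h7⟩ := ih₁ ht hs'
      refine ⟨s'', h1.seq (.ite_nonzero (by rw [h4]; exact hc)
        (h5.weaken (Nat.le_add_right _ _))), ?_, fun r hr hr' => by rw [h7 r hr hr', h3 r hr]⟩
      rw [Cmd.run, if_pos hc]; exact h6
  | loop x P ih =>
    intro t s σ ht hs
    obtain ⟨s₁, a1, a2, a3, a4⟩ :=
      StepExec.move (g := g) (r := t) (a := 0) (t := t) (by omega) s
    -- The counter is the register `t`, and the variable `x` only receives a copy of it, so the body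
    -- is free to overwrite `x`. The store is generalised because it changes from round to round.
    have main : ∀ k (s : RamState) (σ : Store), Represents m N s σ → s.reg t = k →
        ∃ s', StepExec g (.loop t (.seq (.instr (.const (t + 1) 1))
      (.seq (.instr (.arith .sub t t (t + 1))) (.seq (.move (2 + x) t (t + 1))
        (P.compile (t + 1)))))) s s' (k * (5 + P.steps m) + 1) ∧
          Represents m N s' (Store.iterDown (P.run m N) x k σ) ∧
          ∀ r < t, 18 ≤ r → s'.reg r = s.reg r := by
      intro k
      induction k with
      | zero =>
        intro s σ h1 h2
        exact ⟨s, (StepExec.loop_zero h2).weaken (by omega), h1, fun _ _ _ => rfl⟩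
      | succ k ihk =>
        intro s σ h1 h2
        set u₁ := (RamInstr.const (t + 1) 1).apply s with hu₁
        set u₂ := (RamInstr.arith .sub t t (t + 1)).apply u₁ with hu₂
        have d1 : u₂.reg t = k := by
          simp [hu₂, hu₁, RamInstr.apply, RamOp.eval, Finsupp.update_apply, h2]
        have d2 : ∀ r < t, u₂.reg r = s.reg r := fun r hr => by
          have h : r ≠ t + 1 := by omega
          have h' : r ≠ t := by omega
          simp [hu₂, hu₁, RamInstr.apply, Finsupp.update_apply, h, h']
        obtain ⟨u₃, f1, f2, f3, f4⟩ :=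
          StepExec.move (g := g) (r := 2 + x) (a := t) (t := t + 1) (by omega) u₂
        have hrep : Represents m N u₃ (σ.setVar x k) := by
          refine h1.setVar (by rw [f2]; rfl) (by rw [f3, d1]) fun r hr hr' => ?_
          rw [f4 r hr' (by omega), d2 r (by omega)]
        obtain ⟨u₄, e1, e2, e3⟩ := ih (t := t + 1) (by omega) hrep
        obtain ⟨s', g1, g2, g3⟩ := ihk u₄ _ e2
          (by rw [e3 t (by omega) ht, f4 t (by omega) (by omega), d1])
        refine ⟨s', (StepExec.loop_nonzero (by omega) ((StepExec.instr _ _ (by exact trivial)).seq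
          ((StepExec.instr _ _ (by exact trivial)).seq (f1.seq e1))) g1).weaken ?_, g2, fun r hr hr' => ?_⟩
        · rw [Nat.add_mul]; omega
        · rw [g3 r hr hr', e3 r (by omega) hr', f4 r (by omega) (by omega), d2 r hr]
    obtain ⟨s', b1, b2, b3⟩ := main m s₁ σ
      (hs.congr a2 fun r hr => a4 r (by omega) (by omega)) (by rw [a3, hs.size])
    exact ⟨s', a1.seq b1, b2, fun r hr hr' => by rw [b3 r hr hr', a4 r (by omega) (by omega)]⟩

/-! ## Programs that repeat a command an unbounded number of times -/

/-- The machine state represents the store, and all registers for intermediate results are `0`. -/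
structure CleanlyRepresents (m N : ℕ) (s : RamState) (σ : Store) : Prop extends
    Represents m N s σ where
  clean : ∀ r, 18 ≤ r → s.reg r = 0

/-- All numbers in the store and all indices of nonzero array entries are at most `B`. -/
structure Store.Within (σ : Store) (B : ℕ) : Prop where
  var : ∀ x, σ.var x ≤ B
  arr : ∀ k i, σ.arr k i ≤ B
  index : ∀ k i, σ.arr k i ≠ 0 → i ≤ B
  io : ∀ i, σ.io i ≤ B

theorem arrayFits_of_le {f : ℕ →₀ ℕ} {K : ℕ} (h : ∀ a, f a ≠ 0 → a < K ∧ f a ≤ K) :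
    ArrayFits f K K := by
  constructor
  · have : f.support ⊆ Finset.range K := fun a ha =>
      Finset.mem_range.2 (h a (Finsupp.mem_support_iff.1 ha)).1
    simpa using Finset.card_le_card this
  · intro a ha
    exact ⟨(nat_size_le_self _).trans (h a ha).1.le, (nat_size_le_self _).trans (h a ha).2⟩

/-- The size of a clean state depends only on the store, not on how many steps led to it. This is
what prevents exponentially many rounds from accumulating space. -/
theorem CleanlyRepresents.fits {m N B : ℕ} {s : RamState} {σ : Store}
    (h : CleanlyRepresents m N s σ) (hσ : σ.Within B) :
    s.Fits (18 + m + N + 5 * B + 4) (18 + m + N + 5 * B + 4) := by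
  constructor
  · refine arrayFits_of_le fun a ha => ?_
    have ha18 : a < 18 := by
      by_contra hc
      exact ha (h.clean a (not_lt.1 hc))
    refine ⟨by omega, ?_⟩
    rcases Nat.lt_or_ge a 2 with h2 | h2
    · interval_cases a
      · rw [h.size]; omega
      · rw [h.length]; omega
    · obtain ⟨b, rfl⟩ := Nat.exists_eq_add_of_le h2
      have := h.var ⟨b, by omega⟩
      have h' := hσ.var ⟨b, by omega⟩
      simp only at this
      omega
  · refine arrayFits_of_le fun a ha => ?_
    rcases Nat.lt_or_ge a N with h2 | h2
    · have := hσ.io a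
      rw [h.io a h2]
      omega
    · obtain ⟨b, rfl⟩ := Nat.exists_eq_add_of_le h2
      -- Undo the interleaving: cell `N + b` is entry `b / 4` of array `b % 4`.
      have hb := h.arr ⟨b % 4, Nat.mod_lt _ (by omega)⟩ (b / 4)
      have hdm : 4 * (b / 4) + b % 4 = b := Nat.div_add_mod b 4
      simp only [hdm] at hb
      rw [hb] at ha ⊢
      have h1 := hσ.index _ _ ha
      have h3 := hσ.arr ⟨b % 4, Nat.mod_lt _ (by omega)⟩ (b / 4)
      omega

/-- Set the registers `18, …, 18 + k` to `0`. -/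
def RamProg.clear : ℕ → RamProg
  | 0 => .instr (.const 18 0)
  | k + 1 => .seq (RamProg.clear k) (.instr (.const (18 + (k + 1)) 0))

theorem StepExec.clear {g : ℕ} (k : ℕ) (s : RamState) :
    ∃ s', StepExec g (.clear k) s s' (k + 1) ∧ s'.mem = s.mem ∧
      (∀ r < 18, s'.reg r = s.reg r) ∧ (∀ r, 18 + k < r → s'.reg r = s.reg r) ∧
      ∀ r, 18 ≤ r → r ≤ 18 + k → s'.reg r = 0 := by
  induction k with
  | zero =>
    refine ⟨_, StepExec.instr _ _ (by exact trivial), rfl, fun r hr => ?_, fun r hr => ?_,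
      fun r hr hr' => ?_⟩
    · have : r ≠ 18 := by omega
      simp [RamInstr.apply, Finsupp.update_apply, this]
    · have : r ≠ 18 := by omega
      simp [RamInstr.apply, Finsupp.update_apply, this]
    · have : r = 18 := by omega
      simp [RamInstr.apply, Finsupp.update_apply, this]
  | succ k ih =>
    obtain ⟨s', h1, h2, h3, h4, h5⟩ := ih
    refine ⟨_, h1.seq (StepExec.instr _ _ (by exact trivial)), by rw [← h2]; rfl,
      fun r hr => ?_, fun r hr => ?_, fun r hr hr' => ?_⟩
    · have : r ≠ 18 + (k + 1) := by omega
      simp [RamInstr.apply, Finsupp.update_apply, this, h3 r hr]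
    · have : r ≠ 18 + (k + 1) := by omega
      simp [RamInstr.apply, Finsupp.update_apply, this, h4 r (by omega)]
    · by_cases h : r = 18 + (k + 1)
      · simp [RamInstr.apply, Finsupp.update_apply, h]
      · simp [RamInstr.apply, Finsupp.update_apply, h, h5 r hr (by omega)]

namespace Cmd

/-- Run a command and then reset the registers for intermediate results. -/
def cleanCompile (P : Cmd) : RamProg :=
  .seq (P.compile 18) (.clear (P.compile 18).bound)

def cleanSteps (P : Cmd) (m : ℕ) : ℕ :=
  P.steps m + ((P.compile 18).bound + 1)

/-- A single parameter that bounds the constants and written registers of the program and the bit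
lengths of its multipliers, which are `m` and the `4` of address computations. -/
def bits (P : Cmd) (m : ℕ) : ℕ :=
  m + P.cleanCompile.bound + 4

/-- This and `spaceBound` are the estimates of `StepExec.ramExec`, started with the sizes supplied
by `CleanlyRepresents.fits`. -/
def timeBound (P : Cmd) (m N B : ℕ) : ℕ :=
  P.cleanSteps m * (1 + P.bits m +
    2 * ((18 + m + N + 5 * B + 4) + P.cleanSteps m * (P.bits m + 1)))

def spaceBound (P : Cmd) (m N B : ℕ) : ℕ :=
  4 * ((18 + m + N + 5 * B + 4) + P.cleanSteps m) *
    ((18 + m + N + 5 * B + 4) + P.cleanSteps m * (P.bits m + 1))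

theorem polyBounded_cleanSteps (P : Cmd) : PolyBounded P.cleanSteps :=
  P.polyBounded_steps.add (.const _)

theorem polyBounded_bits (P : Cmd) : PolyBounded P.bits :=
  (PolyBounded.id.add (.const _)).add (.const _)

theorem stepExec_cleanCompile (P : Cmd) {m N : ℕ} {s : RamState} {σ : Store}
    (hs : CleanlyRepresents m N s σ) :
    ∃ s', StepExec (P.bits m) P.cleanCompile s s' (P.cleanSteps m) ∧
      CleanlyRepresents m N s' (P.run m N σ) := by
  obtain ⟨s', h1, h2, h3⟩ := P.exec_compile (g := P.bits m) (Nat.le_add_left _ _)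
    ((nat_size_le_self m).trans (by unfold bits; omega)) le_rfl hs.toRepresents
  obtain ⟨s'', h4, h5, h6, h7, h8⟩ := StepExec.clear (g := P.bits m) (P.compile 18).bound s'
  refine ⟨s'', h1.seq h4, h2.congr h5 h6, fun r hr => ?_⟩
  by_cases hr' : r ≤ 18 + (P.compile 18).bound
  · exact h8 r hr hr'
  -- Registers above the cleared range are beyond the bound of the program, so it never wrote them
  -- and they are still `0`.
  · rw [h7 r (by omega), h1.reg_eq (by omega), hs.clean r hr]

theorem ramExec_cleanCompile (P : Cmd) {m N B : ℕ} {s : RamState} {σ : Store}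
    (hs : CleanlyRepresents m N s σ) (hσ : σ.Within B) :
    ∃ s' t u, RamExec P.cleanCompile s s' t u ∧ t ≤ P.timeBound m N B ∧ u ≤ P.spaceBound m N B ∧
      CleanlyRepresents m N s' (P.run m N σ) := by
  obtain ⟨s', h1, h2⟩ := P.stepExec_cleanCompile hs
  obtain ⟨t, u, h3, h4, h5, -⟩ := h1.ramExec (by unfold bits; omega) (hs.fits hσ)
  exact ⟨s', t, u, h3, h4, h5, h2⟩

/-- A nonnegative potential that drops by at least one per round limits the number of rounds to `j`.
Time adds up over the rounds, whereas space is a maximum over clean states within the fixed bound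
`B`, so `j` does not enter the space bound. -/
theorem ramExec_loop (P : Cmd) {m N B : ℕ} (x : Fin 16) (Inv : Store → Prop) (Φ : Store → ℝ)
    (hB : ∀ σ, Inv σ → σ.Within B) (hΦ : ∀ σ, Inv σ → 0 ≤ Φ σ)
    (hstep : ∀ σ, Inv σ → σ.var x ≠ 0 → Inv (P.run m N σ) ∧ Φ (P.run m N σ) + 1 ≤ Φ σ) :
    ∀ (j : ℕ) {s : RamState} {σ : Store}, CleanlyRepresents m N s σ → Inv σ → Φ σ ≤ j →
    ∃ s' σ' t u, RamExec (.loop (2 + x) P.cleanCompile) s s' t u ∧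
      CleanlyRepresents m N s' σ' ∧ Inv σ' ∧ σ'.var x = 0 ∧
      t ≤ j * (1 + B + P.timeBound m N B) + 1 ∧ u ≤ P.spaceBound m N B := by
  have hdone : ∀ (j : ℕ) {s : RamState} {σ : Store}, CleanlyRepresents m N s σ → Inv σ →
      σ.var x = 0 →
      ∃ s' σ' t u, RamExec (.loop (2 + x) P.cleanCompile) s s' t u ∧
      CleanlyRepresents m N s' σ' ∧ Inv σ' ∧ σ'.var x = 0 ∧
      t ≤ j * (1 + B + P.timeBound m N B) + 1 ∧ u ≤ P.spaceBound m N B := by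
    intro j s σ hs hσ h0
    have h0' : s.reg (2 + x) = 0 := by rw [hs.var, h0]
    refine ⟨s, σ, _, _, RamExec.loop_zero h0', hs, hσ, h0, ?_, ?_⟩
    · rw [h0']; simp
    · refine (hs.fits (hB σ hσ)).space_le.trans ?_
      unfold spaceBound
      exact Nat.mul_le_mul (Nat.mul_le_mul_left _ (Nat.le_add_right _ _)) (Nat.le_add_right _ _)
  intro j
  induction j with
  | zero =>
    intro s σ hs hσ hj
    by_cases h0 : σ.var x = 0
    · exact hdone 0 hs hσ h0
    -- With no budget left, a further round would make the potential negative.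
    · obtain ⟨h1, h2⟩ := hstep σ hσ h0
      have := hΦ _ h1
      push_cast at hj
      linarith
  | succ j ih =>
    intro s σ hs hσ hj
    by_cases h0 : σ.var x = 0
    · exact hdone _ hs hσ h0
    · obtain ⟨h1, h2⟩ := hstep σ hσ h0
      obtain ⟨s₁, t₁, u₁, a1, a2, a3, a4⟩ := P.ramExec_cleanCompile hs (hB σ hσ)
      obtain ⟨s', σ', t, u, b1, b2, b3, b4, b5, b6⟩ := ih a4 h1 (by push_cast at hj; linarith)
      have hv := hs.var x
      refine ⟨s', σ', _, _, RamExec.loop_nonzero (by rw [hv]; exact h0) a1 b1, b2, b3, b4, ?_,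
        max_le a3 b6⟩
      have h4 : Nat.size (s.reg (2 + x)) ≤ B := by
        rw [hv]; exact (nat_size_le_self _).trans ((hB σ hσ).var x)
      rw [Nat.add_mul, one_mul]
      omega

end Cmd

/-! ### Complete programs -/

/-- The number `n` of vertices and the adjacency matrix, as the contents of an array. -/
noncomputable def graphStore {n : ℕ} (G : SimpleGraph (Fin n)) : Store where
  var _ := 0
  arr _ _ := 0
  io := (graphInput G).mem

/-- Set up the size parameter and the length of the input: `c * n` and `n * n + 1`. -/
def RamProg.setup (c : ℕ) : RamProg :=
  .seq (.instr (.load 0 0)) (.seq (.instr (.arith .mul 1 0 0)) (.seq (.instr (.const 2 1))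
    (.seq (.instr (.arith .add 1 1 2)) (.seq (.instr (.const 2 c))
      (.seq (.instr (.arith .mul 0 0 2)) (.instr (.const 2 0)))))))

theorem graphInput_mem_le {n : ℕ} (G : SimpleGraph (Fin n)) (a : ℕ) :
    (graphInput G).mem a ≤ n + 1 := by
  simp only [graphInput, Finsupp.onFinset_apply]
  split_ifs <;> omega

theorem graphInput_mem_eq_zero {n : ℕ} (G : SimpleGraph (Fin n)) {a : ℕ} (ha : n * n + 1 ≤ a) :
    (graphInput G).mem a = 0 := by
  simp only [graphInput, Finsupp.onFinset_apply]
  rw [if_neg (by omega), if_neg]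
  rintro ⟨i, j, rfl, -⟩
  have h1 : ((i : ℕ) + 1) * n ≤ n * n := Nat.mul_le_mul_right n i.isLt
  have h2 := j.isLt
  rw [Nat.add_mul] at h1
  omega

theorem graphInput_mem_zero {n : ℕ} (G : SimpleGraph (Fin n)) : (graphInput G).mem 0 = n := by
  simp [graphInput]

theorem graphInput_fits {n : ℕ} (G : SimpleGraph (Fin n)) :
    (graphInput G).Fits (n * n + n + 1) (n * n + n + 1) := by
  refine ⟨arrayFits_of_le fun a ha => absurd rfl ha, arrayFits_of_le fun a ha => ⟨?_, ?_⟩⟩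
  · by_contra hc
    exact ha (graphInput_mem_eq_zero G (by omega))
  · exact (graphInput_mem_le G a).trans (by omega)

/-- The multipliers here are `n` and `c`, whence the bit bound `n + c + 4`. Register `2` belongs to
variable `0`, so it is reset at the end after its use as scratch space. -/
theorem StepExec.setup {n : ℕ} (c : ℕ) (G : SimpleGraph (Fin n)) :
    ∃ s', StepExec (n + c + 4) (.setup c) (graphInput G) s' 7 ∧
      CleanlyRepresents (c * n) (n * n + 1) s' (graphStore G) := by
  have h0 := graphInput_mem_zero G
  have hr : (graphInput G).reg = 0 := rfl
  refine ⟨_, (StepExec.instr _ _ (by exact trivial)).seq ((StepExec.instr _ _ ?_).seq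
    ((StepExec.instr _ _ (by exact trivial)).seq ((StepExec.instr _ _ (by exact trivial)).seq
    ((StepExec.instr _ _ (by exact trivial)).seq ((StepExec.instr _ _ ?_).seq
      (StepExec.instr _ _ (by exact trivial))))))), ?_⟩
  · show Nat.size _ ≤ _
    simp [RamInstr.apply, hr, h0]
    exact (nat_size_le_self n).trans (by omega)
  · show Nat.size _ ≤ _
    simp [RamInstr.apply, hr]
    exact (nat_size_le_self c).trans (by omega)
  · refine ⟨⟨?_, ?_, fun x => ?_, fun k i => ?_, fun i hi => rfl, fun i hi => ?_⟩,
      fun r hr' => ?_⟩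
    · simp [RamInstr.apply, RamOp.eval, Finsupp.update_apply, hr, h0, mul_comm]
    · simp [RamInstr.apply, RamOp.eval, Finsupp.update_apply, hr, h0]
    · have h2 : (2 + x : ℕ) ≠ 0 := by omega
      have h3 : (2 + x : ℕ) ≠ 1 := by omega
      by_cases hx : x = 0
      · simp [RamInstr.apply, Finsupp.update_apply, hx, graphStore]
      · simp [RamInstr.apply, Finsupp.update_apply, hr, graphStore, h3, hx]
    · exact graphInput_mem_eq_zero G (by omega)
    · exact graphInput_mem_eq_zero G hi
    · have h1 : r ≠ 0 := by omega
      have h2 : r ≠ 1 := by omega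
      have h3 : r ≠ 2 := by omega
      simp [RamInstr.apply, Finsupp.update_apply, hr, h1, h2, h3]

/-- Preparation, repetition of `body` as long as the variable `x` is nonzero, and output. -/
def searchProg (c : ℕ) (pre body post : Cmd) (x : Fin 16) : RamProg :=
  .seq (.setup c) (.seq pre.cleanCompile (.seq (.loop (2 + x) body.cleanCompile)
    post.cleanCompile))

/-- The polynomials depend on the program and on `B` alone, and are fixed before the graph, the
invariant and the potential. The number of rounds `j` multiplies the time and leaves the space
untouched; this is how exponential time goes together with polynomial space. -/
theorem haltsWithin_searchProg (c : ℕ) (pre body post : Cmd) (x : Fin 16) {B : ℕ → ℕ}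
    (hB : PolyBounded B) : ∃ (p : ℕ → ℕ) (space : Polynomial ℕ), PolyBounded p ∧
    ∀ (n : ℕ) (G : SimpleGraph (Fin n)) (Q : RamState → Prop) (Inv : Store → Prop)
      (Φ : Store → ℝ) (j : ℕ),
      (graphStore G).Within (B n) →
      (∀ σ, Inv σ → σ.Within (B n)) → (∀ σ, Inv σ → 0 ≤ Φ σ) →
      (∀ σ, Inv σ → σ.var x ≠ 0 →
        Inv (body.run (c * n) (n * n + 1) σ) ∧ Φ (body.run (c * n) (n * n + 1) σ) + 1 ≤ Φ σ) →
      Inv (pre.run (c * n) (n * n + 1) (graphStore G)) →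
      Φ (pre.run (c * n) (n * n + 1) (graphStore G)) ≤ j →
      (∀ σ s, Inv σ → σ.var x = 0 →
        Represents (c * n) (n * n + 1) s (post.run (c * n) (n * n + 1) σ) → Q s) →
      (searchProg c pre body post x).HaltsWithin (graphInput G) ((j + 1) * p n) (space.eval n)
        Q := by
  have hm : PolyBounded fun n => c * n := (PolyBounded.const c).mul .id
  have hN : PolyBounded fun n => n * n + 1 := (PolyBounded.id.mul .id).add (.const 1)
  have hK : PolyBounded fun n => 18 + c * n + (n * n + 1) + 5 * B n + 4 :=
    ((((PolyBounded.const 18).add hm).add hN).add ((PolyBounded.const 5).mul hB)).add (.const 4)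
  have htime : ∀ P : Cmd, PolyBounded fun n => P.timeBound (c * n) (n * n + 1) (B n) := fun P =>
    (P.polyBounded_cleanSteps.comp_mul_left c).mul
      (((PolyBounded.const 1).add (P.polyBounded_bits.comp_mul_left c)).add
        ((PolyBounded.const 2).mul (hK.add ((P.polyBounded_cleanSteps.comp_mul_left c).mul
          ((P.polyBounded_bits.comp_mul_left c).add (.const 1))))))
  have hspace : ∀ P : Cmd, PolyBounded fun n => P.spaceBound (c * n) (n * n + 1) (B n) := fun P =>
    ((PolyBounded.const 4).mul (hK.add (P.polyBounded_cleanSteps.comp_mul_left c))).mul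
      (hK.add ((P.polyBounded_cleanSteps.comp_mul_left c).mul
          ((P.polyBounded_bits.comp_mul_left c).add (.const 1))))
  have hg : PolyBounded fun n => n + c + 4 := (PolyBounded.id.add (.const c)).add (.const 4)
  have hn : PolyBounded fun n => n * n + n + 1 :=
    ((PolyBounded.id.mul .id).add .id).add (.const 1)
  let T₀ : ℕ → ℕ := fun n => 7 * (1 + (n + c + 4) + 2 * ((n * n + n + 1) + 7 * ((n + c + 4) + 1)))
  let S₀ : ℕ → ℕ := fun n => 4 * ((n * n + n + 1) + 7) * ((n * n + n + 1) + 7 * ((n + c + 4) + 1))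
  have hT₀ : PolyBounded T₀ := (PolyBounded.const 7).mul (((PolyBounded.const 1).add hg).add
    ((PolyBounded.const 2).mul (hn.add ((PolyBounded.const 7).mul (hg.add (.const 1))))))
  have hS₀ : PolyBounded S₀ := ((PolyBounded.const 4).mul (hn.add (.const 7))).mul
    (hn.add ((PolyBounded.const 7).mul (hg.add (.const 1))))
  obtain ⟨space, hsp⟩ := ((hS₀.add (hspace pre)).add (hspace body)).add (hspace post)
  refine ⟨fun n => T₀ n + pre.timeBound (c * n) (n * n + 1) (B n) +
    (1 + B n + body.timeBound (c * n) (n * n + 1) (B n) + 1) +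
      post.timeBound (c * n) (n * n + 1) (B n), space,
    ((hT₀.add (htime pre)).add ((((PolyBounded.const 1).add hB).add (htime body)).add
      (.const 1))).add (htime post), ?_⟩
  intro n G Q Inv Φ j h0 h1 h2 h3 h4 h5 h6
  obtain ⟨s₁, a1, a2⟩ := StepExec.setup c G
  have hbd : (RamProg.setup c).bound ≤ n + c + 4 := by
    simp only [RamProg.setup, RamProg.bound, RamInstr.bound]
    omega
  obtain ⟨t₁, u₁, b1, b2, b3, -⟩ := a1.ramExec hbd (graphInput_fits G)
  obtain ⟨s₂, t₂, u₂, d1, d2, d3, d4⟩ := pre.ramExec_cleanCompile a2 h0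
  obtain ⟨s₃, σ, t₃, u₃, e1, e2, e3, e4, e5, e6⟩ :=
    body.ramExec_loop x Inv Φ h1 h2 h3 j d4 h4 h5
  obtain ⟨s₄, t₄, u₄, f1, f2, f3, f4⟩ := post.ramExec_cleanCompile e2 (h1 σ e3)
  refine ⟨s₄, _, _, RamExec.seq b1 (RamExec.seq d1 (RamExec.seq e1 f1)), ?_, ?_,
    h6 σ s₄ e3 e4 f4.toRepresents⟩
  · beta_reduce
    change t₁ ≤ T₀ n at b2
    generalize T₀ n = T at *
    generalize pre.timeBound (c * n) (n * n + 1) (B n) = T₁ at *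
    generalize body.timeBound (c * n) (n * n + 1) (B n) = T₂ at *
    generalize post.timeBound (c * n) (n * n + 1) (B n) = T₃ at *
    generalize 1 + B n + T₂ = X at *
    have : (j + 1) * (T + T₁ + (X + 1) + T₃) =
        j * X + (T + T₁ + X + 1 + T₃) + j * (T + T₁ + T₃ + 1) := by ring
    omega
  · refine le_trans ?_ (hsp n)
    beta_reduce
    change u₁ ≤ S₀ n at b3
    generalize S₀ n = S at *
    refine max_le (by omega) (max_le (by omega) (max_le (by omega) (by omega)))

/-! ## Sets of vertices that induce a matching -/

/-- Every vertex of `W` has exactly one neighbour in `W`. -/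
def InducesMatching {V : Type*} (G : SimpleGraph V) (W : Finset V) : Prop :=
  ∀ w ∈ W, ∃! u, u ∈ W ∧ G.Adj w u

namespace InducesMatching

variable {V : Type*} {G : SimpleGraph V} {W F : Finset V}

theorem eq_of_adj (h : InducesMatching G W) {w u u' : V} (hw : w ∈ W) (hu : u ∈ W)
    (hu' : u' ∈ W) (ha : G.Adj w u) (ha' : G.Adj w u') : u = u' :=
  (h w hw).unique ⟨hu, ha⟩ ⟨hu', ha'⟩

theorem empty : InducesMatching G ∅ := fun w hw => absurd hw (Finset.notMem_empty w)

variable [DecidableEq V]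

theorem pair {a x : V} (h : G.Adj a x) : InducesMatching G {a, x} := by
  intro w hw
  rw [Finset.mem_insert, Finset.mem_singleton] at hw
  rcases hw with rfl | rfl
  · refine ⟨x, ⟨by simp, h⟩, fun u ⟨hu, hu'⟩ => ?_⟩
    rw [Finset.mem_insert, Finset.mem_singleton] at hu
    rcases hu with rfl | rfl
    · exact absurd hu' (G.loopless.irrefl _)
    · rfl
  · refine ⟨a, ⟨by simp, h.symm⟩, fun u ⟨hu, hu'⟩ => ?_⟩
    rw [Finset.mem_insert, Finset.mem_singleton] at hu
    rcases hu with rfl | rfl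
    · rfl
    · exact absurd hu' (G.loopless.irrefl _)

theorem union (hW : InducesMatching G W) (hF : InducesMatching G F)
    (h : ∀ w ∈ W, ∀ z ∈ F, ¬ G.Adj w z) : InducesMatching G (W ∪ F) := by
  intro w hw
  rcases Finset.mem_union.1 hw with hw | hw
  · obtain ⟨u, ⟨hu, hwu⟩, huniq⟩ := hW w hw
    refine ⟨u, ⟨Finset.mem_union_left _ hu, hwu⟩, fun z ⟨hz, hwz⟩ => ?_⟩
    rcases Finset.mem_union.1 hz with hz | hz
    · exact huniq z ⟨hz, hwz⟩
    · exact absurd hwz (h w hw z hz)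
  · obtain ⟨u, ⟨hu, hwu⟩, huniq⟩ := hF w hw
    refine ⟨u, ⟨Finset.mem_union_right _ hu, hwu⟩, fun z ⟨hz, hwz⟩ => ?_⟩
    rcases Finset.mem_union.1 hz with hz | hz
    · exact absurd hwz.symm (h z hz w hw)
    · exact huniq z ⟨hz, hwz⟩

theorem sdiff_pair (h : InducesMatching G W) {a x : V} (ha : a ∈ W) (hx : x ∈ W)
    (hax : G.Adj a x) : InducesMatching G (W \ {a, x}) ∧
      ∀ w ∈ W \ {a, x}, ¬ G.Adj a w ∧ ¬ G.Adj x w := by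
  have key : ∀ w ∈ W \ {a, x}, ¬ G.Adj a w ∧ ¬ G.Adj x w := by
    intro w hw
    simp only [Finset.mem_sdiff, Finset.mem_insert, Finset.mem_singleton, not_or] at hw
    exact ⟨fun h' => hw.2.2 (h.eq_of_adj ha hw.1 hx h' hax),
      fun h' => hw.2.1 (h.eq_of_adj hx hw.1 ha h' hax.symm)⟩
  refine ⟨fun w hw => ?_, key⟩
  obtain ⟨u, ⟨hu, hwu⟩, huniq⟩ := h w (Finset.mem_sdiff.1 hw).1
  refine ⟨u, ⟨?_, hwu⟩, fun z hz => huniq z ⟨(Finset.mem_sdiff.1 hz.1).1, hz.2⟩⟩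
  simp only [Finset.mem_sdiff, Finset.mem_insert, Finset.mem_singleton, not_or]
  exact ⟨hu, fun e => (key w hw).1 (e ▸ hwu.symm), fun e => (key w hw).2 (e ▸ hwu.symm)⟩

/-- A vertex with exactly one neighbour `a` in `W` can replace the partner of `a`. -/
theorem swap (h : InducesMatching G W) {u a x : V} (hu : u ∉ W) (ha : a ∈ W) (hx : x ∈ W)
    (hua : G.Adj u a) (hax : G.Adj a x) (huniq : ∀ w ∈ W, G.Adj u w → w = a) :
    InducesMatching G (insert u (W.erase x)) := by
  have h1 := h.sdiff_pair ha hx hax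
  have he : insert u (W.erase x) = W \ {a, x} ∪ {u, a} := by
    ext z
    have hne : a ≠ x := hax.ne
    simp only [Finset.mem_insert, Finset.mem_erase, Finset.mem_union, Finset.mem_sdiff,
      Finset.mem_singleton, not_or]
    by_cases hza : z = a
    · subst hza; simp [ha, hne]
    · simp [hza]; tauto
  rw [he]
  refine h1.1.union (pair hua) fun w hw z hz hwz => ?_
  rw [Finset.mem_insert, Finset.mem_singleton] at hz
  rcases hz with rfl | rfl
  · have := huniq w (Finset.mem_sdiff.1 hw).1 hwz.symm
    subst this
    simp at hw
  · exact (h1.2 w hw).1 hwz.symm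

theorem card_swap {u x : V} (hu : u ∉ W) (hx : x ∈ W) : (insert u (W.erase x)).card = W.card := by
  rw [Finset.card_insert_of_notMem fun hc => hu (Finset.mem_of_mem_erase hc),
    Finset.card_erase_of_mem hx]
  have := Finset.card_pos.2 ⟨x, hx⟩
  omega

theorem two_pairs {a x b y : V} (hax : G.Adj a x) (hby : G.Adj b y) (hab : ¬ G.Adj a b)
    (hay : ¬ G.Adj a y) (hxb : ¬ G.Adj b x) (hxy : ¬ G.Adj x y) :
    InducesMatching G {a, x, b, y} := by
  have he : ({a, x, b, y} : Finset V) = {a, x} ∪ {b, y} := by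
    ext z
    simp only [Finset.mem_insert, Finset.mem_singleton, Finset.mem_union]
    tauto
  rw [he]
  refine (pair hax).union (pair hby) fun w hw z hz hwz => ?_
  simp only [Finset.mem_insert, Finset.mem_singleton] at hw hz
  rcases hw with rfl | rfl <;> rcases hz with rfl | rfl
  exacts [hab hwz, hay hwz, hxb hwz.symm, hxy hwz]

end InducesMatching

/-! ### Independent edge sets and the sets of their endpoints -/

/-- Independence of the endpoints after deleting `M` says that every edge between endpoints lies in
`M`. Since the edges of `M` are disjoint, each endpoint then has exactly one neighbour among the
endpoints, and `M` can be read off from `W`. -/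
theorem InducesMatching.of_isIndepEdgeSet {V : Type*} [DecidableEq V] {G : SimpleGraph V}
    {M : Finset (Sym2 V)} (h : IsIndepEdgeSet G M) :
    ∃ W : Finset V, (∀ v, v ∈ W ↔ v ∈ edgeEndpoints M) ∧ InducesMatching G W ∧
      W.card = 2 * M.card ∧ ∀ a b, s(a, b) ∈ M ↔ a ∈ W ∧ b ∈ W ∧ G.Adj a b := by
  obtain ⟨h1, h2, h3⟩ := h
  have hW : ∀ v, v ∈ M.biUnion Sym2.toFinset ↔ v ∈ edgeEndpoints M := fun v => by
    simp [edgeEndpoints]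
  have hM : ∀ a b, s(a, b) ∈ M ↔
      a ∈ M.biUnion Sym2.toFinset ∧ b ∈ M.biUnion Sym2.toFinset ∧ G.Adj a b := by
    intro a b
    rw [hW, hW]
    constructor
    · intro hab
      exact ⟨⟨_, hab, by simp⟩, ⟨_, hab, by simp⟩, h1 _ hab⟩
    · rintro ⟨ha, hb, hab⟩
      by_contra hc
      refine h3 ha hb hab.ne ?_
      rw [SimpleGraph.deleteEdges_adj]
      exact ⟨hab, hc⟩
  refine ⟨M.biUnion Sym2.toFinset, hW, ?_, ?_, hM⟩
  · intro w hw
    obtain ⟨e, he, hwe⟩ := (hW w).1 hw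
    induction e with
    | _ a b =>
      have key : ∀ c, s(w, c) ∈ M → ∃! u, u ∈ M.biUnion Sym2.toFinset ∧ G.Adj w u := by
        intro c hc
        have hc' := (hM w c).1 hc
        refine ⟨c, hc'.2, fun z hz => ?_⟩
        have := h2 _ hc _ ((hM w z).2 ⟨hw, hz⟩) w (by simp) (by simp)
        exact (Sym2.congr_right.1 this).symm
      rcases Sym2.mem_iff.1 hwe with rfl | rfl
      · exact key b he
      · exact key a (Sym2.eq_swap ▸ he)
  · rw [Finset.card_biUnion]
    · rw [Finset.sum_congr rfl fun e he =>
        Sym2.card_toFinset_of_not_isDiag e (G.not_isDiag_of_mem_edgeSet (h1 e he))]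
      simp [mul_comm]
    · intro e he f hf hef
      rw [Function.onFun, Finset.disjoint_left]
      intro x hx hx'
      exact hef (h2 e he f hf x (Sym2.mem_toFinset.1 hx) (Sym2.mem_toFinset.1 hx'))

/-- Conversely, the edges inside `W` form the edge set: uniqueness of the neighbour makes them
disjoint, and no other edge joins two endpoints because all of them were taken. -/
theorem InducesMatching.exists_isIndepEdgeSet {V : Type*} [DecidableEq V] {G : SimpleGraph V}
    {W : Finset V} (h : InducesMatching G W) :
    ∃ M : Finset (Sym2 V), IsIndepEdgeSet G M ∧ (∀ v, v ∈ W ↔ v ∈ edgeEndpoints M) ∧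
      W.card = 2 * M.card ∧ ∀ a b, s(a, b) ∈ M ↔ a ∈ W ∧ b ∈ W ∧ G.Adj a b := by
  classical
  let M : Finset (Sym2 V) := W.sym2.filter (· ∈ G.edgeSet)
  have hM : ∀ a b, s(a, b) ∈ M ↔ a ∈ W ∧ b ∈ W ∧ G.Adj a b := fun a b => by
    simp [M, and_assoc]
  have hW : ∀ v, v ∈ W ↔ v ∈ edgeEndpoints M := by
    intro v
    constructor
    · intro hv
      obtain ⟨u, ⟨hu, hvu⟩, -⟩ := h v hv
      exact ⟨s(v, u), (hM v u).2 ⟨hv, hu, hvu⟩, by simp⟩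
    · rintro ⟨e, he, hve⟩
      exact Finset.mem_sym2_iff.1 (Finset.mem_filter.1 he).1 v hve
  have hind : IsIndepEdgeSet G M := by
    refine ⟨fun e he => (Finset.mem_filter.1 he).2, ?_, ?_⟩
    · intro e he f hf x hxe hxf
      obtain ⟨a, rfl⟩ := hxe
      obtain ⟨b, rfl⟩ := hxf
      rw [hM] at he hf
      rw [h.eq_of_adj he.1 he.2.1 hf.2.1 he.2.2 hf.2.2]
    · intro a ha b hb _ hab
      rw [SimpleGraph.deleteEdges_adj] at hab
      exact hab.2 ((hM a b).2 ⟨(hW a).2 ha, (hW b).2 hb, hab.1⟩)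
  obtain ⟨W', h1, h2, h3, h4⟩ := InducesMatching.of_isIndepEdgeSet hind
  have : W' = W := by ext v; rw [h1, hW]
  subst this
  exact ⟨M, hind, hW, h3, hM⟩

theorem isLargestIndepEdgeSet_iff {V : Type*} [DecidableEq V] {G : SimpleGraph V}
    {M : Finset (Sym2 V)} (h : IsIndepEdgeSet G M) : IsLargestIndepEdgeSet G M ↔
      ∀ W, InducesMatching G W → W.card ≤ 2 * M.card := by
  constructor
  · rintro ⟨-, h'⟩ W hW
    obtain ⟨M', h1, -, h2, -⟩ := hW.exists_isIndepEdgeSet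
    rw [h2]
    exact Nat.mul_le_mul_left 2 (h' M' h1)
  · intro h'
    refine ⟨h, fun M' hM' => ?_⟩
    obtain ⟨W, -, h1, h2, -⟩ := InducesMatching.of_isIndepEdgeSet hM'
    have := h' W h1
    omega

/-! ## Branching -/

section Branching

variable (G : SimpleGraph ℕ) (X : Finset ℕ) (md u v a x b y : ℕ)

/-- The conditions under which the quadruple `(a, x, b, y)` describes a branch at `u` and `v` inside
the set `X`. For `a = b` and `x = y` the branch selects the edge `ax`, for `a < b` it selects the
edges `ax` and `by`, and for `a = x = b = y = u` it selects no edge. The mode `md` is `0` if the last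
kind of branch discards `u`, it is `1` if that discards `u` and its neighbours, and it is `2` if there
is no branch of the last kind. -/
def IsBranch : Prop :=
  (a = b ∧ x = y ∧ a ∈ X ∧ x ∈ X ∧ G.Adj a x ∧ (a = u ∨ (md = 2 ∧ a = v ∧ x ≠ u))) ∨
  (md ≠ 2 ∧ a = u ∧ x = u ∧ b = u ∧ y = u) ∨
  (md ≠ 0 ∧ a < b ∧ (a ∈ X ∧ x ∈ X ∧ b ∈ X ∧ y ∈ X) ∧ (G.Adj a x ∧ G.Adj b y) ∧
    (¬ G.Adj a b ∧ ¬ G.Adj a y ∧ ¬ G.Adj b x ∧ ¬ G.Adj x y) ∧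
    ((G.Adj u a ∧ G.Adj u b ∧ a ≠ v ∧ b ≠ v) ∨
      (md = 2 ∧ G.Adj v a ∧ G.Adj v b ∧ a ≠ u ∧ b ≠ u ∧
        (¬ G.Adj u a ∧ ¬ G.Adj u b ∧ ¬ G.Adj u x ∧ ¬ G.Adj u y))))

/-- The branch selects the vertex `i`. -/
def Selects (i : ℕ) : Prop :=
  a ≠ x ∧ (i = a ∨ i = x ∨ i = b ∨ i = y)

/-- The branch discards the vertex `i`, unless it selects it. -/
def Discards (i : ℕ) : Prop :=
  (a ≠ x ∧ (G.Adj a i ∨ G.Adj x i ∨ G.Adj b i ∨ G.Adj y i)) ∨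
  (a = x ∧ (i = u ∨ (md = 1 ∧ G.Adj u i))) ∨
  (a ≠ b ∧ ¬ G.Adj u a ∧ (i = u ∨ G.Adj u i))

open Classical in
/-- The vertices that remain after the branch. -/
noncomputable def branchRest : Finset ℕ :=
  X.filter fun i => ¬ Selects a x b y i ∧ ¬ Discards G md u a x b y i

theorem mem_branchRest {i : ℕ} : i ∈ branchRest G X md u a x b y ↔
    i ∈ X ∧ ¬ Selects a x b y i ∧ ¬ Discards G md u a x b y i := by
  simp [branchRest]

theorem branchRest_subset : branchRest G X md u a x b y ⊆ X :=
  fun _ hi => ((mem_branchRest G X md u a x b y).1 hi).1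

end Branching

/-! ### Completeness of the branching: some branch preserves the optimum -/

section Completeness

variable {G : SimpleGraph ℕ} {X W : Finset ℕ} {md u v : ℕ}

/-- Some branch keeps an induced matching with at least `k` vertices. -/
def BranchKeeps (G : SimpleGraph ℕ) (X : Finset ℕ) (md u v k : ℕ) : Prop :=
  ∃ a x b y, IsBranch G X md u v a x b y ∧ ∃ W ⊆ branchRest G X md u a x b y,
    InducesMatching G W ∧ k ≤ W.card + (if a = x then ∅ else {a, x, b, y} : Finset ℕ).card

/-- The rest of `W` contains no neighbour of `a` or `x`, so it survives the deletions that go with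
selecting `ax`. -/
theorem branchKeeps_edge (hWX : W ⊆ X) (hW : InducesMatching G W) {a x : ℕ} (ha : a ∈ W)
    (hx : x ∈ W) (hax : G.Adj a x) (hu : a = u ∨ (md = 2 ∧ a = v ∧ x ≠ u)) :
    BranchKeeps G X md u v W.card := by
  obtain ⟨h1, h2⟩ := hW.sdiff_pair ha hx hax
  refine ⟨a, x, a, x, Or.inl ⟨rfl, rfl, hWX ha, hWX hx, hax, hu⟩, W \ {a, x}, fun i hi => ?_, h1,
    ?_⟩
  · have h3 := h2 i hi
    simp only [Finset.mem_sdiff, Finset.mem_insert, Finset.mem_singleton, not_or] at hi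
    rw [mem_branchRest]
    refine ⟨hWX hi.1, fun h => ?_, fun h => ?_⟩
    · rcases h.2 with h | h | h | h
      exacts [hi.2.1 h, hi.2.2 h, hi.2.1 h, hi.2.2 h]
    · rcases h with ⟨-, h | h | h | h⟩ | h | h
      exacts [h3.1 h, h3.2 h, h3.1 h, h3.2 h, hax.ne h.1, h.1 rfl]
  · rw [if_neg hax.ne]
    have h4 : ({a, x} : Finset ℕ) ⊆ W := by
      simp [Finset.insert_subset_iff, ha, hx]
    rw [Finset.card_sdiff_of_subset h4]
    have h5 : ({a, x, a, x} : Finset ℕ) = {a, x} := by ext; simp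
    rw [h5]
    omega

/-- If `w` has two neighbours `a` and `b` in `W`, the branch that selects them together with their
partners deletes nothing else from `W`. For `w = v` the branch also discards `u` and its neighbours;
this is harmless because `W` avoids them. -/
theorem branchKeeps_pair {c : ℕ → Bool} (hc : ∀ i j, G.Adj i j → c i ≠ c j) (hWX : W ⊆ X)
    (hW : InducesMatching G W) {a b w : ℕ} (ha : a ∈ W) (hb : b ∈ W) (hab : a < b)
    (hwa : G.Adj w a) (hwb : G.Adj w b) (hmd : md ≠ 0)
    (h : (w = u ∧ a ≠ v ∧ b ≠ v) ∨ (w = v ∧ md = 2 ∧ u ∉ W ∧ ∀ i ∈ W, ¬ G.Adj u i)) :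
    BranchKeeps G X md u v W.card := by
  obtain ⟨x, ⟨hx, hax⟩, hxu⟩ := hW a ha
  obtain ⟨y, ⟨hy, hby⟩, hyu⟩ := hW b hb
  -- Both `a` and `b` have the colour opposite to `w`, so they are not adjacent. In particular they
  -- are not partners of each other, and two different edges are selected.
  have nab : ¬ G.Adj a b := fun h => by
    have h1 := hc _ _ hwa
    have h2 := hc _ _ hwb
    have h3 := hc _ _ h
    revert h1 h2 h3
    cases c a <;> cases c b <;> cases c w <;> simp
  have nay : ¬ G.Adj a y := fun h => hab.ne (hW.eq_of_adj hy ha hb h.symm hby.symm)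
  have nbx : ¬ G.Adj b x := fun h => hab.ne (hW.eq_of_adj hx ha hb hax.symm h.symm)
  have hxb : x ≠ b := fun h => nab (h ▸ hax)
  have hay : a ≠ y := fun h => nab (h ▸ hby.symm)
  have hxy : x ≠ y := fun h => nay (h ▸ hax)
  have nxy : ¬ G.Adj x y := fun h => hay (hW.eq_of_adj hx ha hy hax.symm h)
  obtain ⟨h1, h2⟩ := hW.sdiff_pair ha hx hax
  have hb1 : b ∈ W \ {a, x} := by simp [hb, hab.ne', hxb.symm]
  have hy1 : y ∈ W \ {a, x} := by simp [hy, hay.symm, hxy.symm]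
  obtain ⟨h3, h4⟩ := h1.sdiff_pair hb1 hy1 hby
  refine ⟨a, x, b, y, Or.inr (Or.inr ⟨hmd, hab, ⟨hWX ha, hWX hx, hWX hb, hWX hy⟩, ⟨hax, hby⟩,
    ⟨nab, nay, nbx, nxy⟩, ?_⟩), (W \ {a, x}) \ {b, y}, fun i hi => ?_, h3, ?_⟩
  · rcases h with ⟨rfl, h5, h6⟩ | ⟨rfl, h5, h6, h7⟩
    · exact Or.inl ⟨hwa, hwb, h5, h6⟩
    · exact Or.inr ⟨h5, hwa, hwb, fun e => h6 (e ▸ ha), fun e => h6 (e ▸ hb),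
        h7 a ha, h7 b hb, h7 x hx, h7 y hy⟩
  · have h5 := h4 i hi
    have h6 := h2 i (Finset.mem_sdiff.1 hi).1
    simp only [Finset.mem_sdiff, Finset.mem_insert, Finset.mem_singleton, not_or] at hi
    rw [mem_branchRest]
    refine ⟨hWX hi.1.1, fun h => ?_, fun h' => ?_⟩
    · rcases h.2 with h | h | h | h
      exacts [hi.1.2.1 h, hi.1.2.2 h, hi.2.1 h, hi.2.2 h]
    · rcases h' with ⟨-, h' | h' | h' | h'⟩ | h' | ⟨-, h', h''⟩
      · exact h6.1 h'
      · exact h6.2 h'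
      · exact h5.1 h'
      · exact h5.2 h'
      · exact hax.ne h'.1
      · rcases h with ⟨rfl, -⟩ | ⟨rfl, -, h8, h9⟩
        · exact h' hwa
        · rcases h'' with rfl | h''
          exacts [h8 hi.1.1, h9 i hi.1.1 h'']
  · rw [if_neg hax.ne]
    have h7 : ({a, x} : Finset ℕ) ⊆ W := by simp [Finset.insert_subset_iff, ha, hx]
    have h8 : ({b, y} : Finset ℕ) ⊆ W \ {a, x} := by
      rw [Finset.insert_subset_iff, Finset.singleton_subset_iff]; exact ⟨hb1, hy1⟩
    have h9 : ({a, x, b, y} : Finset ℕ) = {a, x} ∪ {b, y} := by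
      ext; simp only [Finset.mem_insert, Finset.mem_singleton, Finset.mem_union]; tauto
    have h10 : Disjoint ({a, x} : Finset ℕ) {b, y} :=
      Finset.disjoint_sdiff.mono_right h8
    rw [Finset.card_sdiff_of_subset h8, Finset.card_sdiff_of_subset h7, h9,
      Finset.card_union_of_disjoint h10]
    omega

theorem branchKeeps_discard (hu : u ∉ W) (hWX : W ⊆ X) (hW : InducesMatching G W) (hmd : md ≠ 2)
    (h : md = 1 → ∀ i ∈ W, ¬ G.Adj u i) : BranchKeeps G X md u v W.card := by
  refine ⟨u, u, u, u, Or.inr (Or.inl ⟨hmd, rfl, rfl, rfl, rfl⟩), W, fun i hi => ?_, hW, by simp⟩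
  rw [mem_branchRest]
  refine ⟨hWX hi, fun h' => h'.1 rfl, fun h' => ?_⟩
  rcases h' with h' | ⟨-, h' | h'⟩ | h'
  exacts [h'.1 rfl, hu (h' ▸ hi), h h'.1 i hi h'.2, h'.1 rfl]

/-- The three cases lead to three different treatments of an unselected `u`: discard or extend,
exchange, and select two edges. -/
theorem exists_nbr_trichotomy (G : SimpleGraph ℕ) (W : Finset ℕ) (u : ℕ) :
    (∀ i ∈ W, ¬ G.Adj u i) ∨ (∃ a ∈ W, G.Adj u a ∧ ∀ i ∈ W, G.Adj u i → i = a) ∨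
      ∃ a ∈ W, ∃ b ∈ W, a < b ∧ G.Adj u a ∧ G.Adj u b := by
  by_cases h : ∃ a ∈ W, G.Adj u a
  · obtain ⟨a, ha, hua⟩ := h
    by_cases h' : ∃ b ∈ W, G.Adj u b ∧ b ≠ a
    · obtain ⟨b, hb, hub, hba⟩ := h'
      rcases lt_or_gt_of_ne hba with h | h
      · exact Or.inr (Or.inr ⟨b, hb, a, ha, h, hub, hua⟩)
      · exact Or.inr (Or.inr ⟨a, ha, b, hb, h, hua, hub⟩)
    · push Not at h'
      exact Or.inr (Or.inl ⟨a, ha, hua, h'⟩)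
  · push Not at h
    exact Or.inl h

/-- One of the branches keeps the size of a largest induced matching. -/
theorem branchKeeps_of_maximum {c : ℕ → Bool} (hc : ∀ i j, G.Adj i j → c i ≠ c j) (hWX : W ⊆ X)
    (hW : InducesMatching G W) (hmax : ∀ W' ⊆ X, InducesMatching G W' → W'.card ≤ W.card)
    (hu : u ∈ X)
    (hmd : md = 0 ∨ (md = 1 ∧ v = u) ∨ (md = 2 ∧ v ∈ X ∧ G.Adj u v)) :
    BranchKeeps G X md u v W.card := by
  by_cases huW : u ∈ W
  · obtain ⟨x, ⟨hx, hux⟩, -⟩ := hW u huW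
    exact branchKeeps_edge hWX hW huW hx hux (Or.inl rfl)
  -- After the exchange the matching has the same size and contains the edge `wa`, so an edge branch
  -- at `w` applies. When `w = v`, the other end `a` is not `u`, because `a` lies in `W` and `u`
  -- does not.
  have swap : ∀ w ∈ X, w ∉ W → ∀ a ∈ W, G.Adj w a → (∀ i ∈ W, G.Adj w i → i = a) →
      (w = u ∨ (md = 2 ∧ w = v)) → BranchKeeps G X md u v W.card := by
    intro w hw hwW a ha hwa huniq hwu
    obtain ⟨x, ⟨hx, hax⟩, -⟩ := hW a ha
    have hW' := hW.swap hwW ha hx hwa hax huniq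
    rw [← InducesMatching.card_swap hwW hx]
    refine branchKeeps_edge (a := w) (x := a) ?_ hW' (Finset.mem_insert_self _ _) ?_ hwa ?_
    · exact Finset.insert_subset hw ((Finset.erase_subset _ _).trans hWX)
    · exact Finset.mem_insert_of_mem (Finset.mem_erase.2 ⟨hax.ne, ha⟩)
    · exact hwu.imp_right fun h => ⟨h.1, h.2, fun e => huW (e ▸ ha)⟩
  rcases hmd with rfl | ⟨rfl, rfl⟩ | ⟨rfl, hv, huv⟩
  · exact branchKeeps_discard huW hWX hW (by omega) (by omega)
  · rcases exists_nbr_trichotomy G W v with h | ⟨a, ha, h1, h2⟩ | ⟨a, ha, b, hb, h1, h2, h3⟩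
    · exact branchKeeps_discard huW hWX hW (by omega) fun _ => h
    · exact swap v hu huW a ha h1 h2 (Or.inl rfl)
    · exact branchKeeps_pair hc hWX hW ha hb h1 h2 h3 (by omega)
        (Or.inl ⟨rfl, h2.ne', h3.ne'⟩)
  · by_cases hvW : v ∈ W
    · obtain ⟨x, ⟨hx, hvx⟩, -⟩ := hW v hvW
      exact branchKeeps_edge hWX hW hvW hx hvx (Or.inr ⟨rfl, rfl, fun e => huW (e ▸ hx)⟩)
    rcases exists_nbr_trichotomy G W u with h | ⟨a, ha, h1, h2⟩ | ⟨a, ha, b, hb, h1, h2, h3⟩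
    · rcases exists_nbr_trichotomy G W v with h' | ⟨a, ha, h1, h2⟩ | ⟨a, ha, b, hb, h1, h2, h3⟩
      -- Neither `u` nor `v` is selected or has a selected neighbour, so the edge `uv` could be
      -- added to `W`. This is the only use of maximality, and it is why mode `2` needs no branch
      -- that merely discards.
      · exfalso
        have h4 : InducesMatching G (W ∪ {u, v}) := hW.union (.pair huv) fun w hw z hz hwz => by
          rw [Finset.mem_insert, Finset.mem_singleton] at hz
          rcases hz with rfl | rfl
          exacts [h w hw hwz.symm, h' w hw hwz.symm]
        have h5 := hmax _ (Finset.union_subset hWX (by simp [Finset.insert_subset_iff, hu, hv])) h4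
        rw [Finset.card_union_of_disjoint (by simp [huW, hvW]), Finset.card_pair huv.ne] at h5
        omega
      · exact swap v hv hvW a ha h1 h2 (Or.inr ⟨rfl, rfl⟩)
      · exact branchKeeps_pair hc hWX hW ha hb h1 h2 h3 (by omega) (Or.inr ⟨rfl, rfl, huW, h⟩)
    · exact swap u hu huW a ha h1 h2 (Or.inl rfl)
    · exact branchKeeps_pair hc hWX hW ha hb h1 h2 h3 (by omega)
        (Or.inl ⟨rfl, fun e => hvW (e ▸ ha), fun e => hvW (e ▸ hb)⟩)

end Completeness

/-! ## The branching inequalities -/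

section Weights

variable {y : ℝ}

theorem pow_le_base (h0 : 0 ≤ y) (h : y ≤ 500000 / 701009) (n : ℕ) :
    y ^ n ≤ (500000 / 701009 : ℝ) ^ n :=
  pow_le_pow_left₀ h0 h n

/-- At the extreme base the ratio of consecutive terms is `(p + 1) / p` times about `0.713`. This
exceeds `1` for `p = 2` and is below `1` from `p = 3` on, so the maximum is at `p = 3`. -/
theorem mul_pow_le (h0 : 0 ≤ y) (h : y ≤ 500000 / 701009) (p : ℕ) :
    (p : ℝ) * y ^ p ≤ 3 * (500000 / 701009) ^ 3 := by
  have key : ∀ p : ℕ, 3 ≤ p → (p : ℝ) * (500000 / 701009 : ℝ) ^ p ≤ 3 * (500000 / 701009) ^ 3 := by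
    intro p hp
    induction p, hp using Nat.le_induction with
    | base => norm_num
    | succ p hp ih =>
      refine le_trans ?_ ih
      have hp' : (3 : ℝ) ≤ p := by exact_mod_cast hp
      rw [pow_succ, ← mul_assoc, mul_right_comm]
      refine mul_le_mul_of_nonneg_right ?_ (by positivity)
      push_cast
      nlinarith
  refine (mul_le_mul_of_nonneg_left (pow_le_base h0 h p) (Nat.cast_nonneg p)).trans ?_
  rcases Nat.lt_or_ge p 3 with hp | hp
  · interval_cases p <;> norm_num
  · exact key p hp

/-- A sharper constant for small `p`, needed because the case `p = q = 2` of `weight_degree_two`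
leaves almost no slack. -/
theorem mul_pow_le_of_le_two (h0 : 0 ≤ y) (h : y ≤ 500000 / 701009) {p : ℕ} (hp : p ≤ 2) :
    (p : ℝ) * y ^ p ≤ 2 * (500000 / 701009) ^ 2 := by
  refine (mul_le_mul_of_nonneg_left (pow_le_base h0 h p) (Nat.cast_nonneg p)).trans ?_
  interval_cases p <;> norm_num

/-- The exponent `r` pays for the factor `p` with `p` powers and for the factor `q` with `q` powers;
at least `s` powers remain. So bounds uniform in all degrees follow from the two one-variable
maxima. -/
theorem mul_pow_mul_le {A B : ℝ} {p q r s : ℕ} (h0 : 0 ≤ y) (h : y ≤ 500000 / 701009)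
    (hp : (p : ℝ) * y ^ p ≤ A) (hq : (q : ℝ) * y ^ q ≤ B) (hr : p + q + s ≤ r) :
    (p : ℝ) * q * y ^ r ≤ A * B * (500000 / 701009) ^ s := by
  have hA : 0 ≤ A := le_trans (by positivity) hp
  have hB : 0 ≤ B := le_trans (by positivity) hq
  have hy1 : y ≤ 1 := h.trans (by norm_num)
  calc (p : ℝ) * q * y ^ r ≤ (p : ℝ) * q * y ^ (p + q + s) :=
        mul_le_mul_of_nonneg_left (pow_le_pow_of_le_one h0 hy1 hr) (by positivity)
    _ = ((p : ℝ) * y ^ p) * ((q : ℝ) * y ^ q) * y ^ s := by rw [pow_add, pow_add]; ring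
    _ ≤ A * B * (500000 / 701009) ^ s := by
        refine mul_le_mul (mul_le_mul hp hq (by positivity) hA) (pow_le_base h0 h s)
          (by positivity) (mul_nonneg hA hB)

theorem weight_leaf (h0 : 0 ≤ y) (h : y ≤ 500000 / 701009) : y ^ 2 + y ^ 3 ≤ 1 := by
  have h2 := pow_le_base h0 h 2
  have h3 := pow_le_base h0 h 3
  norm_num at h2 h3
  linarith

theorem weight_three (h0 : 0 ≤ y) (h : y ≤ 500000 / 701009) : 3 * y ^ 4 ≤ 1 := by
  have h2 := pow_le_base h0 h 4
  norm_num at h2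
  linarith

/-- For a vertex of degree two with neighbours `a` and `b`, the number `c` counts their common
neighbours and `p`, `q` count the private ones. The terms stand for the two single edges, the
discarding of `u` with both neighbours, and the `p * q` pairs of edges. -/
theorem weight_degree_two (h0 : 0 ≤ y) (h : y ≤ 500000 / 701009) {p q c : ℕ} (hc : 1 ≤ c)
    (hp : 3 ≤ p + c) (hq : 3 ≤ q + c) :
    y ^ (p + c + 2) + y ^ (q + c + 2) + y ^ 3 + (p : ℝ) * q * y ^ (p + q + c + 3) ≤ 1 := by
  have hy1 : y ≤ 1 := h.trans (by norm_num)
  have h3 := pow_le_base h0 h 3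
  have mono : ∀ {k l : ℕ}, k ≤ l → y ^ l ≤ (500000 / 701009 : ℝ) ^ k := fun hkl =>
    (pow_le_pow_of_le_one h0 hy1 hkl).trans (pow_le_base h0 h _)
  have hp3 := mul_pow_le h0 h p
  have hq3 := mul_pow_le h0 h q
  rcases Nat.lt_or_ge (p + c) 4 with hp4 | hp4
  · have hp2 := mul_pow_le_of_le_two h0 h (p := p) (by omega)
    have e1 := mono (k := 5) (l := p + c + 2) (by omega)
    rcases Nat.lt_or_ge (q + c) 4 with hq4 | hq4
    · have hq2 := mul_pow_le_of_le_two h0 h (p := q) (by omega)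
      have e2 := mono (k := 5) (l := q + c + 2) (by omega)
      -- The critical case. For `p = q = 2` and `c = 1` the sum is `y ^ 3 + 2 * y ^ 5 + 4 * y ^ 8`,
      -- which at `y = 500000 / 701009` falls short of `1` by only a few millionths; it dictates the
      -- base.
      have e3 := mul_pow_mul_le (r := p + q + c + 3) (s := 4) h0 h hp2 hq2 (by omega)
      norm_num at h3 e1 e2 e3
      linarith
    · have e2 := mono (k := 6) (l := q + c + 2) (by omega)
      have e3 := mul_pow_mul_le (r := p + q + c + 3) (s := 4) h0 h hp2 hq3 (by omega)
      norm_num at h3 e1 e2 e3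
      linarith
  · have e1 := mono (k := 6) (l := p + c + 2) (by omega)
    rcases Nat.lt_or_ge (q + c) 4 with hq4 | hq4
    · have hq2 := mul_pow_le_of_le_two h0 h (p := q) (by omega)
      have e2 := mono (k := 5) (l := q + c + 2) (by omega)
      have e3 := mul_pow_mul_le (r := p + q + c + 3) (s := 4) h0 h hp3 hq2 (by omega)
      norm_num at h3 e1 e2 e3
      linarith
    · have e2 := mono (k := 6) (l := q + c + 2) (by omega)
      have e3 := mul_pow_mul_le (r := p + q + c + 3) (s := 4) h0 h hp3 hq3 (by omega)
      norm_num at h3 e1 e2 e3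
      linarith

/-- For adjacent vertices of degree three: five edges meet `u` or `v`, each removing at least six
vertices, and there are `p * q` pairs at `u` and `p' * q'` pairs at `v`. -/
theorem weight_degree_three (h0 : 0 ≤ y) (h : y ≤ 500000 / 701009) {p q r p' q' r' : ℕ}
    (hr : p + q + 5 ≤ r) (hr' : p' + q' + 8 ≤ r') :
    5 * y ^ 6 + (p : ℝ) * q * y ^ r + (p' : ℝ) * q' * y ^ r' ≤ 1 := by
  have h6 := pow_le_base h0 h 6
  have e1 := mul_pow_mul_le h0 h (mul_pow_le h0 h p) (mul_pow_le h0 h q) hr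
  have e2 := mul_pow_mul_le h0 h (mul_pow_le h0 h p') (mul_pow_le h0 h q') hr'
  norm_num at h6 e1 e2
  linarith

/-- Discarding a vertex costs `y`; each of its `d` edges leads to a neighbour of degree at least
four. No upper bound on `d` is needed, so the search does not treat very large degrees separately.
-/
theorem weight_high_degree (h0 : 0 ≤ y) (h : y ≤ 500000 / 701009) {d : ℕ} :
    y + d * y ^ (d + 4) ≤ 1 := by
  have h4 := pow_le_base h0 h 4
  have e1 := mul_le_mul (mul_pow_le h0 h d) h4 (by positivity) (by positivity)
  rw [mul_assoc, ← pow_add] at e1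
  norm_num at h4 e1
  linarith

theorem weight_very_high_degree (h0 : 0 ≤ y) (h : y ≤ 500000 / 701009) {k : ℕ} (hk : 8 ≤ k) :
    y + k * y ^ (k + 2) ≤ 1 := by
  have key : (k : ℝ) * (500000 / 701009 : ℝ) ^ k ≤ 8 * (500000 / 701009) ^ 8 := by
    induction k, hk using Nat.le_induction with
    | base => norm_num
    | succ p hp ih =>
      refine le_trans ?_ ih
      have hp' : (8 : ℝ) ≤ p := by exact_mod_cast hp
      rw [pow_succ, ← mul_assoc, mul_right_comm]
      refine mul_le_mul_of_nonneg_right ?_ (by positivity)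
      push_cast
      nlinarith
  have h4 := pow_le_base h0 h 2
  have hk' := (mul_le_mul_of_nonneg_left (pow_le_base h0 h k) (Nat.cast_nonneg k)).trans key
  have e1 := mul_le_mul hk' h4 (by positivity) (by positivity)
  rw [mul_assoc, ← pow_add] at e1
  norm_num at h4 e1
  linarith

end Weights

/-- Dividing by `T n` turns every recurrence into an inequality in `y = 1 / r`. Those hold for all
`y` up to `500000 / 701009`, so the slightly larger base `1.40202` is covered as well. -/
theorem satisfiesRecurrences {r C : ℝ} (hr : 701009 / 500000 ≤ r) (hC : 0 < C) :
    SatisfiesRecurrences fun n : ℤ => C * r ^ n := by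
  have hr0 : 0 < r := lt_of_lt_of_le (by norm_num) hr
  have hy0 : 0 ≤ r⁻¹ := by positivity
  have hy : r⁻¹ ≤ 500000 / 701009 := by
    rw [inv_le_comm₀ hr0 (by norm_num)]
    norm_num
    exact hr
  have hy1 : r⁻¹ ≤ 1 := hy.trans (by norm_num)
  have shift : ∀ (n k : ℤ) (j : ℕ), k = n - j → C * r ^ k = C * r ^ n * r⁻¹ ^ j := by
    intro n k j hk
    rw [hk, zpow_sub₀ hr0.ne', zpow_natCast, inv_pow, div_eq_mul_inv, mul_assoc]
  intro n
  have hT : 0 < C * r ^ n := mul_pos hC (zpow_pos hr0 n)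
  have bound : ∀ x : ℝ, x ≤ 1 → C * r ^ n ≥ C * r ^ n * x := fun x hx =>
    mul_le_of_le_one_right hT.le hx
  refine ⟨?_, ?_, ?_, ?_, ?_, ?_, ?_, ?_⟩
  · show C * r ^ n ≥ C * r ^ (n - 1)
    rw [shift n (n - 1) 1 (by norm_num)]
    exact bound _ (pow_le_one₀ hy0 hy1)
  · show C * r ^ n ≥ C * r ^ (n - 2)
    rw [shift n (n - 2) 2 (by norm_num)]
    exact bound _ (pow_le_one₀ hy0 hy1)
  · show C * r ^ n ≥ C * r ^ (n - 2) + C * r ^ (n - 3)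
    rw [shift n (n - 2) 2 (by norm_num), shift n (n - 3) 3 (by norm_num), ← mul_add]
    exact bound _ (weight_leaf hy0 hy)
  · intro k hk
    show C * r ^ n ≥ C * r ^ (n - 1) + k * (C * r ^ (n - k - 2))
    rw [shift n (n - 1) 1 (by norm_num), shift n (n - k - 2) (k + 2) (by push_cast; ring)]
    have := bound _ (weight_very_high_degree hy0 hy hk)
    linarith
  · show C * r ^ n ≥ 3 * (C * r ^ (n - 4))
    rw [shift n (n - 4) 4 (by norm_num)]
    have := bound _ (weight_three hy0 hy)
    linarith
  · intro d e k hd _ he _ hkd hke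
    show C * r ^ n ≥ C * r ^ (n - d - 2) + C * r ^ (n - e - 2) + C * r ^ (n - 3) +
      ((d : ℝ) - k - 1) * ((e : ℝ) - k - 1) * (C * r ^ (n - d - e - 2 + k))
    obtain ⟨p, rfl⟩ := Nat.exists_eq_add_of_lt hkd
    -- With `d = k + p + 1` and `e = k + q + 1` the coefficients become `p` and `q`, and `k + 1`
    -- plays the role of the number of common neighbours, which includes `u`.
    obtain ⟨q, rfl⟩ := Nat.exists_eq_add_of_lt hke
    rw [shift n (n - 3) 3 (by norm_num),
      shift n (n - ((k + p + 1 : ℕ) : ℤ) - 2) (p + (k + 1) + 2) (by push_cast; ring),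
      shift n (n - ((k + q + 1 : ℕ) : ℤ) - 2) (q + (k + 1) + 2) (by push_cast; ring),
      shift n (n - ((k + p + 1 : ℕ) : ℤ) - ((k + q + 1 : ℕ) : ℤ) - 2 + k)
        (p + q + (k + 1) + 3) (by push_cast; ring)]
    have := bound _ (weight_degree_two hy0 hy (p := p) (q := q) (c := k + 1) (by omega)
      (by omega) (by omega))
    push_cast
    rw [show ((k : ℝ) + p + 1 - k - 1) = p by ring, show ((k : ℝ) + q + 1 - k - 1) = q by ring]
    linarith
  · intro i₁ i₂ k j₁ j₂ l _ _ _ _ hk1 hk2 _ _ _ _ hl1 hl2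
    show C * r ^ n ≥ 5 * (C * r ^ (n - 6)) +
      ((i₁ : ℝ) - k - 1) * ((i₂ : ℝ) - k - 1) * (C * r ^ (n - i₁ - i₂ + k - 3)) +
      ((j₁ : ℝ) - l - 1) * ((j₂ : ℝ) - l - 1) * (C * r ^ (n - j₁ - j₂ + l - 6))
    obtain ⟨p, rfl⟩ := Nat.exists_eq_add_of_lt hk1
    obtain ⟨q, rfl⟩ := Nat.exists_eq_add_of_lt hk2
    obtain ⟨p', rfl⟩ := Nat.exists_eq_add_of_lt hl1
    obtain ⟨q', rfl⟩ := Nat.exists_eq_add_of_lt hl2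
    rw [shift n (n - 6) 6 (by norm_num),
      shift n (n - ((k + p + 1 : ℕ) : ℤ) - ((k + q + 1 : ℕ) : ℤ) + k - 3)
        (p + q + k + 5) (by push_cast; ring),
      shift n (n - ((l + p' + 1 : ℕ) : ℤ) - ((l + q' + 1 : ℕ) : ℤ) + l - 6)
        (p' + q' + l + 8) (by push_cast; ring)]
    have := bound _ (weight_degree_three hy0 hy (p := p) (q := q) (r := p + q + k + 5)
      (p' := p') (q' := q') (r' := p' + q' + l + 8) (by omega) (by omega))
    push_cast
    rw [show ((k : ℝ) + p + 1 - k - 1) = p by ring, show ((k : ℝ) + q + 1 - k - 1) = q by ring,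
      show ((l : ℝ) + p' + 1 - l - 1) = p' by ring, show ((l : ℝ) + q' + 1 - l - 1) = q' by ring]
    linarith
  · intro i _ _
    show C * r ^ n ≥ C * r ^ (n - 1) + i * (C * r ^ (n - i - 4))
    rw [shift n (n - 1) 1 (by norm_num), shift n (n - i - 4) (i + 4) (by push_cast; ring)]
    have := bound _ (weight_high_degree hy0 hy (d := i))
    linarith

/-! ## The weight of the branches -/

section BranchWeight

open Classical in
/-- The neighbours of `v` in `X`. -/
noncomputable def nbrsIn (G : SimpleGraph ℕ) (X : Finset ℕ) (v : ℕ) : Finset ℕ :=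
  X.filter (G.Adj v)

theorem mem_nbrsIn {G : SimpleGraph ℕ} {X : Finset ℕ} {v i : ℕ} :
    i ∈ nbrsIn G X v ↔ i ∈ X ∧ G.Adj v i := by
  simp [nbrsIn]

/-- `u` has the least degree in `X`, and `v` has the least degree among its neighbours. -/
structure IsPivot (G : SimpleGraph ℕ) (X : Finset ℕ) (u v : ℕ) : Prop where
  mem : u ∈ X
  le : ∀ w ∈ X, (nbrsIn G X u).card ≤ (nbrsIn G X w).card
  nbr : ((nbrsIn G X u).card = 0 ∧ v = u) ∨
    (v ∈ X ∧ G.Adj u v ∧ ∀ w ∈ X, G.Adj u w → (nbrsIn G X v).card ≤ (nbrsIn G X w).card)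

/-- The mode of the branching for given degrees of `u` and `v`. -/
def branchMode (du dv : ℕ) : ℕ :=
  if du = 0 then 1 else if dv = du ∧ du ≤ 3 then 2 else if du ≤ 2 then 1 else 0

theorem sum_union_le {ι : Type*} [DecidableEq ι] {f : ι → ℝ} (hf : ∀ i, 0 ≤ f i)
    (A B : Finset ι) : ∑ i ∈ A ∪ B, f i ≤ ∑ i ∈ A, f i + ∑ i ∈ B, f i := by
  rw [← Finset.sum_union_inter]
  exact le_add_of_nonneg_right (Finset.sum_nonneg fun i _ => hf i)

/-- Once the two neighbours `a` and `b` of the pivot are fixed, a pair branch is determined by the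
two partners, so there are at most `A.card * B.card` of them. -/
theorem sum_le_of_subset_product {f : ℕ × ℕ × ℕ × ℕ → ℝ} {P : Finset (ℕ × ℕ × ℕ × ℕ)}
    {A B : Finset ℕ} {a b : ℕ} {w : ℝ} (hw : 0 ≤ w)
    (hP : ∀ t ∈ P, t.1 = a ∧ t.2.2.1 = b ∧ t.2.1 ∈ A ∧ t.2.2.2 ∈ B)
    (hf : ∀ t ∈ P, f t ≤ w) : ∑ t ∈ P, f t ≤ (A.card : ℝ) * B.card * w := by
  have hsub : P ⊆ (A ×ˢ B).image fun z => (a, z.1, b, z.2) := by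
    rintro ⟨a', x, b', y⟩ ht
    obtain ⟨h1, h2, h3, h4⟩ := hP _ ht
    simp only at h1 h2 h3 h4
    subst h1 h2
    exact Finset.mem_image.2 ⟨(x, y), Finset.mem_product.2 ⟨h3, h4⟩, rfl⟩
  have hcard : (P.card : ℝ) ≤ (A.card : ℝ) * B.card := by
    have := (Finset.card_le_card hsub).trans Finset.card_image_le
    rw [Finset.card_product] at this
    exact_mod_cast this
  refine (Finset.sum_le_card_nsmul P f w hf).trans ?_
  rw [nsmul_eq_mul]
  exact mul_le_mul_of_nonneg_right hcard hw

variable {G : SimpleGraph ℕ} {X : Finset ℕ} {md u v : ℕ} {β : ℝ}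

/-- The weight of a branch. -/
noncomputable def branchWeight (G : SimpleGraph ℕ) (X : Finset ℕ) (md u : ℕ) (β : ℝ)
    (t : ℕ × ℕ × ℕ × ℕ) : ℝ :=
  β ^ (branchRest G X md u t.1 t.2.1 t.2.2.1 t.2.2.2).card

theorem branchWeight_nonneg (hβ : 1 ≤ β) (t : ℕ × ℕ × ℕ × ℕ) :
    0 ≤ branchWeight G X md u β t := by
  unfold branchWeight; positivity

/-- Reduces every weight estimate to exhibiting a set `R` of at least `r` vertices of `X` that the
branch removes. -/
theorem branchWeight_le (hβ : 1 ≤ β) {t : ℕ × ℕ × ℕ × ℕ} {R : Finset ℕ} {r : ℕ} (hR : R ⊆ X)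
    (h : ∀ i ∈ R, i ∉ branchRest G X md u t.1 t.2.1 t.2.2.1 t.2.2.2) (hr : r ≤ R.card) :
    branchWeight G X md u β t ≤ β ^ X.card * β⁻¹ ^ r := by
  have h0 : 0 < β := by linarith
  have h1 : (branchRest G X md u t.1 t.2.1 t.2.2.1 t.2.2.2).card + r ≤ X.card := by
    have hd : Disjoint (branchRest G X md u t.1 t.2.1 t.2.2.1 t.2.2.2) R :=
      Finset.disjoint_right.2 h
    have := Finset.card_le_card (Finset.union_subset
      (branchRest_subset G X md u t.1 t.2.1 t.2.2.1 t.2.2.2) hR)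
    rw [Finset.card_union_of_disjoint hd] at this
    omega
  unfold branchWeight
  rw [inv_pow, ← div_eq_mul_inv, le_div_iff₀ (by positivity), ← pow_add]
  exact pow_le_pow_right₀ hβ h1

/-- Bipartiteness makes the neighbourhoods of `a` and `x` disjoint, so their degrees add. The two
endpoints are already counted, since each lies in the neighbourhood of the other. -/
theorem branchWeight_edge_le (hβ : 1 ≤ β) {c : ℕ → Bool} (hc : ∀ i j, G.Adj i j → c i ≠ c j)
    {a x r : ℕ} (hax : G.Adj a x) (hr : r ≤ (nbrsIn G X a).card + (nbrsIn G X x).card) :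
    branchWeight G X md u β (a, x, a, x) ≤ β ^ X.card * β⁻¹ ^ r := by
  refine branchWeight_le hβ (R := nbrsIn G X a ∪ nbrsIn G X x) ?_ ?_ ?_
  · intro i hi
    rw [Finset.mem_union, mem_nbrsIn, mem_nbrsIn] at hi
    exact hi.elim And.left And.left
  · intro i hi hi'
    rw [mem_branchRest] at hi'
    rw [Finset.mem_union, mem_nbrsIn, mem_nbrsIn] at hi
    refine hi'.2.2 (Or.inl ⟨hax.ne, ?_⟩)
    rcases hi with hi | hi
    exacts [Or.inl hi.2, Or.inr (Or.inl hi.2)]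
  · rwa [Finset.card_union_of_disjoint]
    rw [Finset.disjoint_left]
    intro i hi hi'
    rw [mem_nbrsIn] at hi hi'
    have h1 := hc _ _ hi.2
    have h2 := hc _ _ hi'.2
    have h3 := hc _ _ hax
    revert h1 h2 h3
    cases c a <;> cases c x <;> cases c i <;> simp

theorem branchWeight_discard_le (hβ : 1 ≤ β) (hu : u ∈ X) {r : ℕ}
    (hr : r ≤ 1 + if md = 1 then (nbrsIn G X u).card else 0) :
    branchWeight G X md u β (u, u, u, u) ≤ β ^ X.card * β⁻¹ ^ r := by
  refine branchWeight_le hβ (R := insert u (if md = 1 then nbrsIn G X u else ∅)) ?_ ?_ ?_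
  · refine Finset.insert_subset hu ?_
    split_ifs
    · exact fun i hi => (mem_nbrsIn.1 hi).1
    · exact Finset.empty_subset _
  · intro i hi hi'
    rw [mem_branchRest] at hi'
    refine hi'.2.2 (Or.inr (Or.inl ⟨rfl, ?_⟩))
    rcases Finset.mem_insert.1 hi with h | h
    · exact Or.inl h
    · split_ifs at h with hm
      · exact Or.inr ⟨hm, (mem_nbrsIn.1 h).2⟩
      · exact absurd h (Finset.notMem_empty _)
  · rw [Finset.card_insert_of_notMem]
    · split_ifs at hr ⊢
      · omega
      · rw [Finset.card_empty]; omega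
    · split_ifs
      · exact fun h => G.loopless.irrefl u (mem_nbrsIn.1 h).2
      · exact Finset.notMem_empty _

theorem card_union_eq (A B : Finset ℕ) :
    (A ∪ B).card = (A \ B).card + (B \ A).card + (A ∩ B).card := by
  have h1 := Finset.card_union_add_card_inter A B
  have h2 := Finset.card_sdiff_add_card_inter A B
  have h3 := Finset.card_sdiff_add_card_inter B A
  rw [Finset.inter_comm B A] at h3
  omega

/-- Two edges `ax` and `by` with a common neighbour of `a` and `b`, in a bipartite graph. -/
theorem branchWeight_pair_le (hβ : 1 ≤ β) {c : ℕ → Bool} (hc : ∀ i j, G.Adj i j → c i ≠ c j)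
    {w a x b y k r : ℕ} (hb : b ∈ X) (hwa : G.Adj w a) (hwb : G.Adj w b) (hax : G.Adj a x) (hbx : ¬ G.Adj b x)
    (hk : k + 1 ≤ (nbrsIn G X x).card)
    (hr : r ≤ (nbrsIn G X a \ nbrsIn G X b).card + (nbrsIn G X b \ nbrsIn G X a).card +
      (nbrsIn G X a ∩ nbrsIn G X b).card + 2 + k) :
    branchWeight G X md u β (a, x, b, y) ≤ β ^ X.card * β⁻¹ ^ r := by
  have hbx' : b ∉ nbrsIn G X x := fun h => hbx (mem_nbrsIn.1 h).2.symm
  -- The removed set splits by colour: `b` and the neighbours of `x` share the colour of `a`, while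
  -- the neighbours of `a` and of `b` have the other one. As `b` is not adjacent to `x`, the first
  -- part has at least `k + 2` elements.
  have hcol : ∀ i ∈ insert b (nbrsIn G X x), c i = c a := by
    intro i hi
    have h1 := hc _ _ hax
    have h2 := hc _ _ hwa
    have h3 := hc _ _ hwb
    rcases Finset.mem_insert.1 hi with rfl | hi
    · revert h2 h3
      cases c i <;> cases c w <;> cases c a <;> simp
    · have h4 := hc _ _ (mem_nbrsIn.1 hi).2
      revert h1 h4
      cases c i <;> cases c x <;> cases c a <;> simp
  refine branchWeight_le hβ
    (R := (nbrsIn G X a ∪ nbrsIn G X b) ∪ insert b (nbrsIn G X x)) ?_ ?_ ?_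
  · refine Finset.union_subset (Finset.union_subset ?_ ?_) (Finset.insert_subset hb ?_) <;>
      exact fun i hi => (mem_nbrsIn.1 hi).1
  · intro i hi hi'
    rw [mem_branchRest] at hi'
    simp only [Finset.mem_union, Finset.mem_insert, mem_nbrsIn] at hi
    rcases hi with (hi | hi) | hi | hi
    · exact hi'.2.2 (Or.inl ⟨hax.ne, Or.inl hi.2⟩)
    · exact hi'.2.2 (Or.inl ⟨hax.ne, Or.inr (Or.inr (Or.inl hi.2))⟩)
    · exact hi'.2.1 ⟨hax.ne, Or.inr (Or.inr (Or.inl hi))⟩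
    · exact hi'.2.2 (Or.inl ⟨hax.ne, Or.inr (Or.inl hi.2)⟩)
  · rw [Finset.card_union_of_disjoint, card_union_eq, Finset.card_insert_of_notMem hbx']
    · omega
    · rw [Finset.disjoint_left]
      intro i hi hi'
      have h1 := hcol i hi'
      have h2 := hcol b (Finset.mem_insert_self _ _)
      simp only [Finset.mem_union, mem_nbrsIn] at hi
      rcases hi with hi | hi
      · exact hc _ _ hi.2 h1.symm
      · exact hc _ _ hi.2 (h2.trans h1.symm)

/-- Two edges `ax` and `by` with a common neighbour of `a` and `b` at distance two from `u`, in a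
bipartite graph. -/
theorem branchWeight_far_pair_le (hβ : 1 ≤ β) {c : ℕ → Bool} (hc : ∀ i j, G.Adj i j → c i ≠ c j)
    {a x b y k r : ℕ} (hu : u ∈ X) (hb : b ∈ X) (huv : G.Adj u v)
    (hva : G.Adj v a) (hvb : G.Adj v b) (hab : a ≠ b) (hbu : b ≠ u) (hax : G.Adj a x) (hbx : ¬ G.Adj b x) (hux : ¬ G.Adj u x) (hua : ¬ G.Adj u a)
    (hk : k + 1 ≤ (nbrsIn G X x).card)
    (hr : r ≤ ((nbrsIn G X a \ nbrsIn G X b) \ nbrsIn G X u).card +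
      ((nbrsIn G X b \ nbrsIn G X a) \ nbrsIn G X u).card + (nbrsIn G X u).card + 3 + k) :
    branchWeight G X md u β (a, x, b, y) ≤ β ^ X.card * β⁻¹ ^ r := by
  have hbx' : b ∉ nbrsIn G X x := fun h => hbx (mem_nbrsIn.1 h).2.symm
  have hux' : u ∉ nbrsIn G X x := fun h => hux (mem_nbrsIn.1 h).2.symm
  have hcol : ∀ i ∈ insert u (insert b (nbrsIn G X x)), c i = c a := by
    intro i hi
    have h1 := hc _ _ hax
    have h2 := hc _ _ hva
    have h3 := hc _ _ hvb
    have h5 := hc _ _ huv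
    rcases Finset.mem_insert.1 hi with rfl | hi
    · revert h2 h5
      cases c i <;> cases c v <;> cases c a <;> simp
    rcases Finset.mem_insert.1 hi with rfl | hi
    · revert h2 h3
      cases c i <;> cases c v <;> cases c a <;> simp
    · have h4 := hc _ _ (mem_nbrsIn.1 hi).2
      revert h1 h4
      cases c i <;> cases c x <;> cases c a <;> simp
  -- In addition `u` and all its neighbours are removed. The parts of the neighbourhoods of `a` and
  -- `b` are taken outside that of `u`, so that all pieces are disjoint; `u` has the colour of `a`
  -- and joins `b` and the neighbours of `x`.
  refine branchWeight_le hβ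
    (R := (((nbrsIn G X a \ nbrsIn G X b) \ nbrsIn G X u) ∪
      ((nbrsIn G X b \ nbrsIn G X a) \ nbrsIn G X u) ∪ nbrsIn G X u) ∪
        insert u (insert b (nbrsIn G X x))) ?_ ?_ ?_
  · intro i hi
    simp only [Finset.mem_union, Finset.mem_sdiff, Finset.mem_insert, mem_nbrsIn] at hi
    rcases hi with ((hi | hi) | hi) | rfl | rfl | hi
    exacts [hi.1.1.1, hi.1.1.1, hi.1, hu, hb, hi.1]
  · intro i hi hi'
    rw [mem_branchRest] at hi'
    simp only [Finset.mem_union, Finset.mem_sdiff, Finset.mem_insert, mem_nbrsIn] at hi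
    rcases hi with ((hi | hi) | hi) | hi | hi | hi
    · exact hi'.2.2 (Or.inl ⟨hax.ne, Or.inl hi.1.1.2⟩)
    · exact hi'.2.2 (Or.inl ⟨hax.ne, Or.inr (Or.inr (Or.inl hi.1.1.2))⟩)
    · exact hi'.2.2 (Or.inr (Or.inr ⟨hab, hua, Or.inr hi.2⟩))
    · exact hi'.2.2 (Or.inr (Or.inr ⟨hab, hua, Or.inl hi⟩))
    · exact hi'.2.1 ⟨hax.ne, Or.inr (Or.inr (Or.inl hi))⟩
    · exact hi'.2.2 (Or.inl ⟨hax.ne, Or.inr (Or.inl hi.2)⟩)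
  · rw [Finset.card_union_of_disjoint, Finset.card_union_of_disjoint,
      Finset.card_union_of_disjoint, Finset.card_insert_of_notMem,
      Finset.card_insert_of_notMem hbx']
    · omega
    · rw [Finset.mem_insert, not_or]
      exact ⟨hbu.symm, hux'⟩
    · rw [Finset.disjoint_left]
      intro i hi hi'
      simp only [Finset.mem_sdiff] at hi hi'
      exact hi.1.2 hi'.1.1
    · rw [Finset.disjoint_left]
      intro i hi hi'
      simp only [Finset.mem_union, Finset.mem_sdiff] at hi
      rcases hi with hi | hi
      exacts [hi.2 hi', hi.2 hi']
    · rw [Finset.disjoint_left]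
      intro i hi hi'
      have h1 := hcol i hi'
      have h2 := hcol b (Finset.mem_insert_of_mem (Finset.mem_insert_self _ _))
      have h3 := hcol u (Finset.mem_insert_self _ _)
      simp only [Finset.mem_union, Finset.mem_sdiff, mem_nbrsIn] at hi
      rcases hi with (hi | hi) | hi
      · exact hc _ _ hi.1.1.2 h1.symm
      · exact hc _ _ hi.1.1.2 (h2.trans h1.symm)
      · exact hc _ _ hi.2 (h3.trans h1.symm)

end BranchWeight

/-! ### The total weight of the branches in each mode -/

section BranchSum

variable {G : SimpleGraph ℕ} {X : Finset ℕ} {u v : ℕ} {β : ℝ}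

theorem inv_le_of_base_le (hβ : 701009 / 500000 ≤ β) :
    1 ≤ β ∧ 0 ≤ β⁻¹ ∧ β⁻¹ ≤ 500000 / 701009 := by
  have h0 : 0 < β := lt_of_lt_of_le (by norm_num) hβ
  refine ⟨le_trans (by norm_num) hβ, by positivity, ?_⟩
  rw [inv_le_comm₀ h0 (by norm_num)]
  norm_num
  exact hβ

/-- The quadruples that select a single edge at `w`. -/
def edgeQuads (w : ℕ) (S : Finset ℕ) : Finset (ℕ × ℕ × ℕ × ℕ) :=
  S.image fun x => (w, x, w, x)

theorem sum_edgeQuads_le (hβ : 1 ≤ β) {c : ℕ → Bool} (hc : ∀ i j, G.Adj i j → c i ≠ c j)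
    {md w r : ℕ} {S : Finset ℕ}
    (hS : ∀ x ∈ S, G.Adj w x ∧ r ≤ (nbrsIn G X w).card + (nbrsIn G X x).card) :
    ∑ t ∈ edgeQuads w S, branchWeight G X md u β t ≤ S.card * (β ^ X.card * β⁻¹ ^ r) := by
  have hβ0 : 0 ≤ β := by linarith
  refine (Finset.sum_le_card_nsmul _ _ (β ^ X.card * β⁻¹ ^ r) fun t ht => ?_).trans ?_
  · obtain ⟨x, hx, rfl⟩ := Finset.mem_image.1 ht
    exact branchWeight_edge_le hβ hc (hS x hx).1 (hS x hx).2
  · rw [nsmul_eq_mul]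
    refine mul_le_mul_of_nonneg_right ?_ (by positivity)
    exact_mod_cast Finset.card_image_le

theorem exists_ordered_pair {S : Finset ℕ} (h : S.card = 2) : ∃ a b, a < b ∧ S = {a, b} := by
  obtain ⟨a, b, hab, rfl⟩ := Finset.card_eq_two.1 h
  rcases lt_or_gt_of_ne hab with h | h
  · exact ⟨a, b, h, rfl⟩
  · exact ⟨b, a, h, Finset.pair_comm a b⟩

theorem eq_of_mem_ordered_pair {a b a' b' : ℕ} (hab : a < b) (h : a' < b')
    (ha : a' ∈ ({a, b} : Finset ℕ)) (hb : b' ∈ ({a, b} : Finset ℕ)) : a' = a ∧ b' = b := by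
  rw [Finset.mem_insert, Finset.mem_singleton] at ha hb
  omega

theorem eq_empty_of_card_le_one {P : Finset (ℕ × ℕ × ℕ × ℕ)} {S : Finset ℕ} (hS : S.card ≤ 1)
    (hP : ∀ t ∈ P, t.1 ∈ S ∧ t.2.2.1 ∈ S ∧ t.1 < t.2.2.1) : P = ∅ := by
  refine Finset.eq_empty_of_forall_notMem fun t ht => ?_
  obtain ⟨h1, h2, h3⟩ := hP t ht
  exact h3.ne (Finset.card_le_one.1 hS _ h1 _ h2)

variable {T : Finset (ℕ × ℕ × ℕ × ℕ)}

/-- An edge `ux` removes the degree of `u` plus at least four vertices, so the sum is the one in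
`weight_high_degree`. -/
theorem sum_branchWeight_le_of_mode_zero (hβ : 701009 / 500000 ≤ β) {c : ℕ → Bool}
    (hc : ∀ i j, G.Adj i j → c i ≠ c j) (hu : u ∈ X)
    (hnbr : ∀ x ∈ nbrsIn G X u, 4 ≤ (nbrsIn G X x).card)
    (hT : ∀ t ∈ T, IsBranch G X 0 u u t.1 t.2.1 t.2.2.1 t.2.2.2) :
    ∑ t ∈ T, branchWeight G X 0 u β t ≤ β ^ X.card := by
  obtain ⟨hβ1, hy0, hy⟩ := inv_le_of_base_le hβ
  have hnn : ∀ t, 0 ≤ branchWeight G X 0 u β t := branchWeight_nonneg hβ1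
  have hsub : T ⊆ edgeQuads u (nbrsIn G X u) ∪ {(u, u, u, u)} := by
    rintro ⟨a, x, b, y⟩ ht
    rw [Finset.mem_union, Finset.mem_singleton]
    rcases hT _ ht with ⟨h1, h2, ha, hx, hax, h | h⟩ | ⟨-, h1, h2, h3, h4⟩ | h
    · simp only at h1 h2 ha hx hax h
      subst h h1 h2
      exact Or.inl (Finset.mem_image.2 ⟨x, mem_nbrsIn.2 ⟨hx, hax⟩, rfl⟩)
    · exact absurd h.1 (by omega)
    · simp only at h1 h2 h3 h4
      subst h1 h2 h3 h4
      exact Or.inr rfl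
    · exact absurd rfl h.1
  have h1 := sum_edgeQuads_le (u := u) (md := 0) (r := (nbrsIn G X u).card + 4) hβ1 hc
    (S := nbrsIn G X u) (w := u)
    fun x hx => ⟨(mem_nbrsIn.1 hx).2, Nat.add_le_add_left (hnbr x hx) _⟩
  have h2 := branchWeight_discard_le (G := G) (md := 0) (r := 1) hβ1 hu (by simp)
  have h3 := (Finset.sum_le_sum_of_subset_of_nonneg hsub fun t _ _ => hnn t).trans
    (sum_union_le hnn _ _)
  rw [Finset.sum_singleton] at h3
  have h4 := mul_le_mul_of_nonneg_left (weight_high_degree hy0 hy (d := (nbrsIn G X u).card))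
    (show 0 ≤ β ^ X.card by positivity)
  rw [pow_one] at h2
  linarith

/-- In degree zero only the discarding branch exists. In degree one the edge removes at least three
vertices, and discarding removes `u` with its neighbour. In degree two the sum is the one in
`weight_degree_two`. The neighbours have strictly larger degree because equal degrees are left to
mode `2`. -/
theorem sum_branchWeight_le_of_mode_one (hβ : 701009 / 500000 ≤ β) {c : ℕ → Bool}
    (hc : ∀ i j, G.Adj i j → c i ≠ c j) (hu : u ∈ X)
    (hmin : ∀ w ∈ X, (nbrsIn G X u).card ≤ (nbrsIn G X w).card)
    (hnbr : ∀ x ∈ nbrsIn G X u, (nbrsIn G X u).card + 1 ≤ (nbrsIn G X x).card)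
    (hdeg : (nbrsIn G X u).card ≤ 2)
    (hT : ∀ t ∈ T, IsBranch G X 1 u u t.1 t.2.1 t.2.2.1 t.2.2.2) :
    ∑ t ∈ T, branchWeight G X 1 u β t ≤ β ^ X.card := by
  obtain ⟨hβ1, hy0, hy⟩ := inv_le_of_base_le hβ
  have hB : 0 ≤ β ^ X.card := by positivity
  have hnn : ∀ t, 0 ≤ branchWeight G X 1 u β t := branchWeight_nonneg hβ1
  set P := T.filter fun t => t.1 < t.2.2.1 with hPdef
  have hP : ∀ t ∈ P, t.1 < t.2.2.1 ∧
      (t.1 ∈ X ∧ t.2.1 ∈ X ∧ t.2.2.1 ∈ X ∧ t.2.2.2 ∈ X) ∧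
      (G.Adj t.1 t.2.1 ∧ G.Adj t.2.2.1 t.2.2.2) ∧
      (¬ G.Adj t.1 t.2.2.2 ∧ ¬ G.Adj t.2.2.1 t.2.1) ∧ G.Adj u t.1 ∧ G.Adj u t.2.2.1 := by
    intro t ht
    obtain ⟨ht, hlt⟩ := Finset.mem_filter.1 ht
    rcases hT t ht with h | h | ⟨-, h1, h2, h3, h4, h | h⟩
    · exact absurd h.1 hlt.ne
    · exact absurd (h.2.1.trans h.2.2.2.1.symm) hlt.ne
    · exact ⟨h1, h2, h3, ⟨h4.2.1, h4.2.2.1⟩, h.1, h.2.1⟩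
    · exact absurd h.1 (by omega)
  have hsub : T ⊆ edgeQuads u (nbrsIn G X u) ∪ ({(u, u, u, u)} ∪ P) := by
    rintro ⟨a, x, b, y⟩ ht
    rw [Finset.mem_union, Finset.mem_union, Finset.mem_singleton]
    rcases hT _ ht with ⟨h1, h2, ha, hx, hax, h | h⟩ | ⟨-, h1, h2, h3, h4⟩ | h
    · simp only at h1 h2 ha hx hax h
      subst h h1 h2
      exact Or.inl (Finset.mem_image.2 ⟨x, mem_nbrsIn.2 ⟨hx, hax⟩, rfl⟩)
    · exact absurd h.1 (by omega)
    · simp only at h1 h2 h3 h4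
      subst h1 h2 h3 h4
      exact Or.inr (Or.inl rfl)
    · exact Or.inr (Or.inr (Finset.mem_filter.2 ⟨ht, h.2.1⟩))
  have h3 := ((Finset.sum_le_sum_of_subset_of_nonneg hsub fun t _ _ => hnn t).trans
    (sum_union_le hnn _ _)).trans (add_le_add_right (sum_union_le hnn _ _) _)
  rw [Finset.sum_singleton] at h3
  have h2 := branchWeight_discard_le (G := G) (md := 1) (r := 1 + (nbrsIn G X u).card) hβ1 hu (by simp)
  have hPS : ∀ t ∈ P, t.1 ∈ nbrsIn G X u ∧ t.2.2.1 ∈ nbrsIn G X u ∧ t.1 < t.2.2.1 := fun t ht => by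
    obtain ⟨h4, h5, -, -, h6, h7⟩ := hP t ht
    exact ⟨mem_nbrsIn.2 ⟨h5.1, h6⟩, mem_nbrsIn.2 ⟨h5.2.2.1, h7⟩, h4⟩
  rcases Nat.lt_or_ge (nbrsIn G X u).card 2 with hd | hd
  · rw [eq_empty_of_card_le_one (by omega) hPS, Finset.sum_empty, add_zero] at h3
    have h1 := sum_edgeQuads_le (u := u) (md := 1)
      (r := (nbrsIn G X u).card + ((nbrsIn G X u).card + 1)) hβ1 hc (S := nbrsIn G X u) (w := u)
      fun x hx => ⟨(mem_nbrsIn.1 hx).2, Nat.add_le_add_left (hnbr x hx) _⟩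
    rcases Nat.lt_or_ge (nbrsIn G X u).card 1 with hd' | hd'
    · have h0 : (nbrsIn G X u).card = 0 := by omega
      rw [h0] at h1 h2
      have h4 := mul_le_mul_of_nonneg_left (hy.trans (by norm_num : _ ≤ (1 : ℝ))) hB
      norm_num at h1 h2
      linarith
    · have h0 : (nbrsIn G X u).card = 1 := by omega
      rw [h0] at h1 h2
      have h4 := mul_le_mul_of_nonneg_left (weight_leaf hy0 hy) hB
      norm_num at h1 h2
      simp only [inv_pow] at h4
      linarith
  · have h0 : (nbrsIn G X u).card = 2 := by omega
    obtain ⟨a, b, hab, hN⟩ := exists_ordered_pair h0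
    have ha := mem_nbrsIn.1 (hN.symm ▸ Finset.mem_insert_self a {b} : a ∈ nbrsIn G X u)
    have hb := mem_nbrsIn.1 (hN.symm ▸ Finset.mem_insert_of_mem (Finset.mem_singleton_self b) :
      b ∈ nbrsIn G X u)
    have hda := hnbr a (mem_nbrsIn.2 ha)
    have hdb := hnbr b (mem_nbrsIn.2 hb)
    set p := (nbrsIn G X a \ nbrsIn G X b).card with hp
    set q := (nbrsIn G X b \ nbrsIn G X a).card with hq
    set k := (nbrsIn G X a ∩ nbrsIn G X b).card with hk
    -- The pivot itself is a common neighbour of `a` and `b`.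
    have hk1 : 1 ≤ k := Finset.card_pos.2 ⟨u, Finset.mem_inter.2
      ⟨mem_nbrsIn.2 ⟨hu, ha.2.symm⟩, mem_nbrsIn.2 ⟨hu, hb.2.symm⟩⟩⟩
    have hpa : p + k = (nbrsIn G X a).card := Finset.card_sdiff_add_card_inter _ _
    have hqb : q + k = (nbrsIn G X b).card := by
      rw [hk, Finset.inter_comm]; exact Finset.card_sdiff_add_card_inter _ _
    have hE : edgeQuads u (nbrsIn G X u) = edgeQuads u {a} ∪ edgeQuads u {b} := by
      rw [hN]; unfold edgeQuads; rw [← Finset.image_union]; rfl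
    rw [hE] at h3
    have h4 := sum_union_le hnn (edgeQuads u {a}) (edgeQuads u {b})
    have h5 := sum_edgeQuads_le (u := u) (md := 1) (X := X) (r := p + k + 2) hβ1 hc (S := {a}) (w := u)
      fun x hx => by rw [Finset.mem_singleton.1 hx]; exact ⟨ha.2, by omega⟩
    have h6 := sum_edgeQuads_le (u := u) (md := 1) (X := X) (r := q + k + 2) hβ1 hc (S := {b}) (w := u)
      fun x hx => by rw [Finset.mem_singleton.1 hx]; exact ⟨hb.2, by omega⟩
    have h7 : ∑ t ∈ P, branchWeight G X 1 u β t ≤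
        (p : ℝ) * q * (β ^ X.card * β⁻¹ ^ (p + q + k + 3)) := by
      refine sum_le_of_subset_product (a := a) (b := b) (by positivity) (fun t ht => ?_)
        fun t ht => ?_
      · obtain ⟨e1, e2, e3, e4, e5, e6⟩ := hP t ht
        obtain ⟨f1, f2, f3⟩ := hPS t ht
        rw [hN] at f1 f2
        obtain ⟨g1, g2⟩ := eq_of_mem_ordered_pair hab f3 f1 f2
        rw [g1, g2] at e3 e4
        refine ⟨g1, g2, ?_, ?_⟩
        · exact Finset.mem_sdiff.2 ⟨mem_nbrsIn.2 ⟨e2.2.1, e3.1⟩, fun h => e4.2 (mem_nbrsIn.1 h).2⟩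
        · exact Finset.mem_sdiff.2 ⟨mem_nbrsIn.2 ⟨e2.2.2.2, e3.2⟩,
            fun h => e4.1 (mem_nbrsIn.1 h).2⟩
      · obtain ⟨e1, e2, e3, e4, e5, e6⟩ := hP t ht
        obtain ⟨f1, f2, f3⟩ := hPS t ht
        rw [hN] at f1 f2
        obtain ⟨g1, g2⟩ := eq_of_mem_ordered_pair hab f3 f1 f2
        refine branchWeight_pair_le (k := 1) hβ1 hc e2.2.2.1 e5 e6 e3.1 e4.2 ?_ ?_
        · exact (h0.symm.le).trans (hmin _ e2.2.1)
        · rw [g1, g2]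
    have h8 := mul_le_mul_of_nonneg_left
      (weight_degree_two hy0 hy hk1 (p := p) (q := q) (by omega) (by omega)) hB
    rw [h0] at h2
    norm_num only [Finset.card_singleton, Nat.cast_one, one_mul] at h2 h5 h6
    linarith

/-- In degree one the edge `uv` is a component. In degree two there are three edges, each removing
at least four vertices. In degree three there are five edges and two families of pairs; the pairs at
`v` arise only when nothing at or next to `u` is selected, so the removal of `u` and its neighbours
gives them the larger exponent. -/
theorem sum_branchWeight_le_of_mode_two (hβ : 701009 / 500000 ≤ β) {c : ℕ → Bool}
    (hc : ∀ i j, G.Adj i j → c i ≠ c j) (hu : u ∈ X) (hv : v ∈ X) (huv : G.Adj u v)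
    (hmin : ∀ w ∈ X, (nbrsIn G X u).card ≤ (nbrsIn G X w).card)
    (hdv : (nbrsIn G X v).card = (nbrsIn G X u).card) (hdeg : (nbrsIn G X u).card ≤ 3)
    (hT : ∀ t ∈ T, IsBranch G X 2 u v t.1 t.2.1 t.2.2.1 t.2.2.2) :
    ∑ t ∈ T, branchWeight G X 2 u β t ≤ β ^ X.card := by
  classical
  obtain ⟨hβ1, hy0, hy⟩ := inv_le_of_base_le hβ
  have hB : 0 ≤ β ^ X.card := by positivity
  have hnn : ∀ t, 0 ≤ branchWeight G X 2 u β t := branchWeight_nonneg hβ1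
  set P := T.filter fun t => t.1 < t.2.2.1 ∧ G.Adj u t.1 with hPdef
  set Q := T.filter fun t => t.1 < t.2.2.1 ∧ ¬ G.Adj u t.1 with hQdef
  have hPQ : ∀ t ∈ T, t.1 < t.2.2.1 →
      (t.1 ∈ X ∧ t.2.1 ∈ X ∧ t.2.2.1 ∈ X ∧ t.2.2.2 ∈ X) ∧
      (G.Adj t.1 t.2.1 ∧ G.Adj t.2.2.1 t.2.2.2) ∧
      (¬ G.Adj t.1 t.2.2.2 ∧ ¬ G.Adj t.2.2.1 t.2.1) ∧
      ((G.Adj u t.1 ∧ G.Adj u t.2.2.1 ∧ t.1 ≠ v ∧ t.2.2.1 ≠ v) ∨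
        (G.Adj v t.1 ∧ G.Adj v t.2.2.1 ∧ t.1 ≠ u ∧ t.2.2.1 ≠ u ∧
        (¬ G.Adj u t.1 ∧ ¬ G.Adj u t.2.2.1 ∧ ¬ G.Adj u t.2.1 ∧ ¬ G.Adj u t.2.2.2))) := by
    intro t ht hlt
    rcases hT t ht with h | h | ⟨-, h1, h2, h3, h4, h⟩
    · exact absurd h.1 hlt.ne
    · exact absurd rfl h.1
    · exact ⟨h2, h3, ⟨h4.2.1, h4.2.2.1⟩, h.imp_right fun h => h.2⟩
  have hsub : T ⊆ (edgeQuads u (nbrsIn G X u) ∪ edgeQuads v ((nbrsIn G X v).erase u)) ∪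
      (P ∪ Q) := by
    rintro ⟨a, x, b, y⟩ ht
    rw [Finset.mem_union, Finset.mem_union, Finset.mem_union]
    rcases hT _ ht with ⟨h1, h2, ha, hx, hax, h | h⟩ | ⟨h, -⟩ | h
    · simp only at h1 h2 ha hx hax h
      subst h h1 h2
      exact Or.inl (Or.inl (Finset.mem_image.2 ⟨x, mem_nbrsIn.2 ⟨hx, hax⟩, rfl⟩))
    · simp only at h1 h2 ha hx hax h
      obtain ⟨-, h, hxu⟩ := h
      subst h h1 h2
      exact Or.inl (Or.inr (Finset.mem_image.2
        ⟨x, Finset.mem_erase.2 ⟨hxu, mem_nbrsIn.2 ⟨hx, hax⟩⟩, rfl⟩))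
    · exact absurd rfl h
    · by_cases hua : G.Adj u a
      · exact Or.inr (Or.inl (Finset.mem_filter.2 ⟨ht, h.2.1, hua⟩))
      · exact Or.inr (Or.inr (Finset.mem_filter.2 ⟨ht, h.2.1, hua⟩))
  have h1 := (Finset.sum_le_sum_of_subset_of_nonneg hsub fun t _ _ => hnn t).trans
    ((sum_union_le hnn _ _).trans (add_le_add (sum_union_le hnn _ _) (sum_union_le hnn _ _)))
  have hPS : ∀ t ∈ P, t.1 ∈ (nbrsIn G X u).erase v ∧ t.2.2.1 ∈ (nbrsIn G X u).erase v ∧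
      t.1 < t.2.2.1 := fun t ht => by
    obtain ⟨h3, h4, h5⟩ := Finset.mem_filter.1 ht
    obtain ⟨h6, -, -, h7 | h7⟩ := hPQ t h3 h4
    · exact ⟨Finset.mem_erase.2 ⟨h7.2.2.1, mem_nbrsIn.2 ⟨h6.1, h7.1⟩⟩,
        Finset.mem_erase.2 ⟨h7.2.2.2, mem_nbrsIn.2 ⟨h6.2.2.1, h7.2.1⟩⟩, h4⟩
    · exact absurd h5 h7.2.2.2.2.1
  have hQS : ∀ t ∈ Q, t.1 ∈ (nbrsIn G X v).erase u ∧ t.2.2.1 ∈ (nbrsIn G X v).erase u ∧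
      t.1 < t.2.2.1 := fun t ht => by
    obtain ⟨h3, h4, h5⟩ := Finset.mem_filter.1 ht
    obtain ⟨h6, -, -, h7 | h7⟩ := hPQ t h3 h4
    · exact absurd h7.1 h5
    · exact ⟨Finset.mem_erase.2 ⟨h7.2.2.1, mem_nbrsIn.2 ⟨h6.1, h7.1⟩⟩,
        Finset.mem_erase.2 ⟨h7.2.2.2.1, mem_nbrsIn.2 ⟨h6.2.2.1, h7.2.1⟩⟩, h4⟩
  have huN : u ∈ nbrsIn G X v := mem_nbrsIn.2 ⟨hu, huv.symm⟩
  have hvN : v ∈ nbrsIn G X u := mem_nbrsIn.2 ⟨hv, huv⟩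
  have hcu : ((nbrsIn G X u).erase v).card = (nbrsIn G X u).card - 1 := Finset.card_erase_of_mem hvN
  have hcv : ((nbrsIn G X v).erase u).card = (nbrsIn G X u).card - 1 := by
    rw [Finset.card_erase_of_mem huN, hdv]
  have hpos : 0 < (nbrsIn G X u).card := Finset.card_pos.2 ⟨v, hvN⟩
  have h2 := sum_edgeQuads_le (u := u) (md := 2) (w := u)
    (r := (nbrsIn G X u).card + (nbrsIn G X u).card) hβ1 hc (S := nbrsIn G X u)
    fun x hx => ⟨(mem_nbrsIn.1 hx).2, Nat.add_le_add_left (hmin x (mem_nbrsIn.1 hx).1) _⟩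
  have h3 := sum_edgeQuads_le (u := u) (md := 2) (w := v)
    (r := (nbrsIn G X u).card + (nbrsIn G X u).card) hβ1 hc (S := (nbrsIn G X v).erase u)
    fun x hx => by
      have hx' := mem_nbrsIn.1 (Finset.mem_of_mem_erase hx)
      exact ⟨hx'.2, by rw [hdv]; exact Nat.add_le_add_left (hmin x hx'.1) _⟩
  rw [hcv] at h3
  rcases Nat.lt_or_ge (nbrsIn G X u).card 3 with hd | hd
  -- Below degree three, each of `u` and `v` has at most one neighbour besides the other, so there
  -- are no pairs.
  · rw [eq_empty_of_card_le_one (by omega) hPS, eq_empty_of_card_le_one (by omega) hQS,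
      Finset.sum_empty, add_zero, add_zero] at h1
    rcases Nat.lt_or_ge (nbrsIn G X u).card 2 with hd' | hd'
    · have h0 : (nbrsIn G X u).card = 1 := by omega
      rw [h0] at h2 h3
      have h4 := mul_le_mul_of_nonneg_left
        (pow_le_one₀ (n := 2) hy0 (hy.trans (by norm_num : _ ≤ (1 : ℝ)))) hB
      norm_num only [Nat.cast_one, one_mul, Nat.cast_zero, zero_mul] at h2 h3
      linarith
    · have h0 : (nbrsIn G X u).card = 2 := by omega
      rw [h0] at h2 h3
      have h4 := mul_le_mul_of_nonneg_left (weight_three hy0 hy) hB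
      norm_num only [Nat.cast_one, Nat.cast_ofNat, one_mul] at h2 h3
      linarith
  · have h0 : (nbrsIn G X u).card = 3 := by omega
    obtain ⟨a, b, hab, hN⟩ := exists_ordered_pair (hcu.trans (by omega))
    obtain ⟨a', b', hab', hN'⟩ := exists_ordered_pair (hcv.trans (by omega))
    have h7 : ∑ t ∈ P, branchWeight G X 2 u β t ≤
        ((nbrsIn G X a \ nbrsIn G X b).card : ℝ) * (nbrsIn G X b \ nbrsIn G X a).card *
          (β ^ X.card * β⁻¹ ^ ((nbrsIn G X a \ nbrsIn G X b).card +
            (nbrsIn G X b \ nbrsIn G X a).card + 5)) := by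
      refine sum_le_of_subset_product (a := a) (b := b) (by positivity) (fun t ht => ?_)
        fun t ht => ?_ <;>
      obtain ⟨f1, f2, f3⟩ := hPS t ht <;>
      obtain ⟨f4, f5⟩ := Finset.mem_filter.1 ht <;>
      obtain ⟨e2, e3, e4, e5⟩ := hPQ t f4 f3 <;>
      rw [hN] at f1 f2 <;>
      obtain ⟨g1, g2⟩ := eq_of_mem_ordered_pair hab f3 f1 f2
      · rw [g1, g2] at e3 e4
        refine ⟨g1, g2, ?_, ?_⟩
        · exact Finset.mem_sdiff.2 ⟨mem_nbrsIn.2 ⟨e2.2.1, e3.1⟩, fun h => e4.2 (mem_nbrsIn.1 h).2⟩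
        · exact Finset.mem_sdiff.2 ⟨mem_nbrsIn.2 ⟨e2.2.2.2, e3.2⟩,
            fun h => e4.1 (mem_nbrsIn.1 h).2⟩
      · have hub : G.Adj u t.2.2.1 := (e5.resolve_right fun h => h.2.2.2.2.1 f5.2).2.1
        refine branchWeight_pair_le (k := 2) hβ1 hc e2.2.2.1 f5.2 hub e3.1 e4.2 ?_ ?_
        · exact (h0.symm.le).trans (hmin _ e2.2.1)
        · have : 1 ≤ (nbrsIn G X t.1 ∩ nbrsIn G X t.2.2.1).card := Finset.card_pos.2
            ⟨u, Finset.mem_inter.2 ⟨mem_nbrsIn.2 ⟨hu, f5.2.symm⟩, mem_nbrsIn.2 ⟨hu, hub.symm⟩⟩⟩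
          rw [g1, g2] at this ⊢
          omega
    have h8 : ∑ t ∈ Q, branchWeight G X 2 u β t ≤
        (((nbrsIn G X a' \ nbrsIn G X b') \ nbrsIn G X u).card : ℝ) *
          ((nbrsIn G X b' \ nbrsIn G X a') \ nbrsIn G X u).card *
          (β ^ X.card * β⁻¹ ^ (((nbrsIn G X a' \ nbrsIn G X b') \ nbrsIn G X u).card +
            ((nbrsIn G X b' \ nbrsIn G X a') \ nbrsIn G X u).card + 8)) := by
      refine sum_le_of_subset_product (a := a') (b := b') (by positivity) (fun t ht => ?_)
        fun t ht => ?_ <;>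
      obtain ⟨f1, f2, f3⟩ := hQS t ht <;>
      obtain ⟨f4, f5⟩ := Finset.mem_filter.1 ht <;>
      obtain ⟨e2, e3, e4, e5⟩ := hPQ t f4 f3 <;>
      rw [hN'] at f1 f2 <;>
      obtain ⟨g1, g2⟩ := eq_of_mem_ordered_pair hab' f3 f1 f2 <;>
      replace e5 := e5.resolve_left fun h => f5.2 h.1
      · rw [g1, g2] at e3 e4
        refine ⟨g1, g2, ?_, ?_⟩
        · exact Finset.mem_sdiff.2 ⟨Finset.mem_sdiff.2 ⟨mem_nbrsIn.2 ⟨e2.2.1, e3.1⟩,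
            fun h => e4.2 (mem_nbrsIn.1 h).2⟩, fun h => e5.2.2.2.2.2.2.1 (mem_nbrsIn.1 h).2⟩
        · exact Finset.mem_sdiff.2 ⟨Finset.mem_sdiff.2 ⟨mem_nbrsIn.2 ⟨e2.2.2.2, e3.2⟩,
            fun h => e4.1 (mem_nbrsIn.1 h).2⟩, fun h => e5.2.2.2.2.2.2.2 (mem_nbrsIn.1 h).2⟩
      · refine branchWeight_far_pair_le (k := 2) hβ1 hc hu e2.2.2.1 huv e5.1 e5.2.1 f3.ne
          e5.2.2.2.1 e3.1 e4.2 e5.2.2.2.2.2.2.1 f5.2 ?_ ?_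
        · exact (h0.symm.le).trans (hmin _ e2.2.1)
        · rw [g1, g2]
          omega
    have h9 := mul_le_mul_of_nonneg_left (weight_degree_three hy0 hy
      (p := (nbrsIn G X a \ nbrsIn G X b).card) (q := (nbrsIn G X b \ nbrsIn G X a).card)
      (p' := ((nbrsIn G X a' \ nbrsIn G X b') \ nbrsIn G X u).card)
      (q' := ((nbrsIn G X b' \ nbrsIn G X a') \ nbrsIn G X u).card) le_rfl le_rfl) hB
    rw [h0] at h2 h3
    norm_num only [Nat.cast_ofNat] at h2 h3
    linarith

/-- The total weight of the branches at a pivot does not exceed the weight of the whole graph. -/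
theorem sum_branchWeight_le (hβ : 701009 / 500000 ≤ β) {c : ℕ → Bool}
    (hc : ∀ i j, G.Adj i j → c i ≠ c j) (h : IsPivot G X u v) {md : ℕ}
    (hmd : md = branchMode (nbrsIn G X u).card (nbrsIn G X v).card)
    (hT : ∀ t ∈ T, IsBranch G X md u (if md = 2 then v else u) t.1 t.2.1 t.2.2.1 t.2.2.2) :
    ∑ t ∈ T, branchWeight G X md u β t ≤ β ^ X.card := by
  obtain ⟨hu, hmin, hnbr⟩ := h
  have hv : (nbrsIn G X u).card ≠ 0 → v ∈ X ∧ G.Adj u v ∧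
      ∀ w ∈ X, G.Adj u w → (nbrsIn G X v).card ≤ (nbrsIn G X w).card := fun h0 =>
    hnbr.resolve_left fun h => h0 h.1
  unfold branchMode at hmd
  split_ifs at hmd with h1 h2 h3
  · subst hmd
    refine sum_branchWeight_le_of_mode_one hβ hc hu hmin (fun x hx => ?_) (by omega) hT
    rw [Finset.card_eq_zero.1 h1] at hx
    exact absurd hx (Finset.notMem_empty x)
  · subst hmd
    obtain ⟨hv1, hv2, -⟩ := hv h1
    exact sum_branchWeight_le_of_mode_two hβ hc hu hv1 hv2 hmin h2.1 h2.2 hT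
  · subst hmd
    obtain ⟨hv1, hv2, hv3⟩ := hv h1
    have h4 := hmin v hv1
    refine sum_branchWeight_le_of_mode_one hβ hc hu hmin (fun x hx => ?_) h3 hT
    have h5 := hv3 x (mem_nbrsIn.1 hx).1 (mem_nbrsIn.1 hx).2
    omega
  · subst hmd
    obtain ⟨hv1, hv2, hv3⟩ := hv h1
    have h4 := hmin v hv1
    refine sum_branchWeight_le_of_mode_zero hβ hc hu (fun x hx => ?_) hT
    have h5 := hv3 x (mem_nbrsIn.1 hx).1 (mem_nbrsIn.1 hx).2
    omega

end BranchSum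

/-! ## Adjacent vertices of degree three -/

theorem exists_maximum_inducesMatching {V : Type*} [Finite V] (G : SimpleGraph V) :
    ∃ W : Finset V, InducesMatching G W ∧ ∀ W', InducesMatching G W' → W'.card ≤ W.card := by
  classical
  have := Fintype.ofFinite V
  obtain ⟨W, hW, hmax⟩ := Finset.exists_max_image
    (Finset.univ.filter fun W : Finset V => InducesMatching G W) Finset.card
    ⟨∅, by simp [InducesMatching.empty]⟩
  exact ⟨W, (Finset.mem_filter.1 hW).2, fun W' hW' => hmax W' (by simp [hW'])⟩

theorem InducesMatching.exists_isLargestIndepEdgeSet {V : Type*} {G : SimpleGraph V} {W : Finset V}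
    (h : InducesMatching G W) (hmax : ∀ W', InducesMatching G W' → W'.card ≤ W.card) :
    ∃ M : Finset (Sym2 V), IsLargestIndepEdgeSet G M ∧ (∀ v, v ∈ W ↔ v ∈ edgeEndpoints M) ∧
      W.card = 2 * M.card ∧ ∀ a b, s(a, b) ∈ M ↔ a ∈ W ∧ b ∈ W ∧ G.Adj a b := by
  classical
  obtain ⟨M, h1, h2, h3, h4⟩ := h.exists_isIndepEdgeSet
  exact ⟨M, (isLargestIndepEdgeSet_iff h1).2 fun W' hW' => h3 ▸ hmax W' hW', h2, h3, h4⟩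

/-- Take a maximum `W` that misses both `x` and `y`, otherwise the first alternative holds. Exactly
one selected neighbour of `x` or of `y` allows an exchange that brings that vertex in; no selected
neighbour on either side allows adding `xy`. Only two selected neighbours on one side remain. -/
theorem exists_isLargestIndepEdgeSet_of_degree_three {V : Type*} [Finite V] (H : SimpleGraph V)
    {x y x₁ x₂ y₁ y₂ : V} (hx : H.neighborSet x = {y, x₁, x₂})
    (hy : H.neighborSet y = {x, y₁, y₂}) :
    ∃ M : Finset (Sym2 V), IsLargestIndepEdgeSet H M ∧
      ((s(x, y) ∈ M ∨ s(x, x₁) ∈ M ∨ s(x, x₂) ∈ M ∨ s(y, y₁) ∈ M ∨ s(y, y₂) ∈ M) ∨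
        (x₁ ∈ edgeEndpoints M ∧ x₂ ∈ edgeEndpoints M) ∨
        (y₁ ∈ edgeEndpoints M ∧ y₂ ∈ edgeEndpoints M ∧
          x₁ ∉ edgeEndpoints M ∧ x₂ ∉ edgeEndpoints M)) := by
  classical
  have hx' : ∀ z, H.Adj x z ↔ z = y ∨ z = x₁ ∨ z = x₂ := fun z => by
    rw [← SimpleGraph.mem_neighborSet, hx]; simp
  have hy' : ∀ z, H.Adj y z ↔ z = x ∨ z = y₁ ∨ z = y₂ := fun z => by
    rw [← SimpleGraph.mem_neighborSet, hy]; simp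
  have hxy : H.Adj x y := (hx' y).2 (Or.inl rfl)
  -- A selected vertex is matched along one of its three edges, and the five edges in the list are
  -- all edges at `x` or `y`.
  have of_mem : ∀ W, InducesMatching H W → (∀ W', InducesMatching H W' → W'.card ≤ W.card) →
      x ∈ W ∨ y ∈ W → ∃ M : Finset (Sym2 V), IsLargestIndepEdgeSet H M ∧
      (s(x, y) ∈ M ∨ s(x, x₁) ∈ M ∨ s(x, x₂) ∈ M ∨ s(y, y₁) ∈ M ∨ s(y, y₂) ∈ M) := by
    intro W hW hmax hmem
    obtain ⟨M, h1, h2, h3, h4⟩ := hW.exists_isLargestIndepEdgeSet hmax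
    refine ⟨M, h1, ?_⟩
    rcases hmem with hmem | hmem <;> obtain ⟨z, ⟨hz, hxz⟩, -⟩ := hW _ hmem
    · have hM := (h4 x z).2 ⟨hmem, hz, hxz⟩
      rcases (hx' z).1 hxz with rfl | rfl | rfl <;> simp [hM]
    · have hM := (h4 y z).2 ⟨hmem, hz, hxz⟩
      rcases (hy' z).1 hxz with rfl | rfl | rfl
      · rw [Sym2.eq_swap] at hM; simp [hM]
      · simp [hM]
      · simp [hM]
  obtain ⟨W, hW, hmax⟩ := exists_maximum_inducesMatching H
  by_cases hmem : x ∈ W ∨ y ∈ W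
  · obtain ⟨M, h1, h2⟩ := of_mem W hW hmax hmem
    exact ⟨M, h1, Or.inl h2⟩
  rw [not_or] at hmem
  have swap : ∀ w, (w = x ∨ w = y) → ∀ a ∈ W, H.Adj w a → (∀ i ∈ W, H.Adj w i → i = a) →
      ∃ M : Finset (Sym2 V), IsLargestIndepEdgeSet H M ∧
      (s(x, y) ∈ M ∨ s(x, x₁) ∈ M ∨ s(x, x₂) ∈ M ∨ s(y, y₁) ∈ M ∨ s(y, y₂) ∈ M) := by
    intro w hw a ha hwa huniq
    obtain ⟨p, ⟨hp, hap⟩, -⟩ := hW a ha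
    have hwW : w ∉ W := by rcases hw with rfl | rfl; exacts [hmem.1, hmem.2]
    refine of_mem _ (hW.swap hwW ha hp hwa hap huniq)
      (fun W' hW' => by rw [InducesMatching.card_swap hwW hp]; exact hmax W' hW') ?_
    rcases hw with rfl | rfl
    exacts [Or.inl (Finset.mem_insert_self _ _), Or.inr (Finset.mem_insert_self _ _)]
  obtain ⟨M, h1, h2, -, -⟩ := hW.exists_isLargestIndepEdgeSet hmax
  have adjx : ∀ z, z = x₁ ∨ z = x₂ → H.Adj x z := fun z hz => (hx' z).2 (Or.inr hz)
  have adjy : ∀ z, z = y₁ ∨ z = y₂ → H.Adj y z := fun z hz => (hy' z).2 (Or.inr hz)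
  have casex : ∀ z ∈ W, H.Adj x z → z = x₁ ∨ z = x₂ := fun z hz h =>
    ((hx' z).1 h).resolve_left fun e => hmem.2 (e ▸ hz)
  have casey : ∀ z ∈ W, H.Adj y z → z = y₁ ∨ z = y₂ := fun z hz h =>
    ((hy' z).1 h).resolve_left fun e => hmem.1 (e ▸ hz)
  by_cases a1 : x₁ ∈ W <;> by_cases a2 : x₂ ∈ W
  · exact ⟨M, h1, Or.inr (Or.inl ⟨(h2 _).1 a1, (h2 _).1 a2⟩)⟩
  · obtain ⟨M, h1, h2⟩ := swap x (Or.inl rfl) x₁ a1 (adjx _ (Or.inl rfl)) fun i hi h =>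
      (casex i hi h).resolve_right fun e => a2 (e ▸ hi)
    exact ⟨M, h1, Or.inl h2⟩
  · obtain ⟨M, h1, h2⟩ := swap x (Or.inl rfl) x₂ a2 (adjx _ (Or.inr rfl)) fun i hi h =>
      (casex i hi h).resolve_left fun e => a1 (e ▸ hi)
    exact ⟨M, h1, Or.inl h2⟩
  by_cases b1 : y₁ ∈ W <;> by_cases b2 : y₂ ∈ W
  · exact ⟨M, h1, Or.inr (Or.inr ⟨(h2 _).1 b1, (h2 _).1 b2, fun h => a1 ((h2 _).2 h),
      fun h => a2 ((h2 _).2 h)⟩)⟩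
  · obtain ⟨M, h1, h2⟩ := swap y (Or.inr rfl) y₁ b1 (adjy _ (Or.inl rfl)) fun i hi h =>
      (casey i hi h).resolve_right fun e => b2 (e ▸ hi)
    exact ⟨M, h1, Or.inl h2⟩
  · obtain ⟨M, h1, h2⟩ := swap y (Or.inr rfl) y₂ b2 (adjy _ (Or.inr rfl)) fun i hi h =>
      (casey i hi h).resolve_left fun e => b1 (e ▸ hi)
    exact ⟨M, h1, Or.inl h2⟩
  -- No neighbour of `x` or `y` is selected, so `W` together with `x` and `y` would be larger.
  · exfalso
    have h4 : InducesMatching H (W ∪ {x, y}) := hW.union (.pair hxy) fun w hw z hz hwz => by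
      rw [Finset.mem_insert, Finset.mem_singleton] at hz
      rcases hz with rfl | rfl
      · rcases casex w hw hwz.symm with rfl | rfl
        exacts [a1 hw, a2 hw]
      · rcases casey w hw hwz.symm with rfl | rfl
        exacts [b1 hw, b2 hw]
    have h5 := hmax _ h4
    rw [Finset.card_union_of_disjoint (by simp [hmem.1, hmem.2]), Finset.card_pair hxy.ne] at h5
    omega

/-! ## The bipartite double cover -/

section DoubleCover

variable {V : Type*} {G : SimpleGraph V}

theorem closedDoubleCover_adj_inl {v : V} {z : V ⊕ V} :
    (closedDoubleCover G).Adj (.inl v) z ↔ ∃ u, z = .inr u ∧ Dominates G v u := by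
  constructor
  · rintro (⟨a, b, h, rfl, h'⟩ | ⟨a, b, -, h, -⟩)
    · obtain rfl := Sum.inl.inj h
      exact ⟨b, rfl, h'.symm.imp Eq.symm id⟩
    · exact absurd h Sum.inl_ne_inr
  · rintro ⟨u, rfl, h⟩
    exact Or.inl ⟨v, u, rfl, rfl, h.symm.imp id Eq.symm⟩

theorem closedDoubleCover_adj_inr {u : V} {z : V ⊕ V} :
    (closedDoubleCover G).Adj (.inr u) z ↔ ∃ v, z = .inl v ∧ Dominates G v u := by
  rcases z with v | v
  · rw [SimpleGraph.adj_comm, closedDoubleCover_adj_inl]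
    simp
  · constructor
    · rintro (⟨a, b, h, -⟩ | ⟨a, b, h, -⟩)
      · exact absurd h.symm Sum.inl_ne_inr
      · exact absurd h.symm Sum.inl_ne_inr
    · rintro ⟨w, h, -⟩
      exact absurd h.symm Sum.inl_ne_inr

theorem isBipartite_closedDoubleCover : (closedDoubleCover G).IsBipartite := by
  refine ⟨SimpleGraph.Coloring.mk (fun x => Sum.elim (fun _ => 0) (fun _ => 1) x) ?_⟩
  intro a b hab
  rcases a with a | a
  · obtain ⟨u, rfl, -⟩ := closedDoubleCover_adj_inl.1 hab
    simp
  · obtain ⟨u, rfl, -⟩ := closedDoubleCover_adj_inr.1 hab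
    simp

/-- The partner of `v` in the second copy is a vertex dominated by `v` and by no other member of
`S`, since a second dominator would be a second neighbour among the endpoints. The sizes agree
because every edge has exactly one end in the first copy. -/
theorem isIrredundant_of_isIndepEdgeSet {M : Finset (Sym2 (V ⊕ V))}
    (hM : IsIndepEdgeSet (closedDoubleCover G) M) {S : Finset V}
    (hS : ∀ v, v ∈ S ↔ Sum.inl v ∈ edgeEndpoints M) : IsIrredundant G S ∧ S.card = M.card := by
  classical
  obtain ⟨W, h1, h2, h3, h4⟩ := InducesMatching.of_isIndepEdgeSet hM
  have hS' : ∀ v, v ∈ S ↔ Sum.inl v ∈ W := fun v => by rw [hS, h1]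
  have partner : ∀ v ∈ S, ∃ u, Sum.inr u ∈ W ∧ Dominates G v u := by
    intro v hv
    obtain ⟨z, ⟨hz, hvz⟩, -⟩ := h2 _ ((hS' v).1 hv)
    obtain ⟨u, rfl, hu⟩ := closedDoubleCover_adj_inl.1 hvz
    exact ⟨u, hz, hu⟩
  constructor
  · intro v hv
    obtain ⟨u, hu, hvu⟩ := partner v hv
    refine ⟨u, hvu, fun w hw hwv hwu => hwv ?_⟩
    exact Sum.inl_injective (h2.eq_of_adj hu ((hS' w).1 hw) ((hS' v).1 hv)
      (closedDoubleCover_adj_inr.2 ⟨w, rfl, hwu⟩) (closedDoubleCover_adj_inr.2 ⟨v, rfl, hvu⟩))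
  · choose f hf hf' using partner
    refine Finset.card_bij (fun v hv => s(Sum.inl v, Sum.inr (f v hv))) ?_ ?_ ?_
    · intro v hv
      exact (h4 _ _).2 ⟨(hS' v).1 hv, hf v hv, closedDoubleCover_adj_inl.2 ⟨_, rfl, hf' v hv⟩⟩
    · intro v hv w hw h
      rw [Sym2.eq_iff] at h
      rcases h with h | h
      · exact Sum.inl_injective h.1
      · exact absurd h.1 Sum.inl_ne_inr
    · have key : ∀ v u, Sum.inl v ∈ W → Sum.inr u ∈ W → Dominates G v u →
          ∃ w, ∃ hw : w ∈ S, s(Sum.inl w, Sum.inr (f w hw)) = s(Sum.inl v, (Sum.inr u : V ⊕ V)) := by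
        intro v u hv hu hvu
        refine ⟨v, (hS' v).2 hv, ?_⟩
        rw [h2.eq_of_adj hv (hf v _) hu (closedDoubleCover_adj_inl.2 ⟨_, rfl, hf' v _⟩)
          (closedDoubleCover_adj_inl.2 ⟨_, rfl, hvu⟩)]
      intro e he
      induction e with
      | _ a b =>
        obtain ⟨ha, hb, hab⟩ := (h4 a b).1 he
        rcases a with a | a
        · obtain ⟨u, rfl, hu⟩ := closedDoubleCover_adj_inl.1 hab
          exact key a u ha hb hu
        · obtain ⟨v, rfl, hv⟩ := closedDoubleCover_adj_inr.1 hab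
          rw [Sym2.eq_swap]
          exact key v a hb ha hv

/-- Choose for each `v` in `S` a vertex `f v` that only `v` dominates. The vertices of `S` in the
first copy and their images under `f` in the second induce a matching, because `w` is adjacent to
the copy of `f v` only for `w = v`. -/
theorem exists_isIndepEdgeSet_of_isIrredundant {S : Finset V} (hS : IsIrredundant G S) :
    ∃ M : Finset (Sym2 (V ⊕ V)), IsIndepEdgeSet (closedDoubleCover G) M ∧
      (∀ v : V, v ∈ S ↔ Sum.inl v ∈ edgeEndpoints M) ∧ M.card = S.card := by
  classical
  choose f hf hf' using hS
  have hinj : ∀ v hv w hw, Dominates G w (f v hv) → w = v := fun v hv w (hw : w ∈ S) h => by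
    by_contra hne
    exact hf' v hv w hw hne h
  let W : Finset (V ⊕ V) := S.image Sum.inl ∪ S.attach.image fun v => Sum.inr (f v.1 v.2)
  have hl : ∀ v, Sum.inl v ∈ W ↔ v ∈ S := fun v => by simp [W]
  have hr : ∀ u, Sum.inr u ∈ W ↔ ∃ v, ∃ hv : v ∈ S, f v hv = u := fun u => by simp [W]
  have hW : InducesMatching (closedDoubleCover G) W := by
    intro w hw
    rcases w with v | u
    · have hv := (hl v).1 hw
      refine ⟨Sum.inr (f v hv), ⟨(hr _).2 ⟨v, hv, rfl⟩,
        closedDoubleCover_adj_inl.2 ⟨_, rfl, hf v hv⟩⟩, ?_⟩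
      rintro z ⟨hz, hvz⟩
      obtain ⟨u, rfl, hu⟩ := closedDoubleCover_adj_inl.1 hvz
      obtain ⟨w, hw, rfl⟩ := (hr u).1 hz
      obtain rfl := hinj w hw v hv hu
      rfl
    · obtain ⟨v, hv, rfl⟩ := (hr u).1 hw
      refine ⟨Sum.inl v, ⟨(hl v).2 hv, closedDoubleCover_adj_inr.2 ⟨_, rfl, hf v hv⟩⟩, ?_⟩
      rintro z ⟨hz, hvz⟩
      obtain ⟨w, rfl, hw⟩ := closedDoubleCover_adj_inr.1 hvz
      rw [hinj v hv w ((hl w).1 hz) hw]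
  obtain ⟨M, h1, h2, -, -⟩ := hW.exists_isIndepEdgeSet
  have hM : ∀ v : V, v ∈ S ↔ Sum.inl v ∈ edgeEndpoints M := fun v => by rw [← h2, hl]
  exact ⟨M, h1, hM, (isIrredundant_of_isIndepEdgeSet h1 hM).2.symm⟩

/-- An irredundant set of largest cardinality among all irredundant sets is also inclusion-maximal,
so restricting to maximal sets in the definition of the upper irredundance number does not change
the value. -/
theorem maximal_isIrredundant_of_isLargestIndepEdgeSet {M : Finset (Sym2 (V ⊕ V))}
    (hM : IsLargestIndepEdgeSet (closedDoubleCover G) M) {S : Finset V}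
    (hS : ∀ v, v ∈ S ↔ Sum.inl v ∈ edgeEndpoints M) :
    Maximal (IsIrredundant G) S ∧ S.card = upperIrredundance G := by
  obtain ⟨h1, h2⟩ := isIrredundant_of_isIndepEdgeSet hM.1 hS
  have hle : ∀ S', IsIrredundant G S' → S'.card ≤ S.card := fun S' hS' => by
    obtain ⟨M', h3, -, h4⟩ := exists_isIndepEdgeSet_of_isIrredundant hS'
    rw [← h4, h2]
    exact hM.2 M' h3
  have hmax : Maximal (IsIrredundant G) S :=
    ⟨h1, fun S' hS' hle' => (Finset.eq_of_subset_of_card_le hle' (hle S' hS')).ge⟩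
  have hg : IsGreatest {k : ℕ | ∃ S : Finset V, Maximal (IsIrredundant G) S ∧ S.card = k} S.card :=
    ⟨⟨S, hmax, rfl⟩, by rintro k ⟨S', hS', rfl⟩; exact hle S' hS'.1⟩
  exact ⟨hmax, hg.csSup_eq.symm⟩

theorem card_eq_upperIrredundance [Finite V] {M : Finset (Sym2 (V ⊕ V))}
    (hM : IsLargestIndepEdgeSet (closedDoubleCover G) M) : M.card = upperIrredundance G := by
  classical
  have := Fintype.ofFinite V
  have hS : ∀ v, v ∈ (Finset.univ.filter fun v : V => Sum.inl v ∈ edgeEndpoints M) ↔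
      Sum.inl v ∈ edgeEndpoints M := fun v => by simp
  rw [← (isIrredundant_of_isIndepEdgeSet hM.1 hS).2]
  exact (maximal_isIrredundant_of_isLargestIndepEdgeSet hM hS).2

end DoubleCover

/-! ## Search nodes -/

section Frames

/-- A search node assigns `2` to the selected vertices, `1` to the undecided ones and `0` to the
discarded ones; these are the undecided vertices below `m`. -/
def undecided (m : ℕ) (f : ℕ → ℕ) : Finset ℕ :=
  (Finset.range m).filter fun i => f i = 1

/-- The selected vertices below `m`. -/
def selected (m : ℕ) (f : ℕ → ℕ) : Finset ℕ :=
  (Finset.range m).filter fun i => f i = 2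

theorem mem_undecided {m : ℕ} {f : ℕ → ℕ} {i : ℕ} : i ∈ undecided m f ↔ i < m ∧ f i = 1 := by
  simp [undecided]

theorem mem_selected {m : ℕ} {f : ℕ → ℕ} {i : ℕ} : i ∈ selected m f ↔ i < m ∧ f i = 2 := by
  simp [selected]

theorem card_undecided_le (m : ℕ) (f : ℕ → ℕ) : (undecided m f).card ≤ m :=
  (Finset.card_filter_le _ _).trans (by simp)

theorem card_selected_le (m : ℕ) (f : ℕ → ℕ) : (selected m f).card ≤ m :=
  (Finset.card_filter_le _ _).trans (by simp)

/-- The selected vertices induce a matching and have no undecided neighbours. -/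
structure IsNode (G : SimpleGraph ℕ) (m : ℕ) (f : ℕ → ℕ) : Prop where
  le_two : ∀ i, f i ≤ 2
  eq_zero : ∀ i, m ≤ i → f i = 0
  matching : InducesMatching G (selected m f)
  not_adj : ∀ i ∈ selected m f, ∀ j ∈ undecided m f, ¬ G.Adj i j

/-- The node can be completed to an induced matching with at least `k` vertices. -/
def Attains (G : SimpleGraph ℕ) (m : ℕ) (f : ℕ → ℕ) (k : ℕ) : Prop :=
  ∃ W ⊆ undecided m f, InducesMatching G W ∧ k ≤ W.card + (selected m f).card

open Classical in
/-- The node after a branch. -/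
noncomputable def childNode (G : SimpleGraph ℕ) (md u : ℕ) (f : ℕ → ℕ) (t : ℕ × ℕ × ℕ × ℕ) (i : ℕ) :
    ℕ :=
  if Selects t.1 t.2.1 t.2.2.1 t.2.2.2 i then 2
  else if f i = 1 then (if Discards G md u t.1 t.2.1 t.2.2.1 t.2.2.2 i then 0 else 1)
  else f i

/-- The branch `t` is possible at the pivot. -/
def BranchAt (G : SimpleGraph ℕ) (m : ℕ) (f : ℕ → ℕ) (md u v : ℕ) (t : ℕ × ℕ × ℕ × ℕ) : Prop :=
  IsBranch G (undecided m f) md u v t.1 t.2.1 t.2.2.1 t.2.2.2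

variable {G : SimpleGraph ℕ} {m md u v : ℕ} {f : ℕ → ℕ} {t : ℕ × ℕ × ℕ × ℕ}

theorem undecided_childNode : undecided m (childNode G md u f t) =
    branchRest G (undecided m f) md u t.1 t.2.1 t.2.2.1 t.2.2.2 := by
  ext i
  rw [mem_undecided, mem_branchRest, mem_undecided]
  unfold childNode
  split_ifs with h1 h2 h3
  · simp [h1]
  · simp [h3]
  · simp [h1, h2, h3]
  · simp [h2]

theorem BranchAt.selects_mem (h : BranchAt G m f md u v t) {i : ℕ}
    (hi : Selects t.1 t.2.1 t.2.2.1 t.2.2.2 i) : i ∈ undecided m f := by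
  obtain ⟨hne, hi⟩ := hi
  rcases h with h | h | h
  · rcases hi with rfl | rfl | rfl | rfl
    exacts [h.2.2.1, h.2.2.2.1, h.1 ▸ h.2.2.1, h.2.1 ▸ h.2.2.2.1]
  · exact absurd (h.2.1.trans h.2.2.1.symm) hne
  · rcases hi with rfl | rfl | rfl | rfl
    exacts [h.2.2.1.1, h.2.2.1.2.1, h.2.2.1.2.2.1, h.2.2.1.2.2.2]

theorem BranchAt.selected_childNode (h : BranchAt G m f md u v t) :
    selected m (childNode G md u f t) = selected m f ∪
      (if t.1 = t.2.1 then ∅ else {t.1, t.2.1, t.2.2.1, t.2.2.2}) := by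
  have hmem : ∀ i, i ∈ (if t.1 = t.2.1 then ∅ else {t.1, t.2.1, t.2.2.1, t.2.2.2} : Finset ℕ) ↔
      Selects t.1 t.2.1 t.2.2.1 t.2.2.2 i := fun i => by
    unfold Selects; split_ifs with h1 <;> simp [h1]
  ext i
  rw [Finset.mem_union, hmem, mem_selected, mem_selected]
  unfold childNode
  split_ifs with h1 h2 h3
  · have := (mem_undecided.1 (h.selects_mem h1)).1
    simp [h1, this]
  · simp [h1, h2]
  · simp [h1, h2]
  · simp [h1]

theorem BranchAt.disjoint (h : BranchAt G m f md u v t) :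
    Disjoint (selected m f) (if t.1 = t.2.1 then ∅ else {t.1, t.2.1, t.2.2.1, t.2.2.2}) := by
  rw [Finset.disjoint_left]
  intro i hi hi'
  have : Selects t.1 t.2.1 t.2.2.1 t.2.2.2 i := by
    unfold Selects; split_ifs at hi' with h1 <;> simp at hi'; exact ⟨h1, hi'⟩
  have h1 := (mem_undecided.1 (h.selects_mem this)).2
  have h2 := (mem_selected.1 hi).2
  omega

/-- Newly selected vertices were undecided, hence not adjacent to selected ones, so old and new
matchings combine. The neighbours of newly selected vertices are decided in the same branch. -/
theorem BranchAt.isNode (h : BranchAt G m f md u v t) (hf : IsNode G m f) :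
    IsNode G m (childNode G md u f t) := by
  refine ⟨fun i => ?_, fun i hi => ?_, ?_, ?_⟩
  · unfold childNode
    have := hf.le_two i
    split_ifs <;> omega
  · unfold childNode
    have h0 := hf.eq_zero i hi
    rw [if_neg fun hs => ?_, if_neg (by omega), h0]
    have := (mem_undecided.1 (h.selects_mem hs)).1
    omega
  · rw [h.selected_childNode]
    refine hf.matching.union ?_ fun i hi j hj => hf.not_adj i hi j ?_
    · rcases h with h | h | h
      · rw [if_neg h.2.2.2.2.1.ne]
        have : ({t.1, t.2.1, t.2.2.1, t.2.2.2} : Finset ℕ) = {t.1, t.2.1} := by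
          rw [← h.1, ← h.2.1]; ext; simp
        rw [this]
        exact .pair h.2.2.2.2.1
      · rw [if_pos (h.2.1.trans h.2.2.1.symm)]
        exact .empty
      · obtain ⟨-, -, -, ⟨h1, h2⟩, ⟨h3, h4, h5, h6⟩, -⟩ := h
        rw [if_neg h1.ne]
        exact .two_pairs h1 h2 h3 h4 h5 h6
    · refine h.selects_mem ?_
      unfold Selects; split_ifs at hj with h1 <;> simp at hj; exact ⟨h1, hj⟩
  · rw [h.selected_childNode, undecided_childNode]
    intro i hi j hj hij
    rw [mem_branchRest] at hj
    rcases Finset.mem_union.1 hi with hi | hi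
    · exact hf.not_adj i hi j hj.1 hij
    · split_ifs at hi with h1
      · exact absurd hi (Finset.notMem_empty _)
      · simp only [Finset.mem_insert, Finset.mem_singleton] at hi
        refine hj.2.2 (Or.inl ⟨h1, ?_⟩)
        rcases hi with rfl | rfl | rfl | rfl <;> tauto

theorem BranchAt.card_lt (h : BranchAt G m f md u v t) (hu : u ∈ undecided m f) :
    (undecided m (childNode G md u f t)).card < (undecided m f).card := by
  rw [undecided_childNode]
  refine Finset.card_lt_card ((Finset.ssubset_iff_of_subset (branchRest_subset ..)).2 ?_)
  rcases h with h | h | h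
  · refine ⟨t.1, h.2.2.1, fun hc => ?_⟩
    rw [mem_branchRest] at hc
    exact hc.2.1 ⟨h.2.2.2.2.1.ne, Or.inl rfl⟩
  · refine ⟨u, hu, fun hc => ?_⟩
    rw [mem_branchRest] at hc
    exact hc.2.2 (Or.inr (Or.inl ⟨h.2.1.trans h.2.2.1.symm, Or.inl rfl⟩))
  · refine ⟨t.1, h.2.2.1.1, fun hc => ?_⟩
    rw [mem_branchRest] at hc
    exact hc.2.1 ⟨h.2.2.2.1.1.ne, Or.inl rfl⟩

/-- The given completion need not be a maximum one within the undecided vertices, as the exchange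
argument requires. It is first replaced by a largest one, which still reaches `k`. -/
theorem exists_child_attains {c : ℕ → Bool} (hc : ∀ i j, G.Adj i j → c i ≠ c j) {k : ℕ}
    (hk : Attains G m f k) (hp : IsPivot G (undecided m f) u v)
    (hmd : md = branchMode (nbrsIn G (undecided m f) u).card (nbrsIn G (undecided m f) v).card) :
    ∃ t, BranchAt G m f md u (if md = 2 then v else u) t ∧ Attains G m (childNode G md u f t) k := by
  classical
  obtain ⟨W₀, h1, h2, h3⟩ := hk
  obtain ⟨W, hW, hmax⟩ := Finset.exists_max_image
    ((undecided m f).powerset.filter fun W => InducesMatching G W) Finset.card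
    ⟨W₀, Finset.mem_filter.2 ⟨Finset.mem_powerset.2 h1, h2⟩⟩
  rw [Finset.mem_filter, Finset.mem_powerset] at hW
  have hle := hmax W₀ (Finset.mem_filter.2 ⟨Finset.mem_powerset.2 h1, h2⟩)
  have hmode : md = 0 ∨ (md = 1 ∧ (if md = 2 then v else u) = u) ∨
      (md = 2 ∧ (if md = 2 then v else u) ∈ undecided m f ∧ G.Adj u (if md = 2 then v else u)) := by
    unfold branchMode at hmd
    split_ifs at hmd with g1 g2 g3
    · exact Or.inr (Or.inl ⟨hmd, if_neg (by omega)⟩)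
    · have := hp.nbr.resolve_left fun h => g1 h.1
      rw [if_pos hmd]
      exact Or.inr (Or.inr ⟨hmd, this.1, this.2.1⟩)
    · exact Or.inr (Or.inl ⟨hmd, if_neg (by omega)⟩)
    · exact Or.inl hmd
  obtain ⟨a, x, b, y, hb, W', hW', h4, h5⟩ := branchKeeps_of_maximum hc hW.1 hW.2
    (fun W' h h' => hmax W' (Finset.mem_filter.2 ⟨Finset.mem_powerset.2 h, h'⟩)) hp.mem hmode
  refine ⟨(a, x, b, y), hb, W', ?_, h4, ?_⟩
  · rw [undecided_childNode]; exact hW'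
  · have hb' : BranchAt G m f md u (if md = 2 then v else u) (a, x, b, y) := hb
    rw [hb'.selected_childNode, Finset.card_union_of_disjoint hb'.disjoint]
    simp only
    omega

theorem exists_isPivot {X : Finset ℕ} (hX : X.Nonempty) : ∃ u ∈ X, ∃ v ∈ X, IsPivot G X u v := by
  obtain ⟨u, hu, hmin⟩ := Finset.exists_min_image X (fun w => (nbrsIn G X w).card) hX
  by_cases h0 : (nbrsIn G X u).card = 0
  · exact ⟨u, hu, u, hu, hu, hmin, Or.inl ⟨h0, rfl⟩⟩
  · obtain ⟨v, hv, hv'⟩ := Finset.exists_min_image (nbrsIn G X u) (fun w => (nbrsIn G X w).card)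
      (Finset.card_pos.1 (Nat.pos_of_ne_zero h0))
    rw [mem_nbrsIn] at hv
    exact ⟨u, hu, v, hv.1, hu, hmin, Or.inr ⟨hv.1, hv.2, fun w hw hw' =>
      hv' w (mem_nbrsIn.2 ⟨hw, hw'⟩)⟩⟩

/-- The potential of a node bounds the size of the search tree below it. -/
noncomputable def potential (m : ℕ) (β : ℝ) (f : ℕ → ℕ) : ℝ :=
  ((undecided m f).card + 1) * β ^ (undecided m f).card

theorem one_le_potential {β : ℝ} (hβ : 1 ≤ β) (m : ℕ) (f : ℕ → ℕ) : 1 ≤ potential m β f := by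
  unfold potential
  have h1 : 1 ≤ β ^ (undecided m f).card := one_le_pow₀ hβ
  have h2 : (0 : ℝ) ≤ (undecided m f).card := Nat.cast_nonneg _
  nlinarith

/-- Every child has fewer undecided vertices, so its polynomial factor is at most `(undecided m
f).card`. The children together get at most that number times `β ^ (undecided m f).card`. What
remains of the parent's potential is one further power of `β`, at least `1`, which pays for the
current round. -/
theorem sum_potential_le {β : ℝ} (hβ : 701009 / 500000 ≤ β) {c : ℕ → Bool}
    (hc : ∀ i j, G.Adj i j → c i ≠ c j) (hp : IsPivot G (undecided m f) u v)
    (hmd : md = branchMode (nbrsIn G (undecided m f) u).card (nbrsIn G (undecided m f) v).card)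
    {T : Finset (ℕ × ℕ × ℕ × ℕ)}
    (hT : ∀ t ∈ T, BranchAt G m f md u (if md = 2 then v else u) t) :
    ∑ t ∈ T, potential m β (childNode G md u f t) + 1 ≤ potential m β f := by
  obtain ⟨hβ1, -, -⟩ := inv_le_of_base_le hβ
  have h1 := sum_branchWeight_le hβ hc hp hmd hT
  have h2 : ∀ t ∈ T, potential m β (childNode G md u f t) ≤
      (undecided m f).card * branchWeight G (undecided m f) md u β t := by
    intro t ht
    have h3 : ((undecided m (childNode G md u f t)).card + 1 : ℝ) ≤ (undecided m f).card := by
      exact_mod_cast (hT t ht).card_lt hp.mem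
    unfold potential branchWeight
    rw [← undecided_childNode]
    exact mul_le_mul_of_nonneg_right h3 (by positivity)
  have h4 := Finset.sum_le_sum h2
  rw [← Finset.mul_sum] at h4
  have h5 := mul_le_mul_of_nonneg_left h1 (Nat.cast_nonneg (α := ℝ) (undecided m f).card)
  have h6 : 1 ≤ β ^ (undecided m f).card := one_le_pow₀ hβ1
  unfold potential at h4 ⊢
  linarith

end Frames

/-! ## Reasoning about commands -/

namespace Store

variable (σ : Store) (x y : Fin 16) (k l : Fin 4) (i v : ℕ)

@[simp] theorem var_setVar : (σ.setVar x v).var y = if y = x then v else σ.var y :=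
  Function.update_apply ..

@[simp] theorem arr_setVar : (σ.setVar x v).arr = σ.arr := rfl

@[simp] theorem io_setVar : (σ.setVar x v).io = σ.io := rfl

theorem arr_setArr_self : (σ.setArr k i v).arr k = Function.update (σ.arr k) i v :=
  Function.update_self ..

theorem arr_setArr_of_ne (h : l ≠ k) : (σ.setArr k i v).arr l = σ.arr l :=
  Function.update_of_ne h ..

@[simp] theorem io_setIo : (σ.setIo i v).io = Function.update σ.io i v := rfl

/-- The loop invariant is indexed by the number of values still to be run, because loops count
downwards. -/
theorem iterDown_induction {f : Store → Store} {x : Fin 16} {P : ℕ → Store → Prop} {m : ℕ}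
    {σ : Store} (h : P m σ) (hs : ∀ k < m, ∀ τ, P (k + 1) τ → P k (f (τ.setVar x k))) :
    P 0 (iterDown f x m σ) := by
  induction m generalizing σ with
  | zero => exact h
  | succ m ih => exact ih (hs m m.lt_succ_self σ h) fun k hk => hs k (hk.trans m.lt_succ_self)

/-- If the round of a loop for `i` extends a list by `e i`, then the loop extends it by all of these.
-/
theorem iterDown_append {α : Type*} {f : Store → Store} {x : Fin 16} {J : Store → List α → Prop}
    {m : ℕ} {e : ℕ → List α} {σ : Store} {l : List α} (h : J σ l)
    (hs : ∀ i < m, ∀ τ l, J τ l → J (f (τ.setVar x i)) (l ++ e i)) :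
    J (iterDown f x m σ) (l ++ (List.range m).reverse.flatMap e) := by
  induction m generalizing σ l with
  | zero => simpa [iterDown] using h
  | succ m ih =>
    rw [List.range_succ, List.reverse_append, List.reverse_singleton, List.singleton_append,
      List.flatMap_cons, ← List.append_assoc]
    exact ih (hs m m.lt_succ_self σ l h) fun k hk => hs k (hk.trans m.lt_succ_self)

end Store

namespace Cmd

/-- Whether the command may change the variable `y`. -/
def writesVar (y : Fin 16) : Cmd → Bool
  | skip => false
  | assign x _ => decide (x = y)
  | store _ _ _ => false
  | storeIo _ _ => false
  | seq P Q => P.writesVar y || Q.writesVar y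
  | ite _ P Q => P.writesVar y || Q.writesVar y
  | loop x P => decide (x = y) || P.writesVar y

/-- Whether the command may change the array `l`. -/
def writesArr (l : Fin 4) : Cmd → Bool
  | skip => false
  | assign _ _ => false
  | store k _ _ => decide (k = l)
  | storeIo _ _ => false
  | seq P Q => P.writesArr l || Q.writesArr l
  | ite _ P Q => P.writesArr l || Q.writesArr l
  | loop _ P => P.writesArr l

/-- Whether the command may change the array that holds the input and the output. -/
def writesIo : Cmd → Bool
  | skip => false
  | assign _ _ => false
  | store _ _ _ => false
  | storeIo _ _ => true
  | seq P Q => P.writesIo || Q.writesIo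
  | ite _ P Q => P.writesIo || Q.writesIo
  | loop _ P => P.writesIo

variable {m N : ℕ} {P : Cmd}

/-- A syntactic frame rule. For concrete commands the hypothesis is computed, so invariance is
usually proved by `rfl`; the same holds for `arr_run` and `io_run`. -/
theorem var_run {y : Fin 16} (h : P.writesVar y = false) (σ : Store) :
    (P.run m N σ).var y = σ.var y := by
  induction P generalizing σ with
  | skip => rfl
  | assign x e =>
    exact (Store.var_setVar ..).trans (if_neg (Ne.symm (of_decide_eq_false h)))
  | store => rfl
  | storeIo => simp only [run]; split_ifs <;> rfl
  | seq P Q ih₁ ih₂ =>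
    rw [writesVar, Bool.or_eq_false_iff] at h
    exact (ih₂ h.2 _).trans (ih₁ h.1 _)
  | ite c P Q ih₁ ih₂ =>
    rw [writesVar, Bool.or_eq_false_iff] at h
    simp only [run]
    split_ifs
    exacts [ih₁ h.1 _, ih₂ h.2 _]
  | loop x P ih =>
    rw [writesVar, Bool.or_eq_false_iff] at h
    refine Store.iterDown_induction (P := fun _ τ => τ.var y = σ.var y) rfl fun k _ τ hτ => ?_
    rw [ih h.2, Store.var_setVar, if_neg (Ne.symm (of_decide_eq_false h.1)), hτ]

theorem arr_run {l : Fin 4} (h : P.writesArr l = false) (σ : Store) :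
    (P.run m N σ).arr l = σ.arr l := by
  induction P generalizing σ with
  | skip => rfl
  | assign x e => rfl
  | store k i e => exact Store.arr_setArr_of_ne _ _ _ _ _ (Ne.symm (of_decide_eq_false h))
  | storeIo => simp only [run]; split_ifs <;> rfl
  | seq P Q ih₁ ih₂ =>
    rw [writesArr, Bool.or_eq_false_iff] at h
    exact (ih₂ h.2 _).trans (ih₁ h.1 _)
  | ite c P Q ih₁ ih₂ =>
    rw [writesArr, Bool.or_eq_false_iff] at h
    simp only [run]
    split_ifs
    exacts [ih₁ h.1 _, ih₂ h.2 _]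
  | loop x P ih =>
    exact Store.iterDown_induction (P := fun _ τ => τ.arr l = σ.arr l) rfl
      fun k _ τ hτ => (ih h _).trans hτ

theorem io_run (h : P.writesIo = false) (σ : Store) : (P.run m N σ).io = σ.io := by
  induction P generalizing σ with
  | skip => rfl
  | assign x e => rfl
  | store k i e => rfl
  | storeIo => simp [writesIo] at h
  | seq P Q ih₁ ih₂ =>
    rw [writesIo, Bool.or_eq_false_iff] at h
    exact (ih₂ h.2 _).trans (ih₁ h.1 _)
  | ite c P Q ih₁ ih₂ =>
    rw [writesIo, Bool.or_eq_false_iff] at h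
    simp only [run]
    split_ifs
    exacts [ih₁ h.1 _, ih₂ h.2 _]
  | loop x P ih =>
    exact Store.iterDown_induction (P := fun _ τ => τ.io = σ.io) rfl
      fun k _ τ hτ => (ih h _).trans hτ

/-- A loop that fills a block of the array `k`. -/
theorem run_fill {k : Fin 4} {x : Fin 16} {idx e : Expr} {off : ℕ} {v : ℕ → ℕ} {σ : Store}
    (h : ∀ τ : Store, (∀ y, y ≠ x → τ.var y = σ.var y) → (∀ l, l ≠ k → τ.arr l = σ.arr l) →
      τ.io = σ.io → τ.var x < m → idx.eval m τ = off + τ.var x ∧ e.eval m τ = v (τ.var x))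
    (q : ℕ) : ((loop x (store k idx e)).run m N σ).arr k q =
      if off ≤ q ∧ q < off + m then v (q - off) else σ.arr k q := by
  have := Store.iterDown_induction (f := (store k idx e).run m N) (x := x) (m := m) (σ := σ)
    (P := fun i τ => (∀ y, y ≠ x → τ.var y = σ.var y) ∧ (∀ l, l ≠ k → τ.arr l = σ.arr l) ∧
      τ.io = σ.io ∧ ∀ q, τ.arr k q =
        if off + i ≤ q ∧ q < off + m then v (q - off) else σ.arr k q)
    ⟨fun _ _ => rfl, fun _ _ => rfl, rfl, fun q => by rw [if_neg (by omega)]⟩ ?_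
  · exact this.2.2.2 q
  · rintro i hi τ ⟨h1, h2, h3, h4⟩
    have h1' : ∀ y, y ≠ x → (τ.setVar x i).var y = σ.var y := fun y hy => by
      rw [Store.var_setVar, if_neg hy, h1 y hy]
    obtain ⟨h5, h6⟩ := h (τ.setVar x i) h1' h2 h3 (by simpa using hi)
    rw [Store.var_setVar, if_pos rfl] at h5 h6
    refine ⟨h1', fun l hl => ?_, h3, fun q => ?_⟩
    · exact (Store.arr_setArr_of_ne _ _ _ _ _ hl).trans (h2 l hl)
    · simp only [run, Store.arr_setArr_self, Function.update_apply, h5, h6]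
      split_ifs with h7 h8 h8
      · congr 1; omega
      · omega
      · rw [Store.arr_setVar, h4, if_pos (by omega)]
      · rw [Store.arr_setVar, h4, if_neg (by omega)]

end Cmd

/-! ### Conditions -/

namespace Expr

/-- The expression, read as a condition, is true. -/
def Holds (m : ℕ) (e : Expr) (σ : Store) : Prop := e.eval m σ ≠ 0

def not (e : Expr) : Expr := ite e (const 0) (const 1)

def and (e₁ e₂ : Expr) : Expr := ite e₁ e₂ (const 0)

def or (e₁ e₂ : Expr) : Expr := ite e₁ (const 1) e₂

def eq (e₁ e₂ : Expr) : Expr := ite (sub e₁ e₂) (const 0) (ite (sub e₂ e₁) (const 0) (const 1))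

def lt (e₁ e₂ : Expr) : Expr := sub e₂ e₁

def all (x : Fin 16) (e : Expr) : Expr := not (sum x (not e))

variable {m : ℕ} {e e₁ e₂ c : Expr} {x : Fin 16} {σ : Store}

open Classical in
theorem eval_ite : (ite c e₁ e₂).eval m σ = if c.Holds m σ then e₁.eval m σ else e₂.eval m σ := by
  unfold Holds; simp only [eval]; congr

theorem eval_not : (not e).eval m σ = if e.eval m σ = 0 then 1 else 0 := by
  simp only [not, eval]; split_ifs <;> simp_all

@[simp] theorem holds_not : (not e).Holds m σ ↔ ¬ e.Holds m σ := by
  unfold Holds; rw [eval_not]; split_ifs <;> simp_all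

@[simp] theorem holds_and : (and e₁ e₂).Holds m σ ↔ e₁.Holds m σ ∧ e₂.Holds m σ := by
  unfold Holds; simp only [and, eval]; split_ifs <;> simp_all

@[simp] theorem holds_or : (or e₁ e₂).Holds m σ ↔ e₁.Holds m σ ∨ e₂.Holds m σ := by
  unfold Holds; simp only [or, eval]; split_ifs <;> simp_all

@[simp] theorem holds_eq : (eq e₁ e₂).Holds m σ ↔ e₁.eval m σ = e₂.eval m σ := by
  unfold Holds; simp only [eq, eval]
  by_cases h₁ : e₁.eval m σ - e₂.eval m σ = 0 <;> by_cases h₂ : e₂.eval m σ - e₁.eval m σ = 0 <;>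
    simp [h₁, h₂] <;> omega

@[simp] theorem holds_lt : (lt e₁ e₂).Holds m σ ↔ e₁.eval m σ < e₂.eval m σ := by
  unfold Holds; simp only [lt, eval]; omega

@[simp] theorem holds_all : (all x e).Holds m σ ↔ ∀ i < m, e.Holds m (σ.setVar x i) := by
  rw [all, holds_not]
  unfold Holds
  simp only [eval, ne_eq, not_not, Finset.sum_eq_zero_iff, Finset.mem_range, eval_not]
  refine forall_congr' fun i => forall_congr' fun _ => ?_
  split_ifs <;> simp_all

end Expr

/-! ## The conditions of the search program

The variables `0`, `1`, `2` hold the two pivots and the mode, the variables `3`, `4`, `5`, `6` a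
branch, the variable `10` the number of nodes on the stack and the variable `11` the number of
vertices selected by the best node. Array `0` is the adjacency matrix, array `1` the stack, array `2`
the current node and array `3` the best node. -/

namespace Search

open Expr

/-- The arrays of the store hold the adjacency matrix of `G` and the current node `f`. -/
structure Reads (G : SimpleGraph ℕ) (m : ℕ) (f : ℕ → ℕ) (σ : Store) : Prop where
  adj : ∀ i < m, ∀ j < m, (σ.arr 0 (i * m + j) ≠ 0 ↔ G.Adj i j)
  node : ∀ i < m, σ.arr 2 i = f i

def adjExpr (e₁ e₂ : Expr) : Expr := arr 0 (add (scale e₁) e₂)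

def aliveExpr (e : Expr) : Expr := eq (arr 2 e) (const 1)

def degExpr (x : Fin 16) : Expr :=
  sum 8 (ite (and (aliveExpr (var 8)) (adjExpr (var x) (var 8))) (const 1) (const 0))

/-- The variables `13` and `14` hold a pivot. -/
def pivotExpr : Expr :=
  and (and (aliveExpr (var 13)) (aliveExpr (var 14)))
    (and (all 9 (or (not (aliveExpr (var 9))) (not (lt (degExpr 9) (degExpr 13)))))
      (or (and (eq (degExpr 13) (const 0)) (eq (var 14) (var 13)))
        (and (adjExpr (var 13) (var 14)) (all 9 (or (not (aliveExpr (var 9)))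
          (or (not (adjExpr (var 13) (var 9))) (not (lt (degExpr 9) (degExpr 14)))))))))

def modeExpr : Expr :=
  ite (degExpr 0)
    (ite (and (eq (degExpr 1) (degExpr 0)) (lt (degExpr 0) (const 4))) (const 2)
      (ite (lt (degExpr 0) (const 3)) (const 1) (const 0)))
    (const 1)

def branchExpr : Expr :=
  or (and (eq (var 3) (var 5)) (and (eq (var 4) (var 6)) (and (aliveExpr (var 3))
      (and (aliveExpr (var 4)) (and (adjExpr (var 3) (var 4)) (or (eq (var 3) (var 0))
        (and (eq (var 2) (const 2)) (and (eq (var 3) (var 1)) (not (eq (var 4) (var 0))))))))))) <|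
  or (and (not (eq (var 2) (const 2))) (and (eq (var 3) (var 0)) (and (eq (var 4) (var 0))
      (and (eq (var 5) (var 0)) (eq (var 6) (var 0)))))) <|
  and (not (eq (var 2) (const 0))) <| and (lt (var 3) (var 5)) <|
  and (and (aliveExpr (var 3)) (and (aliveExpr (var 4))
    (and (aliveExpr (var 5)) (aliveExpr (var 6))))) <|
  and (and (adjExpr (var 3) (var 4)) (adjExpr (var 5) (var 6))) <|
  and (and (not (adjExpr (var 3) (var 5))) (and (not (adjExpr (var 3) (var 6)))
    (and (not (adjExpr (var 5) (var 4))) (not (adjExpr (var 4) (var 6)))))) <|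
  or (and (adjExpr (var 0) (var 3)) (and (adjExpr (var 0) (var 5))
      (and (not (eq (var 3) (var 1))) (not (eq (var 5) (var 1)))))) <|
  and (eq (var 2) (const 2)) <| and (adjExpr (var 1) (var 3)) <| and (adjExpr (var 1) (var 5)) <|
  and (not (eq (var 3) (var 0))) <| and (not (eq (var 5) (var 0))) <|
  and (not (adjExpr (var 0) (var 3))) <| and (not (adjExpr (var 0) (var 5))) <|
  and (not (adjExpr (var 0) (var 4))) (not (adjExpr (var 0) (var 6)))

def selectsExpr : Expr :=
  and (not (eq (var 3) (var 4))) <| or (eq (var 7) (var 3)) <| or (eq (var 7) (var 4)) <|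
    or (eq (var 7) (var 5)) (eq (var 7) (var 6))

def discardsExpr : Expr :=
  or (and (not (eq (var 3) (var 4))) (or (adjExpr (var 3) (var 7)) (or (adjExpr (var 4) (var 7))
    (or (adjExpr (var 5) (var 7)) (adjExpr (var 6) (var 7)))))) <|
  or (and (eq (var 3) (var 4)) (or (eq (var 7) (var 0))
    (and (eq (var 2) (const 1)) (adjExpr (var 0) (var 7))))) <|
  and (not (eq (var 3) (var 5))) (and (not (adjExpr (var 0) (var 3)))
    (or (eq (var 7) (var 0)) (adjExpr (var 0) (var 7))))

/-- The value of the child at the vertex in the variable `7`. -/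
def childExpr : Expr :=
  ite selectsExpr (const 2)
    (ite (aliveExpr (var 7)) (ite discardsExpr (const 0) (const 1)) (arr 2 (var 7)))

variable {G : SimpleGraph ℕ} {m : ℕ} {f : ℕ → ℕ} {σ : Store} {e e₁ e₂ : Expr}

theorem Reads.setVar (h : Reads G m f σ) (x : Fin 16) (v : ℕ) : Reads G m f (σ.setVar x v) :=
  ⟨h.adj, h.node⟩

theorem Reads.congr {σ' : Store} (h : Reads G m f σ) (h0 : σ'.arr 0 = σ.arr 0)
    (h2 : σ'.arr 2 = σ.arr 2) : Reads G m f σ' :=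
  ⟨fun i hi j hj => by rw [h0]; exact h.adj i hi j hj, fun i hi => by rw [h2]; exact h.node i hi⟩

theorem Reads.holds_adj (h : Reads G m f σ) (h₁ : e₁.eval m σ < m) (h₂ : e₂.eval m σ < m) :
    (adjExpr e₁ e₂).Holds m σ ↔ G.Adj (e₁.eval m σ) (e₂.eval m σ) :=
  h.adj _ h₁ _ h₂

theorem Reads.holds_alive (h : Reads G m f σ) (h₁ : e.eval m σ < m) :
    (aliveExpr e).Holds m σ ↔ e.eval m σ ∈ undecided m f := by
  rw [aliveExpr, holds_eq, mem_undecided, and_iff_right h₁]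
  simp only [eval]
  rw [h.node _ h₁]

/-- Variable `8` is bound by the sum inside `degExpr`, so it cannot hold the vertex whose degree is
computed. -/
theorem Reads.eval_deg (h : Reads G m f σ) {x : Fin 16} (hx : x ≠ 8) (hlt : σ.var x < m) :
    (degExpr x).eval m σ = (nbrsIn G (undecided m f) (σ.var x)).card := by
  classical
  have : ∀ i ∈ Finset.range m,
      (ite (and (aliveExpr (var 8)) (adjExpr (var x) (var 8))) (const 1) (const 0)).eval m
        (σ.setVar 8 i) = if i ∈ undecided m f ∧ G.Adj (σ.var x) i then 1 else 0 := by
    intro i hi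
    rw [Finset.mem_range] at hi
    rw [eval_ite, holds_and, (h.setVar 8 i).holds_alive (by simpa [eval] using hi),
      (h.setVar 8 i).holds_adj (by simpa [eval, hx] using hlt) (by simpa [eval] using hi)]
    simp [eval, hx]
  rw [degExpr, eval, Finset.sum_congr rfl this, Finset.sum_boole, Nat.cast_id]
  congr 1
  ext i
  rw [Finset.mem_filter, mem_nbrsIn, Finset.mem_range, and_iff_right_iff_imp]
  exact fun hi => (mem_undecided.1 hi.1).1

theorem Reads.holds_pivot (h : Reads G m f σ) (hu : σ.var 13 < m) (hv : σ.var 14 < m) :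
    pivotExpr.Holds m σ ↔ IsPivot G (undecided m f) (σ.var 13) (σ.var 14) := by
  have h1 : (all 9 (or (not (aliveExpr (var 9))) (not (lt (degExpr 9) (degExpr 13))))).Holds m σ ↔
      ∀ w ∈ undecided m f, (nbrsIn G (undecided m f) (σ.var 13)).card ≤
        (nbrsIn G (undecided m f) w).card := by
    rw [holds_all]
    constructor
    · intro hw w hw'
      have hlt := (mem_undecided.1 hw').1
      have := hw w hlt
      rw [holds_or, holds_not, holds_not, holds_lt,
        (h.setVar 9 w).holds_alive (by simpa [eval] using hlt),
        (h.setVar 9 w).eval_deg (by decide) (by simpa using hlt),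
        (h.setVar 9 w).eval_deg (by decide) (by simpa using hu)] at this
      simpa [eval, hw'] using this
    · intro hw w hlt
      rw [holds_or, holds_not, holds_not, holds_lt,
        (h.setVar 9 w).holds_alive (by simpa [eval] using hlt),
        (h.setVar 9 w).eval_deg (by decide) (by simpa using hlt),
        (h.setVar 9 w).eval_deg (by decide) (by simpa using hu)]
      simpa [eval, or_iff_not_imp_left] using hw w
  have h2 : (all 9 (or (not (aliveExpr (var 9)))
      (or (not (adjExpr (var 13) (var 9))) (not (lt (degExpr 9) (degExpr 14)))))).Holds m σ ↔
      ∀ w ∈ undecided m f, G.Adj (σ.var 13) w → (nbrsIn G (undecided m f) (σ.var 14)).card ≤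
        (nbrsIn G (undecided m f) w).card := by
    have key : ∀ w < m, (or (not (aliveExpr (var 9)))
        (or (not (adjExpr (var 13) (var 9))) (not (lt (degExpr 9) (degExpr 14))))).Holds m
          (σ.setVar 9 w) ↔ (w ∈ undecided m f → G.Adj (σ.var 13) w →
            (nbrsIn G (undecided m f) (σ.var 14)).card ≤ (nbrsIn G (undecided m f) w).card) := by
      intro w hlt
      rw [holds_or, holds_or, holds_not, holds_not, holds_not, holds_lt,
        (h.setVar 9 w).holds_alive (by simpa [eval] using hlt),
        (h.setVar 9 w).holds_adj (by simpa [eval] using hu) (by simpa [eval] using hlt),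
        (h.setVar 9 w).eval_deg (by decide) (by simpa using hlt),
        (h.setVar 9 w).eval_deg (by decide) (by simpa using hv)]
      simp [eval, imp_iff_not_or]
    rw [holds_all]
    exact ⟨fun hw w hw' => (key w (mem_undecided.1 hw').1).1 (hw w (mem_undecided.1 hw').1) hw',
      fun hw w hlt => (key w hlt).2 (hw w)⟩
  rw [pivotExpr, holds_and, holds_and, holds_and, holds_or, holds_and, holds_and, holds_eq, holds_eq,
    h1, h2, h.holds_alive (e := var _) hu, h.holds_alive (e := var _) hv,
    h.holds_adj (e₁ := var _) (e₂ := var _) hu hv, h.eval_deg (by decide) hu]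
  simp only [eval]
  constructor
  · rintro ⟨⟨h3, h4⟩, h5, h6 | h6⟩
    exacts [⟨h3, h5, Or.inl h6⟩, ⟨h3, h5, Or.inr ⟨h4, h6⟩⟩]
  · rintro ⟨h3, h4, ⟨h5, h6⟩ | ⟨h5, h6⟩⟩
    exacts [⟨⟨h3, h6 ▸ h3⟩, h4, Or.inl ⟨h5, h6⟩⟩, ⟨⟨h3, h5⟩, h4, Or.inr h6⟩]

theorem Reads.eval_mode (h : Reads G m f σ) (hu : σ.var 0 < m) (hv : σ.var 1 < m) :
    modeExpr.eval m σ = branchMode (nbrsIn G (undecided m f) (σ.var 0)).card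
      (nbrsIn G (undecided m f) (σ.var 1)).card := by
  classical
  rw [modeExpr, eval_ite, eval_ite, eval_ite, holds_and, holds_eq, holds_lt, holds_lt, Holds,
    h.eval_deg (by decide) hu, h.eval_deg (by decide) hv]
  generalize (nbrsIn G (undecided m f) (σ.var 0)).card = d
  generalize (nbrsIn G (undecided m f) (σ.var 1)).card = d'
  have h4 : d < 4 ↔ d ≤ 3 := by omega
  have h3 : d < 3 ↔ d ≤ 2 := by omega
  simp only [eval, branchMode, h4, h3]
  split_ifs <;> first | rfl | contradiction

/-- The variables that describe the pivots, the mode and the branch. -/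
structure Holding (m u v md a x b y : ℕ) (σ : Store) : Prop where
  var_zero : σ.var 0 = u
  var_one : σ.var 1 = v
  var_two : σ.var 2 = md
  var_three : σ.var 3 = a
  var_four : σ.var 4 = x
  var_five : σ.var 5 = b
  var_six : σ.var 6 = y
  lt : u < m ∧ v < m ∧ a < m ∧ x < m ∧ b < m ∧ y < m

variable {u v md a x b y : ℕ}

/-- `branchExpr` mirrors `IsBranch` connective by connective. After the atoms are rewritten, the two
sides agree definitionally. -/
theorem Reads.holds_branch (h : Reads G m f σ) (hv : Holding m u v md a x b y σ) :
    branchExpr.Holds m σ ↔ IsBranch G (undecided m f) md u v a x b y := by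
  obtain ⟨h0, h1, h2, h3, h4, h5, h6, l0, l1, l3, l4, l5, l6⟩ := hv
  subst h0 h1 h2 h3 h4 h5 h6
  simp only [branchExpr, holds_or, holds_and, holds_not, holds_eq, holds_lt,
    h.holds_alive (e := var _) l3, h.holds_alive (e := var _) l4, h.holds_alive (e := var _) l5,
    h.holds_alive (e := var _) l6, h.holds_adj (e₁ := var _) (e₂ := var _) l3 l4,
    h.holds_adj (e₁ := var _) (e₂ := var _) l5 l6,
    h.holds_adj (e₁ := var _) (e₂ := var _) l3 l5, h.holds_adj (e₁ := var _) (e₂ := var _) l3 l6,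
    h.holds_adj (e₁ := var _) (e₂ := var _) l5 l4, h.holds_adj (e₁ := var _) (e₂ := var _) l4 l6,
    h.holds_adj (e₁ := var _) (e₂ := var _) l0 l3, h.holds_adj (e₁ := var _) (e₂ := var _) l0 l5,
    h.holds_adj (e₁ := var _) (e₂ := var _) l0 l4, h.holds_adj (e₁ := var _) (e₂ := var _) l0 l6,
    h.holds_adj (e₁ := var _) (e₂ := var _) l1 l3, h.holds_adj (e₁ := var _) (e₂ := var _) l1 l5]
  rfl

theorem Reads.eval_child (h : Reads G m f σ) (hv : Holding m u v md a x b y σ)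
    (hi : σ.var 7 < m) : childExpr.eval m σ = childNode G md u f (a, x, b, y) (σ.var 7) := by
  classical
  obtain ⟨h0, h1, h2, h3, h4, h5, h6, l0, l1, l3, l4, l5, l6⟩ := hv
  subst h0 h1 h2 h3 h4 h5 h6
  have hs : selectsExpr.Holds m σ ↔ Selects (σ.var 3) (σ.var 4) (σ.var 5) (σ.var 6) (σ.var 7) := by
    simp only [selectsExpr, holds_or, holds_and, holds_not, holds_eq]
    rfl
  have hd : discardsExpr.Holds m σ ↔ Discards G (σ.var 2) (σ.var 0) (σ.var 3) (σ.var 4) (σ.var 5)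
      (σ.var 6) (σ.var 7) := by
    simp only [discardsExpr, holds_or, holds_and, holds_not, holds_eq,
      h.holds_adj (e₁ := var _) (e₂ := var _) l3 hi, h.holds_adj (e₁ := var _) (e₂ := var _) l4 hi,
      h.holds_adj (e₁ := var _) (e₂ := var _) l5 hi, h.holds_adj (e₁ := var _) (e₂ := var _) l6 hi,
      h.holds_adj (e₁ := var _) (e₂ := var _) l0 hi, h.holds_adj (e₁ := var _) (e₂ := var _) l0 l3]
    rfl
  rw [childExpr, eval_ite, eval_ite, eval_ite, hs, hd, h.holds_alive (e := var _) hi]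
  simp only [eval, childNode, h.node _ hi, mem_undecided, hi, true_and]

end Search

/-! ## States of the search -/

section SearchState

open Classical in
/-- All possible branches at the pivot, in the order in which they are found. -/
noncomputable def branchList (G : SimpleGraph ℕ) (m : ℕ) (f : ℕ → ℕ) (md u v : ℕ) :
    List (ℕ × ℕ × ℕ × ℕ) :=
  (List.range m).reverse.flatMap fun a => (List.range m).reverse.flatMap fun x =>
    (List.range m).reverse.flatMap fun b => (List.range m).reverse.flatMap fun y =>
      if BranchAt G m f md u v (a, x, b, y) then [(a, x, b, y)] else []

variable {G : SimpleGraph ℕ} {m md u v k c : ℕ} {f best : ℕ → ℕ}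

/-- The list ranges over quadruples below `m`. This loses nothing, since every entry of a branch is
an undecided vertex or the pivot `u`. -/
theorem mem_branchList {t : ℕ × ℕ × ℕ × ℕ} (hu : u ∈ undecided m f) :
    t ∈ branchList G m f md u v ↔ BranchAt G m f md u v t := by
  obtain ⟨a, x, b, y⟩ := t
  simp only [branchList, List.mem_flatMap, List.mem_reverse, List.mem_range]
  constructor
  · rintro ⟨a', -, x', -, b', -, y', -, h⟩
    split_ifs at h with h'
    · rw [List.mem_singleton] at h
      rwa [h]
    · simp at h
  · intro h
    have hlt : ∀ {i}, i ∈ undecided m f → i < m := fun hi => (mem_undecided.1 hi).1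
    have h' : a < m ∧ x < m ∧ b < m ∧ y < m := by
      rcases h with ⟨h1, h2, h3, h4, -⟩ | ⟨-, h1, h2, h3, h4⟩ | ⟨-, -, ⟨h1, h2, h3, h4⟩, -⟩
      · simp only at h1 h2
        subst h1 h2
        exact ⟨hlt h3, hlt h4, hlt h3, hlt h4⟩
      · simp only at h1 h2 h3 h4
        subst h1 h2 h3 h4
        exact ⟨hlt hu, hlt hu, hlt hu, hlt hu⟩
      · exact ⟨hlt h1, hlt h2, hlt h3, hlt h4⟩
    refine ⟨a, h'.1, x, h'.2.1, b, h'.2.2.1, y, h'.2.2.2, ?_⟩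
    rw [if_pos h, List.mem_singleton]

theorem List.sum_map_flatMap_range {α M : Type*} [AddCommMonoid M] (m : ℕ) (e : ℕ → List α)
    (g : α → M) : (((List.range m).reverse.flatMap e).map g).sum =
      ∑ i ∈ Finset.range m, ((e i).map g).sum := by
  induction m with
  | zero => simp
  | succ m ih =>
    rw [List.range_succ, List.reverse_append, List.reverse_singleton, List.singleton_append,
      List.flatMap_cons, List.map_append, List.sum_append, ih, Finset.sum_range_succ, add_comm]

open Classical in
-- Every branch occurs exactly once in the list, so sums over pushed children are the sums over
-- finite sets that the weight estimates control.
theorem sum_map_branchList {M : Type*} [AddCommMonoid M] (g : ℕ × ℕ × ℕ × ℕ → M) :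
    ((branchList G m f md u v).map g).sum =
      ∑ t ∈ (Finset.range m ×ˢ Finset.range m ×ˢ Finset.range m ×ˢ Finset.range m).filter
        (BranchAt G m f md u v), g t := by
  rw [Finset.sum_filter, Finset.sum_product]
  simp only [branchList, List.sum_map_flatMap_range, Finset.sum_product]
  refine Finset.sum_congr rfl fun a _ => Finset.sum_congr rfl fun x _ =>
    Finset.sum_congr rfl fun b _ => Finset.sum_congr rfl fun y _ => ?_
  split_ifs <;> simp

theorem length_branchList_le : (branchList G m f md u v).length ≤ m ^ 4 := by
  classical
  have h := sum_map_branchList (G := G) (m := m) (f := f) (md := md) (u := u) (v := v)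
    (fun _ => (1 : ℕ))
  rw [List.map_const', List.sum_replicate, smul_eq_mul, mul_one] at h
  rw [h, Finset.sum_const, smul_eq_mul, mul_one]
  refine (Finset.card_filter_le _ _).trans (le_of_eq ?_)
  simp only [Finset.card_product, Finset.card_range]
  ring

/-- The nodes on the stack, the best node found, the number of its selected vertices; here `k` is the
number of vertices of a largest induced matching. -/
structure SearchState (G : SimpleGraph ℕ) (m k : ℕ) (L : List (ℕ → ℕ)) (best : ℕ → ℕ) (c : ℕ) :
    Prop where
  isNode : ∀ f ∈ L, IsNode G m f
  le_two : ∀ i, best i ≤ 2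
  eq_zero : ∀ i, m ≤ i → best i = 0
  matching : InducesMatching G (selected m best)
  card : c = (selected m best).card
  attains : k ≤ c ∨ ∃ f ∈ L, Attains G m f k
  shallow : ∀ p f, L[p]? = some f → p ≤ m ^ 4 * (m - (undecided m f).card)

/-- The field `shallow` allows `m ^ 4` positions for each decided vertex. Applied to the topmost
node, it bounds the height of the stack. -/
theorem SearchState.length_le {L : List (ℕ → ℕ)} (h : SearchState G m k L best c) :
    L.length ≤ m ^ 5 + 1 := by
  rcases Nat.eq_zero_or_pos L.length with h0 | h0
  · omega
  · have h1 := h.shallow (L.length - 1) L[L.length - 1] (List.getElem?_eq_getElem (by omega))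
    have h2 := Nat.mul_le_mul_left (m ^ 4)
      (Nat.sub_le m (undecided m L[L.length - 1]).card)
    have h3 : m ^ 4 * m = m ^ 5 := by ring
    omega

/-- The nodes that are pushed after the node `f` was popped. -/
def IsExpansion (G : SimpleGraph ℕ) (m : ℕ) (f : ℕ → ℕ) (l : List (ℕ → ℕ)) : Prop :=
  (undecided m f = ∅ ∧ l = []) ∨
  ∃ u v, IsPivot G (undecided m f) u v ∧ ∃ md,
    md = branchMode (nbrsIn G (undecided m f) u).card (nbrsIn G (undecided m f) v).card ∧
    l = (branchList G m f md u (if md = 2 then v else u)).map (childNode G md u f)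

/-- The optimum is never lost: if the popped node can reach `k`, then so can one of its children,
and a node without undecided vertices has already reached it and is recorded. -/
theorem SearchState.step {L l : List (ℕ → ℕ)} (h : SearchState G m k (L ++ [f]) best c)
    {col : ℕ → Bool} (hcol : ∀ i j, G.Adj i j → col i ≠ col j) (hl : IsExpansion G m f l) :
    SearchState G m k (L ++ l) (if c < (selected m f).card then f else best)
      (if c < (selected m f).card then (selected m f).card else c) := by
  have hf : IsNode G m f := h.isNode f (by simp)
  refine ⟨fun g hg => ?_, ?_, ?_, ?_, ?_, ?_, fun p g hp => ?_⟩
  · rcases List.mem_append.1 hg with hg | hg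
    · exact h.isNode g (by simp [hg])
    · rcases hl with ⟨-, rfl⟩ | ⟨u, v, hp, md, -, rfl⟩
      · simp at hg
      · obtain ⟨t, ht, rfl⟩ := List.mem_map.1 hg
        exact ((mem_branchList hp.mem).1 ht).isNode hf
  · split_ifs
    exacts [hf.le_two, h.le_two]
  · split_ifs
    exacts [hf.eq_zero, h.eq_zero]
  · split_ifs
    exacts [hf.matching, h.matching]
  · split_ifs
    exacts [rfl, h.card]
  · rcases h.attains with hk | ⟨g, hg, hk⟩
    · left
      split_ifs <;> omega
    · rcases List.mem_append.1 hg with hg | hg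
      · exact Or.inr ⟨g, by simp [hg], hk⟩
      · rw [List.mem_singleton] at hg
        subst hg
        rcases hl with ⟨h0, -⟩ | ⟨u, v, hp, md, hmd, rfl⟩
        · obtain ⟨W, hW, -, hk⟩ := hk
          rw [h0, Finset.subset_empty] at hW
          subst hW
          rw [Finset.card_empty] at hk
          left
          split_ifs <;> omega
        · obtain ⟨t, ht, hk⟩ := exists_child_attains hcol hk hp hmd
          exact Or.inr ⟨_, List.mem_append_right _
            (List.mem_map.2 ⟨t, (mem_branchList hp.mem).2 ht, rfl⟩), hk⟩
  · rw [List.getElem?_append] at hp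
    split_ifs at hp with hlt
    · refine h.shallow p g ?_
      rw [List.getElem?_append_left hlt, hp]
    · rcases hl with ⟨-, rfl⟩ | ⟨u, v, hpiv, md, -, rfl⟩
      · simp at hp
      · have h1 := h.shallow L.length f (by simp)
        have h2 := (List.getElem?_eq_some_iff.1 hp).1
        rw [List.length_map] at h2
        have h3 := length_branchList_le (G := G) (m := m) (f := f) (md := md) (u := u)
          (v := if md = 2 then v else u)
        obtain ⟨t, ht, rfl⟩ := List.mem_map.1 (List.mem_of_getElem? hp)
        have h4 := ((mem_branchList hpiv.mem).1 ht).card_lt hpiv.mem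
        -- The at most `m ^ 4` children lie directly above the old position of `f`, and each has
        -- decided at least one more vertex, which raises its permitted position by `m ^ 4`.
        have h5 := card_undecided_le m f
        have h6 := Nat.mul_le_mul_left (m ^ 4) (show m - (undecided m f).card + 1 ≤
          m - (undecided m (childNode G md u f t)).card by omega)
        rw [Nat.mul_add, Nat.mul_one] at h6
        omega

/-- A node without undecided vertices has no children; its own potential, which is at least `1`,
pays for its round. -/
theorem sum_potential_expansion_le {β : ℝ} (hβ : 701009 / 500000 ≤ β) {col : ℕ → Bool}
    (hcol : ∀ i j, G.Adj i j → col i ≠ col j) {l : List (ℕ → ℕ)} (hl : IsExpansion G m f l) :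
    (l.map (potential m β)).sum + 1 ≤ potential m β f := by
  classical
  rcases hl with ⟨-, rfl⟩ | ⟨u, v, hp, md, hmd, rfl⟩
  · simpa using one_le_potential (by linarith) m f
  · rw [List.map_map, sum_map_branchList]
    exact sum_potential_le hβ hcol hp hmd fun t ht => (Finset.mem_filter.1 ht).2

end SearchState

/-! ## The search program -/

namespace Search

open Expr

/-- Move the topmost node of the stack to array `2`. -/
def popCmd : Cmd :=
  .seq (.assign 10 (sub (var 10) (const 1)))
    (.seq (.loop 7 (.store 2 (var 7) (arr 1 (add (scale (var 10)) (var 7)))))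
      (.loop 7 (.store 1 (add (scale (var 10)) (var 7)) (const 0))))

/-- Update the best node. -/
def recordCmd : Cmd :=
  .seq (.assign 15 (sum 7 (ite (eq (arr 2 (var 7)) (const 2)) (const 1) (const 0))))
    (.ite (lt (var 11) (var 15))
      (.seq (.assign 11 (var 15)) (.loop 7 (.store 3 (var 7) (arr 2 (var 7))))) .skip)

/-- Find a pivot, if there is one. -/
def pivotCmd : Cmd :=
  .seq (.assign 12 (const 0)) (.loop 13 (.loop 14 (.ite pivotExpr
    (.seq (.assign 0 (var 13)) (.seq (.assign 1 (var 14)) (.assign 12 (const 1)))) .skip)))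

/-- Push a child of the current node. -/
def pushCmd : Cmd :=
  .seq (.loop 7 (.store 1 (add (scale (var 10)) (var 7)) childExpr))
    (.assign 10 (add (var 10) (const 1)))

/-- Push all children of the current node. -/
def branchCmd : Cmd :=
  .loop 3 (.loop 4 (.loop 5 (.loop 6 (.ite branchExpr pushCmd .skip))))

def expandCmd : Cmd :=
  .seq pivotCmd (.ite (var 12) (.seq (.assign 2 modeExpr)
    (.seq (.ite (eq (var 2) (const 2)) .skip (.assign 1 (var 0))) branchCmd)) .skip)

/-- Set some variables to zero. -/
def resetCmd : List (Fin 16) → Cmd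
  | [] => .skip
  | x :: xs => .seq (.assign x (const 0)) (resetCmd xs)

def bodyCmd : Cmd :=
  .seq popCmd (.seq recordCmd (.seq expandCmd
    (resetCmd [0, 1, 2, 3, 4, 5, 6, 7, 8, 9, 12, 13, 14, 15])))

/-- The node at position `p` of the stack. -/
def frameAt (m : ℕ) (σ : Store) (p i : ℕ) : ℕ := if i < m then σ.arr 1 (p * m + i) else 0

/-- The nodes on the stack. -/
def stack (m : ℕ) (σ : Store) : List (ℕ → ℕ) := (List.range (σ.var 10)).map (frameAt m σ)

/-- The stack array vanishes above the stack. -/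
def ClearAbove (m : ℕ) (σ : Store) : Prop := ∀ q, σ.var 10 * m ≤ q → σ.arr 1 q = 0

variable {G : SimpleGraph ℕ} {m N : ℕ} {f : ℕ → ℕ} {σ τ : Store}

theorem stack_congr (h10 : τ.var 10 = σ.var 10) (h1 : τ.arr 1 = σ.arr 1) :
    stack m τ = stack m σ := by
  unfold stack frameAt; rw [h10, h1]

theorem ClearAbove.congr (h : ClearAbove m σ) (h10 : τ.var 10 = σ.var 10)
    (h1 : τ.arr 1 = σ.arr 1) : ClearAbove m τ := by
  unfold ClearAbove; rw [h10, h1]; exact h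

theorem length_stack (m : ℕ) (σ : Store) : (stack m σ).length = σ.var 10 := by simp [stack]

theorem stack_eq_append (h10 : τ.var 10 = σ.var 10 + 1)
    (h : ∀ q < σ.var 10 * m, τ.arr 1 q = σ.arr 1 q)
    (hf : ∀ i < m, τ.arr 1 (σ.var 10 * m + i) = f i) (h0 : ∀ i, m ≤ i → f i = 0) :
    stack m τ = stack m σ ++ [f] := by
  unfold stack
  rw [h10, List.range_succ, List.map_append, List.map_singleton]
  congr 1
  · refine List.map_congr_left fun p hp => ?_
    funext i
    unfold frameAt
    split_ifs with hi
    · refine h _ ?_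
      have := Nat.mul_le_mul_right m (show p + 1 ≤ σ.var 10 from List.mem_range.1 hp)
      rw [Nat.add_mul] at this
      omega
    · rfl
  · congr 1
    funext i
    unfold frameAt
    split_ifs with hi
    exacts [hf i hi, (h0 i (by omega)).symm]

/-- Every nonzero cell of the stack array belongs to a node on the stack. Hence its index is bounded
by the stack height and its value by `2`. -/
theorem exists_frame_of_arr_ne_zero (h : ClearAbove m σ) {q : ℕ} (hq : σ.arr 1 q ≠ 0) :
    q < σ.var 10 * m ∧ ∃ f ∈ stack m σ, f (q % m) = σ.arr 1 q := by
  have hlt : q < σ.var 10 * m := by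
    by_contra hc
    exact hq (h q (by omega))
  have hm : 0 < m := by
    rcases Nat.eq_zero_or_pos m with rfl | h0
    · simp at hlt
    · exact h0
  refine ⟨hlt, frameAt m σ (q / m), ?_, ?_⟩
  · exact List.mem_map.2 ⟨q / m, List.mem_range.2 ((Nat.div_lt_iff_lt_mul hm).2 hlt), rfl⟩
  · unfold frameAt
    rw [if_pos (Nat.mod_lt _ hm), Nat.div_add_mod']

/-- Erasing the freed block preserves `ClearAbove`. Without it, stale cells above the stack would
escape the space bound. -/
theorem run_pop (h0 : σ.var 10 ≠ 0) (hc : ClearAbove m σ) :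
    ∃ f : ℕ → ℕ, stack m σ = stack m (popCmd.run m N σ) ++ [f] ∧ (∀ i, m ≤ i → f i = 0) ∧
      (∀ i, (popCmd.run m N σ).arr 2 i = if i < m then f i else σ.arr 2 i) ∧
      ClearAbove m (popCmd.run m N σ) := by
  have hrun : popCmd.run m N σ =
      (Cmd.loop 7 (.store 1 (add (scale (var 10)) (var 7)) (const 0))).run m N
        ((Cmd.loop 7 (.store 2 (var 7) (arr 1 (add (scale (var 10)) (var 7))))).run m N
          (σ.setVar 10 (σ.var 10 - 1))) := rfl
  rw [hrun]
  set τ := (Cmd.loop 7 (.store 1 (add (scale (var 10)) (var 7)) (const 0))).run m N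
    ((Cmd.loop 7 (.store 2 (var 7) (arr 1 (add (scale (var 10)) (var 7))))).run m N
      (σ.setVar 10 (σ.var 10 - 1))) with hτ
  have h10 : τ.var 10 = σ.var 10 - 1 := by
    rw [hτ, Cmd.var_run rfl, Cmd.var_run rfl]
    rfl
  have h1 : ∀ q, τ.arr 1 q = if (σ.var 10 - 1) * m ≤ q ∧ q < (σ.var 10 - 1) * m + m then 0
      else σ.arr 1 q := fun q => by
    rw [hτ, Cmd.run_fill (off := (σ.var 10 - 1) * m) (v := fun _ => 0)]
    · rw [Cmd.arr_run rfl]; rfl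
    · intro ρ hv _ _ _
      have := hv 10 (by decide)
      rw [Cmd.var_run rfl] at this
      refine ⟨?_, rfl⟩
      simp only [eval, this]
      rfl
  have h2 : ∀ q, τ.arr 2 q = if q < m then σ.arr 1 ((σ.var 10 - 1) * m + q) else σ.arr 2 q :=
      fun q => by
    rw [hτ, Cmd.arr_run rfl,
      Cmd.run_fill (off := 0) (v := fun i => σ.arr 1 ((σ.var 10 - 1) * m + i))]
    · simp only [zero_le, true_and, zero_add, Nat.sub_zero]; rfl
    · intro ρ hv ha _ _
      have hv' := hv 10 (by decide)
      have ha' := ha 1 (by decide)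
      refine ⟨by simp [eval], ?_⟩
      simp only [eval, hv', ha']
      rfl
  have hsplit : (σ.var 10 - 1) * m + m = σ.var 10 * m := by
    obtain ⟨s, hs⟩ := Nat.exists_eq_succ_of_ne_zero h0
    rw [hs, Nat.succ_sub_one, Nat.succ_mul]
  refine ⟨fun i => if i < m then σ.arr 1 ((σ.var 10 - 1) * m + i) else 0, ?_, fun i hi =>
    if_neg (by omega), fun i => ?_, fun q hq => ?_⟩
  · refine stack_eq_append (by omega) (fun q hq => ?_) (fun i hi => ?_) fun i hi => if_neg (by omega)
    · rw [h10] at hq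
      rw [h1, if_neg (by omega)]
    · rw [h10, if_pos hi]
  · rw [h2]
    split_ifs with hi
    exacts [(if_pos hi).symm, rfl]
  · rw [h10] at hq
    rw [h1]
    split_ifs with h
    · rfl
    · exact hc q (by omega)

theorem run_record (hf : ∀ i < m, σ.arr 2 i = f i) :
    (recordCmd.run m N σ).var 11 =
      (if σ.var 11 < (selected m f).card then (selected m f).card else σ.var 11) ∧
    (recordCmd.run m N σ).arr 3 = if σ.var 11 < (selected m f).card then
      (fun i => if i < m then f i else σ.arr 3 i) else σ.arr 3 := by
  classical
  have hcount : (sum 7 (ite (eq (arr 2 (var 7)) (const 2)) (const 1) (const 0))).eval m σ =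
      (selected m f).card := by
    rw [eval, selected, Finset.card_filter]
    refine Finset.sum_congr rfl fun i hi => ?_
    rw [eval_ite, holds_eq]
    simp [eval, hf i (Finset.mem_range.1 hi)]
  set ρ := σ.setVar 15 (selected m f).card with hρ
  have hrun : recordCmd.run m N σ = if σ.var 11 < (selected m f).card then
      (Cmd.loop 7 (.store 3 (var 7) (arr 2 (var 7)))).run m N
        (ρ.setVar 11 (selected m f).card) else ρ := by
    rw [recordCmd, Cmd.run, Cmd.run, hcount, Cmd.run]
    have : (lt (var 11) (var 15)).eval m ρ ≠ 0 ↔ σ.var 11 < (selected m f).card :=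
      holds_lt.trans (by simp [eval, hρ])
    simp only [← hρ, this]
    split_ifs
    · simp only [Cmd.run, eval, hρ, Store.var_setVar, if_true]
    · rfl
  rw [hrun]
  split_ifs with h
  · refine ⟨(Cmd.var_run rfl _).trans (by simp), funext fun q => ?_⟩
    rw [Cmd.run_fill (off := 0) (v := f)]
    · simp only [zero_le, true_and, zero_add, Nat.sub_zero]; rfl
    · intro κ _ ha _ hi
      refine ⟨by simp [eval], ?_⟩
      simp only [eval, ha 2 (by decide)]
      exact hf _ hi
  · exact ⟨by simp [hρ], rfl⟩

/-- The double loop keeps the last pivot that it meets, with variable `12` as a flag. If the flag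
stays `0`, no pair is a pivot, and by `exists_isPivot` no vertex is undecided. -/
theorem run_pivot (h : Reads G m f σ) :
    ((pivotCmd.run m N σ).var 12 = 0 ∧ undecided m f = ∅) ∨
    ((pivotCmd.run m N σ).var 12 ≠ 0 ∧
      IsPivot G (undecided m f) ((pivotCmd.run m N σ).var 0) ((pivotCmd.run m N σ).var 1) ∧
      (pivotCmd.run m N σ).var 0 < m ∧ (pivotCmd.run m N σ).var 1 < m) := by
  classical
  let e : ℕ → ℕ → List (ℕ × ℕ) := fun p q => if IsPivot G (undecided m f) p q then [(p, q)] else []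
  -- The list is a ghost value: all pivots met so far, of which the variables `0` and `1` hold one
  -- as soon as the list is nonempty.
  let J : Store → List (ℕ × ℕ) → Prop := fun τ l => Reads G m f τ ∧
    (∀ z ∈ l, IsPivot G (undecided m f) z.1 z.2 ∧ z.1 < m ∧ z.2 < m) ∧
    ((τ.var 12 = 0 ∧ l = []) ∨ (τ.var 12 ≠ 0 ∧ (τ.var 0, τ.var 1) ∈ l))
  have hJ : ∀ {τ l x v}, J τ l → x ≠ 12 → x ≠ 0 → x ≠ 1 → J (τ.setVar x v) l := by
    intro τ l x v hτ h12 h0 h1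
    refine ⟨hτ.1.setVar _ _, hτ.2.1, ?_⟩
    rw [Store.var_setVar, Store.var_setVar, Store.var_setVar, if_neg h12.symm, if_neg h0.symm,
      if_neg h1.symm]
    exact hτ.2.2
  have key : J (pivotCmd.run m N σ) ([] ++ (List.range m).reverse.flatMap fun p =>
      (List.range m).reverse.flatMap (e p)) := by
    refine Store.iterDown_append (J := J) (σ := σ.setVar 12 0) (l := [])
      ⟨h.setVar _ _, by simp, Or.inl ⟨by simp, rfl⟩⟩ fun p hp τ l hτ => ?_
    refine (Store.iterDown_append (J := fun τ l => J τ l ∧ τ.var 13 = p)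
      ⟨hJ hτ (by decide) (by decide) (by decide), by simp⟩ fun q hq τ l hτ => ?_).1
    have hpiv := (hτ.1.1.setVar 14 q).holds_pivot (by simpa [hτ.2] using hp) (by simpa using hq)
    simp only [Store.var_setVar, hτ.2, if_true, show ((13 : Fin 16) = 14) = False by decide,
      if_false] at hpiv
    refine ⟨?_, (Cmd.var_run rfl _).trans (by simp [hτ.2])⟩
    rw [Cmd.run]
    have hiff : pivotExpr.eval m (τ.setVar 14 q) ≠ 0 ↔ IsPivot G (undecided m f) p q := hpiv
    simp only [hiff, e]
    split_ifs with hpq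
    · refine ⟨hτ.1.1.congr rfl rfl, fun z hz => ?_, Or.inr ⟨?_, ?_⟩⟩
      · rcases List.mem_append.1 hz with hz | hz
        · exact hτ.1.2.1 z hz
        · rw [List.mem_singleton] at hz
          subst hz
          exact ⟨hpq, hp, hq⟩
      · simp [Cmd.run, eval]
      · simp [Cmd.run, eval, hτ.2]
    · rw [List.append_nil]
      exact hJ hτ.1 (by decide) (by decide) (by decide)
  rw [List.nil_append] at key
  obtain ⟨-, h1, h2 | h2⟩ := key
  · refine Or.inl ⟨h2.1, Finset.not_nonempty_iff_eq_empty.1 fun hne => ?_⟩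
    obtain ⟨u, hu, v, hv, hp⟩ := exists_isPivot (G := G) hne
    have : (u, v) ∈ (List.range m).reverse.flatMap fun p =>
        (List.range m).reverse.flatMap (e p) := by
      simp only [List.mem_flatMap, List.mem_reverse, List.mem_range]
      exact ⟨u, (mem_undecided.1 hu).1, v, (mem_undecided.1 hv).1, by simp [e, hp]⟩
    rw [h2.2] at this
    simp at this
  · exact Or.inr ⟨h2.1, h1 _ h2.2⟩

variable {u v md a x b y : ℕ}

theorem run_push (h : Reads G m f σ) (hv : Holding m u v md a x b y σ) (hc : ClearAbove m σ)
    (h0 : ∀ i, m ≤ i → childNode G md u f (a, x, b, y) i = 0) :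
    stack m (pushCmd.run m N σ) = stack m σ ++ [childNode G md u f (a, x, b, y)] ∧
      ClearAbove m (pushCmd.run m N σ) := by
  set τ := pushCmd.run m N σ with hτ
  have h10 : τ.var 10 = σ.var 10 + 1 := by
    rw [hτ, pushCmd, Cmd.run, Cmd.run]
    simp only [eval, Store.var_setVar, if_true]
    rw [Cmd.var_run rfl]
  have h1 : ∀ q, τ.arr 1 q = if σ.var 10 * m ≤ q ∧ q < σ.var 10 * m + m then
      childNode G md u f (a, x, b, y) (q - σ.var 10 * m) else σ.arr 1 q := fun q => by
    rw [hτ, pushCmd, Cmd.run, Cmd.run, Store.arr_setVar,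
      Cmd.run_fill (off := σ.var 10 * m) (v := childNode G md u f (a, x, b, y))]
    intro ρ hv' ha _ hi
    refine ⟨by simp only [eval, hv' 10 (by decide)], ?_⟩
    refine (h.congr (ha 0 (by decide)) (ha 2 (by decide))).eval_child (v := v)
      ⟨?_, ?_, ?_, ?_, ?_, ?_, ?_, hv.lt⟩ hi
    exacts [(hv' 0 (by decide)).trans hv.var_zero, (hv' 1 (by decide)).trans hv.var_one,
      (hv' 2 (by decide)).trans hv.var_two, (hv' 3 (by decide)).trans hv.var_three,
      (hv' 4 (by decide)).trans hv.var_four, (hv' 5 (by decide)).trans hv.var_five,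
      (hv' 6 (by decide)).trans hv.var_six]
  refine ⟨stack_eq_append h10 (fun q hq => by rw [h1, if_neg (by omega)]) (fun i hi => ?_) h0,
    fun q hq => ?_⟩
  · rw [h1, if_pos (by omega), Nat.add_sub_cancel_left]
  · rw [h10, Nat.add_mul, Nat.one_mul] at hq
    rw [h1, if_neg (by omega), hc q (by omega)]

/-- Pushing writes only to the stack, so all children are computed from the same node in array `2`.
The ghost list in the invariant records the branches found so far, and the stack grows by their
images. -/
theorem run_branch (hf : IsNode G m f) (h : Reads G m f σ) (hc : ClearAbove m σ)
    (hu : σ.var 0 = u) (hv : σ.var 1 = v) (hmd : σ.var 2 = md) (hum : u < m) (hvm : v < m) :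
    stack m (branchCmd.run m N σ) =
      stack m σ ++ (branchList G m f md u v).map (childNode G md u f) ∧
    ClearAbove m (branchCmd.run m N σ) := by
  classical
  let J : Store → List (ℕ × ℕ × ℕ × ℕ) → Prop := fun τ l => Reads G m f τ ∧ ClearAbove m τ ∧
    τ.var 0 = u ∧ τ.var 1 = v ∧ τ.var 2 = md ∧
    stack m τ = stack m σ ++ l.map (childNode G md u f)
  have hJ : ∀ {τ l x i}, J τ l → x ≠ 10 → x ≠ 0 → x ≠ 1 → x ≠ 2 → J (τ.setVar x i) l := by
    rintro τ l x i ⟨h1, h2, h3, h4, h5, h6⟩ n10 n0 n1 n2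
    have g10 : (τ.setVar x i).var 10 = τ.var 10 := by rw [Store.var_setVar, if_neg n10.symm]
    refine ⟨h1.setVar _ _, h2.congr g10 rfl, ?_, ?_, ?_, (stack_congr g10 rfl).trans h6⟩
    · rw [Store.var_setVar, if_neg n0.symm, h3]
    · rw [Store.var_setVar, if_neg n1.symm, h4]
    · rw [Store.var_setVar, if_neg n2.symm, h5]
  have key : J (branchCmd.run m N σ) ([] ++ branchList G m f md u v) := by
    refine Store.iterDown_append (J := J) ⟨h, hc, hu, hv, hmd, by simp⟩ fun a ha τ l hτ => ?_
    refine (Store.iterDown_append (J := fun τ l => J τ l ∧ τ.var 3 = a)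
      ⟨hJ hτ (by decide) (by decide) (by decide) (by decide), by simp⟩ fun x hx τ l hτ => ?_).1
    refine ⟨?_, (Cmd.var_run (P := .loop 5 _) rfl _).trans (by simp [hτ.2])⟩
    have h3 := hτ.2
    refine (Store.iterDown_append (J := fun τ l => J τ l ∧ τ.var 3 = a ∧ τ.var 4 = x)
      ⟨hJ hτ.1 (by decide) (by decide) (by decide) (by decide), by simp [h3]⟩
      fun b hb τ l hτ => ?_).1
    refine ⟨?_, (Cmd.var_run (P := .loop 6 _) rfl _).trans (by simp [hτ.2.1]),
      (Cmd.var_run (P := .loop 6 _) rfl _).trans (by simp [hτ.2.2])⟩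
    have h3 := hτ.2.1
    have h4 := hτ.2.2
    refine (Store.iterDown_append
      (J := fun τ l => J τ l ∧ τ.var 3 = a ∧ τ.var 4 = x ∧ τ.var 5 = b)
      ⟨hJ hτ.1 (by decide) (by decide) (by decide) (by decide), by simp [h3, h4]⟩
      fun y hy τ l hτ => ?_).1
    have h3 := hτ.2.1
    have h4 := hτ.2.2.1
    have h5 := hτ.2.2.2
    refine ⟨?_, (Cmd.var_run rfl _).trans (by simp [h3]), (Cmd.var_run rfl _).trans (by simp [h4]),
      (Cmd.var_run rfl _).trans (by simp [h5])⟩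
    obtain ⟨g1, g2, g3, g4, g5, g6⟩ : J (τ.setVar 6 y) l :=
      hJ hτ.1 (by decide) (by decide) (by decide) (by decide)
    have hold : Holding m u v md a x b y (τ.setVar 6 y) :=
      ⟨g3, g4, g5, by simp [h3], by simp [h4], by simp [h5], by simp, hum, hvm, ha, hx, hb, hy⟩
    have hiff : branchExpr.eval m (τ.setVar 6 y) ≠ 0 ↔ BranchAt G m f md u v (a, x, b, y) :=
      g1.holds_branch hold
    rw [Cmd.run]
    simp only [hiff]
    split_ifs with hbr
    · obtain ⟨k1, k2⟩ := run_push (N := N) g1 hold g2 fun i hi => (hbr.isNode hf).eq_zero i hi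
      refine ⟨g1.congr (Cmd.arr_run rfl _) (Cmd.arr_run rfl _), k2,
        (Cmd.var_run rfl _).trans g3, (Cmd.var_run rfl _).trans g4, (Cmd.var_run rfl _).trans g5, ?_⟩
      rw [k1, g6, List.map_append, List.map_singleton, List.append_assoc]
    · rw [List.append_nil]
      exact ⟨g1, g2, g3, g4, g5, g6⟩
  rw [List.nil_append] at key
  exact ⟨key.2.2.2.2.2, key.2.1⟩

theorem run_expand (hf : IsNode G m f) (h : Reads G m f σ) (hc : ClearAbove m σ) :
    ∃ l, IsExpansion G m f l ∧ stack m (expandCmd.run m N σ) = stack m σ ++ l ∧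
      ClearAbove m (expandCmd.run m N σ) := by
  have hp := run_pivot (N := N) h
  set ρ := pivotCmd.run m N σ with hρ
  have hr : Reads G m f ρ := h.congr (Cmd.arr_run rfl _) (Cmd.arr_run rfl _)
  have h10 : ρ.var 10 = σ.var 10 := Cmd.var_run rfl _
  have h1 : ρ.arr 1 = σ.arr 1 := Cmd.arr_run rfl _
  -- Outside mode `2` the second pivot is overwritten by the first one, as in the `if md = 2 then v
  -- else u` of `IsExpansion`.
  have hrun : expandCmd.run m N σ = if ρ.var 12 ≠ 0 then
      branchCmd.run m N ((Cmd.ite (eq (var 2) (const 2)) .skip (.assign 1 (var 0))).run m N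
        (ρ.setVar 2 (modeExpr.eval m ρ))) else ρ := rfl
  rw [hrun]
  rcases hp with ⟨h12, h0⟩ | ⟨h12, hp, hu, hv⟩
  · rw [if_neg (not_not.2 h12)]
    exact ⟨[], Or.inl ⟨h0, rfl⟩, by rw [List.append_nil]; exact stack_congr h10 h1,
      hc.congr h10 h1⟩
  · rw [if_pos h12, hr.eval_mode hu hv]
    set md := branchMode (nbrsIn G (undecided m f) (ρ.var 0)).card
      (nbrsIn G (undecided m f) (ρ.var 1)).card with hmd
    set κ := (Cmd.ite (eq (var 2) (const 2)) .skip (.assign 1 (var 0))).run m N (ρ.setVar 2 md)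
      with hκ
    have k0 : κ.var 0 = ρ.var 0 := (Cmd.var_run rfl _).trans (by simp)
    have k1 : κ.var 1 = if md = 2 then ρ.var 1 else ρ.var 0 := by
      have : (eq (var 2) (const 2)).eval m (ρ.setVar 2 md) ≠ 0 ↔ md = 2 :=
        holds_eq.trans (by simp [eval])
      rw [hκ, Cmd.run]
      simp only [this]
      split_ifs
      · simp [Cmd.run]
      · simp [Cmd.run, eval]
    have k2 : κ.var 2 = md := (Cmd.var_run rfl _).trans (by simp)
    have k10 : κ.var 10 = σ.var 10 := (Cmd.var_run rfl _).trans (by simp [h10])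
    have k1' : κ.arr 1 = σ.arr 1 := (Cmd.arr_run rfl _).trans h1
    obtain ⟨g1, g2⟩ := run_branch (N := N) (σ := κ) hf
      (hr.congr (Cmd.arr_run rfl _) (Cmd.arr_run rfl _)) (hc.congr k10 k1') k0 k1 k2 hu
      (by split_ifs <;> assumption)
    rw [stack_congr k10 k1'] at g1
    exact ⟨_, Or.inr ⟨_, _, hp, md, hmd, rfl⟩, g1, g2⟩

theorem var_run_reset (L : List (Fin 16)) (σ : Store) (x : Fin 16) :
    ((resetCmd L).run m N σ).var x = if x ∈ L then 0 else σ.var x := by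
  induction L generalizing σ with
  | nil => rfl
  | cons z L ih =>
    rw [resetCmd, Cmd.run, ih]
    simp only [Cmd.run, eval, Store.var_setVar, List.mem_cons]
    split_ifs <;> simp_all

end Search

/-! ## Correctness of the search program -/

namespace Search

open Expr

/-- The contents of the store between two rounds of the search. -/
structure SearchInv (G : SimpleGraph ℕ) (m k : ℕ) (w : ℕ → ℕ) (σ : Store) : Prop where
  adj : ∀ i < m, ∀ j < m, (σ.arr 0 (i * m + j) ≠ 0 ↔ G.Adj i j)
  adj_le : ∀ q, σ.arr 0 q ≤ 1
  adj_eq_zero : ∀ q, m * m ≤ q → σ.arr 0 q = 0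
  node_le : ∀ i, σ.arr 2 i ≤ 2
  node_eq_zero : ∀ i, m ≤ i → σ.arr 2 i = 0
  clear : ClearAbove m σ
  state : SearchState G m k (stack m σ) (σ.arr 3) (σ.var 11)
  var : ∀ x, x ≠ 10 → x ≠ 11 → σ.var x = 0
  io : σ.io = w

/-- The sum of the potentials of all nodes on the stack. -/
noncomputable def stackPotential (m : ℕ) (β : ℝ) (σ : Store) : ℝ :=
  ((stack m σ).map (potential m β)).sum

variable {G : SimpleGraph ℕ} {m N k : ℕ} {w : ℕ → ℕ} {σ : Store}

/-- One round replaces the top node by its expansion, so the potential of the stack drops by at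
least `1`. All variables but the stack height and the record are reset, which keeps them bounded
between rounds. -/
theorem SearchInv.body (h : SearchInv G m k w σ) (h0 : σ.var 10 ≠ 0) {col : ℕ → Bool}
    (hcol : ∀ i j, G.Adj i j → col i ≠ col j) {β : ℝ} (hβ : 701009 / 500000 ≤ β) :
    SearchInv G m k w (bodyCmd.run m N σ) ∧
      stackPotential m β (bodyCmd.run m N σ) + 1 ≤ stackPotential m β σ := by
  obtain ⟨f, hs, hf0, hf, hc⟩ := run_pop (N := N) h0 h.clear
  set τ₁ := popCmd.run m N σ with hτ₁
  have hnode : IsNode G m f := h.state.isNode f (by simp [hs])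
  have hrec := run_record (N := N) (σ := τ₁) (f := f) fun i hi => by rw [hf, if_pos hi]
  set τ₂ := recordCmd.run m N τ₁ with hτ₂
  have a0 : τ₂.arr 0 = σ.arr 0 := (Cmd.arr_run rfl _).trans (Cmd.arr_run rfl _)
  have a2 : τ₂.arr 2 = τ₁.arr 2 := Cmd.arr_run rfl _
  have a1 : τ₂.arr 1 = τ₁.arr 1 := Cmd.arr_run rfl _
  have v10 : τ₂.var 10 = τ₁.var 10 := Cmd.var_run rfl _
  have hread : Reads G m f τ₂ :=
    ⟨by rw [a0]; exact h.adj, fun i hi => by rw [a2, hf, if_pos hi]⟩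
  obtain ⟨l, hl, hl', hc'⟩ := run_expand (N := N) hnode hread (hc.congr v10 a1)
  set τ₃ := expandCmd.run m N τ₂ with hτ₃
  rw [stack_congr v10 a1] at hl'
  have hrun : bodyCmd.run m N σ =
    (resetCmd [0, 1, 2, 3, 4, 5, 6, 7, 8, 9, 12, 13, 14, 15]).run m N τ₃ := rfl
  rw [hrun]
  set τ₄ := (resetCmd [0, 1, 2, 3, 4, 5, 6, 7, 8, 9, 12, 13, 14, 15]).run m N τ₃ with hτ₄
  have b10 : τ₄.var 10 = τ₃.var 10 := Cmd.var_run rfl _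
  have b1 : τ₄.arr 1 = τ₃.arr 1 := Cmd.arr_run rfl _
  have b0 : τ₄.arr 0 = σ.arr 0 := (Cmd.arr_run rfl _).trans ((Cmd.arr_run rfl _).trans a0)
  have b2 : τ₄.arr 2 = τ₁.arr 2 := (Cmd.arr_run rfl _).trans ((Cmd.arr_run rfl _).trans a2)
  have b3 : τ₄.arr 3 = if σ.var 11 < (selected m f).card then f else σ.arr 3 := by
    have : τ₄.arr 3 = τ₂.arr 3 := (Cmd.arr_run rfl _).trans (Cmd.arr_run rfl _)
    have g11 : τ₁.var 11 = σ.var 11 := Cmd.var_run rfl _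
    have g3 : τ₁.arr 3 = σ.arr 3 := Cmd.arr_run rfl _
    rw [this, hrec.2, g11, g3]
    split_ifs
    · funext i
      split_ifs with hi
      exacts [rfl, (h.state.eq_zero i (by omega)).trans (hf0 i (by omega)).symm]
    · rfl
  have b11 : τ₄.var 11 = if σ.var 11 < (selected m f).card then (selected m f).card
      else σ.var 11 := by
    have : τ₄.var 11 = τ₂.var 11 := (Cmd.var_run rfl _).trans (Cmd.var_run rfl _)
    have g11 : τ₁.var 11 = σ.var 11 := Cmd.var_run rfl _
    rw [this, hrec.1, g11]
  have bs : stack m τ₄ = stack m τ₁ ++ l := (stack_congr b10 b1).trans hl'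
  have hstate := h.state
  rw [hs] at hstate
  refine ⟨⟨by rw [b0]; exact h.adj, by rw [b0]; exact h.adj_le, by rw [b0]; exact h.adj_eq_zero,
    fun i => ?_, fun i hi => ?_, hc'.congr b10 b1, ?_, fun x h10 h11 => ?_, ?_⟩, ?_⟩
  · rw [b2, hf]
    split_ifs
    exacts [hnode.le_two i, h.node_le i]
  · rw [b2, hf, if_neg (by omega), h.node_eq_zero i hi]
  · rw [bs, b3, b11]
    exact hstate.step hcol hl
  · rw [hτ₄, var_run_reset, if_pos]
    revert x
    decide
  · exact (Cmd.io_run rfl _).trans ((Cmd.io_run rfl _).trans ((Cmd.io_run rfl _).trans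
      ((Cmd.io_run rfl _).trans h.io)))
  · have := sum_potential_expansion_le hβ hcol hl
    unfold stackPotential
    rw [bs, hs, List.map_append, List.map_append, List.sum_append, List.sum_append,
      List.map_singleton, List.sum_singleton]
    linarith

theorem stackPotential_nonneg {β : ℝ} (hβ : 1 ≤ β) : 0 ≤ stackPotential m β σ := by
  refine List.sum_nonneg fun a ha => ?_
  obtain ⟨f, -, rfl⟩ := List.mem_map.1 ha
  exact zero_le_one.trans (one_le_potential hβ m f)

/-- The product term covers the stack height and the indices of the stack array, `m * m` those of
the matrix, `m` those of the two single nodes and the record, and `n + 2` the input values and the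
entries, which are at most `2`. -/
theorem SearchInv.within (h : SearchInv G m k w σ) {n : ℕ} (hw : ∀ i, w i ≤ n + 1) :
    σ.Within ((m ^ 5 + 1) * (m + 1) + m * m + m + n + 2) := by
  have hlen : σ.var 10 ≤ m ^ 5 + 1 := by
    rw [← length_stack m σ]; exact h.state.length_le
  have hlen' : σ.var 10 * m ≤ (m ^ 5 + 1) * m := Nat.mul_le_mul_right m hlen
  have hexp : (m ^ 5 + 1) * (m + 1) = (m ^ 5 + 1) * m + (m ^ 5 + 1) := by ring
  refine ⟨fun x => ?_, fun l i => ?_, fun l i hi => ?_, fun i => ?_⟩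
  · by_cases h10 : x = 10
    · subst h10
      omega
    by_cases h11 : x = 11
    · subst h11
      rw [h.state.card]
      have := card_selected_le m (σ.arr 3)
      omega
    rw [h.var x h10 h11]
    exact Nat.zero_le _
  · have : σ.arr l i ≤ 2 := by
      fin_cases l
      · exact (h.adj_le i).trans one_le_two
      · by_cases h1 : σ.arr 1 i = 0
        · exact h1.le.trans (Nat.zero_le 2)
        · obtain ⟨-, f, hf, hfi⟩ := exists_frame_of_arr_ne_zero h.clear h1
          exact hfi ▸ (h.state.isNode f hf).le_two _
      · exact h.node_le i
      · exact h.state.le_two i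
    omega
  · have key : i < m * m ∨ i < m ∨ i < σ.var 10 * m := by
      fin_cases l
      · exact Or.inl (lt_of_not_ge fun hc => hi (h.adj_eq_zero i hc))
      · exact Or.inr (Or.inr (exists_frame_of_arr_ne_zero h.clear hi).1)
      · exact Or.inr (Or.inl (lt_of_not_ge fun hc => hi (h.node_eq_zero i hc)))
      · exact Or.inr (Or.inl (lt_of_not_ge fun hc => hi (h.state.eq_zero i hc)))
    omega
  · rw [h.io]
    have := hw i
    omega

/-! ### The initial state -/

/-- Prepare the search in the graph whose edges are given by `e` in the variables `7` and `8`. -/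
def initCmd (e : Expr) : Cmd :=
  .seq (.loop 7 (.loop 8 (.store 0 (add (scale (var 7)) (var 8)) (ite e (const 1) (const 0)))))
    (.seq (.loop 7 (.store 1 (var 7) (const 1))) (.seq (resetCmd [7, 8]) (.assign 10 (const 1))))

/-- In a store with input `w`, the expression `e` describes the edges of `G`. -/
def DescribesAdj (G : SimpleGraph ℕ) (m : ℕ) (w : ℕ → ℕ) (e : Expr) : Prop :=
  ∀ τ : Store, τ.io = w → τ.var 7 < m → τ.var 8 < m → (e.Holds m τ ↔ G.Adj (τ.var 7) (τ.var 8))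

/-- Rows are filled from the last to the first. Row `i` occupies the block from `i * m` to `(i + 1)
* m`, so filling a row leaves the later ones intact. -/
theorem run_matrix {e : Expr} (he : DescribesAdj G m w e) (hio : σ.io = w)
    (h0 : ∀ q, σ.arr 0 q = 0) {τ : Store}
    (hτ : τ = (Cmd.loop 7 (.loop 8 (.store 0 (add (scale (var 7)) (var 8))
      (ite e (const 1) (const 0))))).run m N σ) :
    (∀ i < m, ∀ j < m, (τ.arr 0 (i * m + j) ≠ 0 ↔ G.Adj i j)) ∧ (∀ q, τ.arr 0 q ≤ 1) ∧
      ∀ q, m * m ≤ q → τ.arr 0 q = 0 := by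
  classical
  have := Store.iterDown_induction (m := m) (x := 7) (σ := σ)
    (f := (Cmd.loop 8 (.store 0 (add (scale (var 7)) (var 8)) (ite e (const 1) (const 0)))).run m N)
    (P := fun i₀ τ => τ.io = w ∧
      (∀ i, i₀ ≤ i → i < m → ∀ j < m, (τ.arr 0 (i * m + j) ≠ 0 ↔ G.Adj i j)) ∧
      (∀ q, τ.arr 0 q ≤ 1) ∧ ∀ q, m * m ≤ q → τ.arr 0 q = 0)
    ⟨hio, fun i hi hi' => by omega, fun q => by simp [h0], fun q _ => h0 q⟩ ?_
  · rw [hτ]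
    exact ⟨fun i hi => this.2.1 i (Nat.zero_le i) hi, this.2.2⟩
  · rintro i₀ hi₀ τ ⟨h1, h2, h3, h4⟩
    have hfill := Cmd.run_fill (m := m) (N := N) (k := 0) (x := 8) (σ := τ.setVar 7 i₀)
      (idx := add (scale (var 7)) (var 8)) (e := ite e (const 1) (const 0)) (off := i₀ * m)
      (v := fun j => if G.Adj i₀ j then 1 else 0) (fun ρ hv ha hρ hlt => by
        have h7 : ρ.var 7 = i₀ := (hv 7 (by decide)).trans (by simp)
        refine ⟨by simp only [eval, h7], ?_⟩
        have := he ρ (hρ.trans h1) (by omega) hlt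
        rw [h7] at this
        rw [eval_ite, this]
        rfl)
    refine ⟨(Cmd.io_run rfl _).trans h1, fun i hi hi' j hj => ?_, fun q => ?_, fun q hq => ?_⟩
    · rw [hfill]
      rcases hi.eq_or_lt with rfl | hlt
      · rw [if_pos (by omega), Nat.add_sub_cancel_left]
        split_ifs <;> simp_all
      · have := Nat.mul_le_mul_right m (Nat.succ_le_of_lt hlt)
        rw [Nat.succ_mul] at this
        rw [if_neg (by omega)]
        exact h2 i hlt hi' j hj
    · rw [hfill]
      split_ifs
      exacts [le_rfl, Nat.zero_le _, h3 q]
    · have := Nat.mul_le_mul_right m (Nat.succ_le_of_lt hi₀)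
      rw [Nat.succ_mul] at this
      rw [hfill, if_neg (by omega)]
      exact h4 q hq

/-- The root of the search tree: all vertices are undecided. -/
def rootNode (m i : ℕ) : ℕ := if i < m then 1 else 0

theorem undecided_rootNode (m : ℕ) : undecided m (rootNode m) = Finset.range m := by
  ext i
  simp [mem_undecided, rootNode]

theorem selected_eq_empty {f : ℕ → ℕ} (h : ∀ i, f i ≤ 1) : selected m f = ∅ := by
  ext i
  have := h i
  simp only [mem_selected, Finset.notMem_empty, iff_false]
  omega

theorem run_init {e : Expr} (he : DescribesAdj G m w e) (hio : σ.io = w)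
    (hvar : ∀ x, σ.var x = 0) (harr : ∀ l q, σ.arr l q = 0)
    (hk : ∃ W ⊆ Finset.range m, InducesMatching G W ∧ k ≤ W.card) :
    SearchInv G m k w ((initCmd e).run m N σ) ∧
      stack m ((initCmd e).run m N σ) = [rootNode m] := by
  obtain ⟨h1, h2, h3⟩ := run_matrix (N := N) he hio (harr 0) rfl
  set τ₁ := (Cmd.loop 7 (.loop 8 (.store 0 (add (scale (var 7)) (var 8))
      (ite e (const 1) (const 0))))).run m N σ with hτ₁
  set τ₂ := (Cmd.loop 7 (.store 1 (var 7) (const 1))).run m N τ₁ with hτ₂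
  have g1 : ∀ q, τ₂.arr 1 q = rootNode m q := fun q => by
    have h0 : τ₁.arr 1 q = 0 := (congrFun (Cmd.arr_run rfl σ) q).trans (harr 1 q)
    rw [hτ₂, Cmd.run_fill (off := 0) (v := fun _ => 1) (fun ρ _ _ _ _ => by simp [eval]), h0]
    simp [rootNode]
  have g0 : τ₂.arr 0 = τ₁.arr 0 := Cmd.arr_run rfl _
  have g2 : τ₂.arr 2 = σ.arr 2 := (Cmd.arr_run rfl _).trans (Cmd.arr_run rfl _)
  have g3 : τ₂.arr 3 = σ.arr 3 := (Cmd.arr_run rfl _).trans (Cmd.arr_run rfl _)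
  have hrun : (initCmd e).run m N σ = ((resetCmd [7, 8]).run m N τ₂).setVar 10 1 := rfl
  rw [hrun]
  set τ₃ := ((resetCmd [7, 8]).run m N τ₂).setVar 10 1 with hτ₃
  have k0 : τ₃.arr 0 = τ₁.arr 0 := g0
  have k1 : ∀ q, τ₃.arr 1 q = rootNode m q := g1
  have k2 : ∀ q, τ₃.arr 2 q = 0 := fun q => (congrFun g2 q).trans (harr 2 q)
  have k3 : ∀ q, τ₃.arr 3 q = 0 := fun q => (congrFun g3 q).trans (harr 3 q)
  have k10 : τ₃.var 10 = 1 := by simp [hτ₃]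
  have kvar : ∀ x, x ≠ 10 → τ₃.var x = 0 := fun x hx => by
    have hx' : τ₂.var x = 0 ∨ x ∈ ([7, 8] : List (Fin 16)) := by
      by_cases hx : x ∈ ([7, 8] : List (Fin 16))
      · exact Or.inr hx
      · simp only [List.mem_cons, List.not_mem_nil, or_false, not_or] at hx
        have hne : x ≠ 7 ∧ x ≠ 8 := hx
        left
        rw [hτ₂, hτ₁, Cmd.var_run (by simp [Cmd.writesVar, hne.1.symm]),
          Cmd.var_run (by simp [Cmd.writesVar, hne.1.symm, hne.2.symm]), hvar]
    rw [hτ₃, Store.var_setVar, if_neg hx, var_run_reset]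
    split_ifs with hmem
    exacts [rfl, hx'.resolve_right hmem]
  have kstack : stack m τ₃ = [rootNode m] := by
    unfold stack
    rw [k10, List.range_one, List.map_singleton]
    congr 1
    funext i
    unfold frameAt
    rw [k1]
    simp [rootNode]
  have kroot : IsNode G m (rootNode m) := by
    have hs : selected m (rootNode m) = ∅ :=
      selected_eq_empty fun i => by unfold rootNode; split_ifs <;> omega
    refine ⟨fun i => by unfold rootNode; split_ifs <;> omega, fun i hi => if_neg (by omega), ?_, ?_⟩
    · rw [hs]; exact .empty
    · rw [hs]; simp
  have kbest : selected m (τ₃.arr 3) = ∅ := selected_eq_empty fun i => by simp [k3]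
  refine ⟨⟨by rw [k0]; exact h1, by rw [k0]; exact h2, by rw [k0]; exact h3,
    fun i => by simp [k2], fun i _ => k2 i, fun q hq => ?_, ?_, fun x h10 _ => kvar x h10, ?_⟩,
    kstack⟩
  · rw [k1]
    rw [k10, Nat.one_mul] at hq
    exact if_neg (by omega)
  · rw [kstack, kvar 11 (by decide)]
    refine ⟨fun f hf => ?_, fun i => by simp [k3], fun i _ => k3 i, ?_, ?_, ?_, ?_⟩
    · rw [List.mem_singleton.1 hf]; exact kroot
    · rw [kbest]; exact .empty
    · rw [kbest, Finset.card_empty]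
    · obtain ⟨W, hW, hW', hkW⟩ := hk
      exact Or.inr ⟨_, List.mem_singleton_self _, W, by rwa [undecided_rootNode], hW',
        hkW.trans (Nat.le_add_right _ _)⟩
    · intro p f hp
      have := (List.getElem?_eq_some_iff.1 hp).1
      rw [List.length_singleton] at this
      omega
  · exact (Cmd.io_run rfl _).trans ((Cmd.io_run (by simp [Cmd.writesIo]) _).trans
      ((Cmd.io_run (by simp [Cmd.writesIo]) _).trans hio))

/-! ### The complete program -/

/-- A bound on the number of rounds of the search in a graph with `m` vertices. -/
noncomputable def rounds (m : ℕ) : ℕ := ⌈((m : ℝ) + 1) * (701009 / 500000 : ℝ) ^ m⌉₊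

/-- The correctness of the search, independent of the encoding: `e` says how edges are read from the
input, `post` how the answer is written, and `c * n` is the number of vertices searched. The final
selected set is an induced matching of size at least any promised `k`. -/
theorem haltsWithin_search (c : ℕ) (e : Expr) (post : Cmd) :
    ∃ (p : ℕ → ℕ) (space : Polynomial ℕ), PolyBounded p ∧
    ∀ (n : ℕ) (H : SimpleGraph (Fin n)) (G : SimpleGraph ℕ) (k : ℕ) (col : ℕ → Bool)
      (Q : RamState → Prop), (∀ i j, G.Adj i j → col i ≠ col j) →
      DescribesAdj G (c * n) (graphInput H).mem e →
      (∃ W ⊆ Finset.range (c * n), InducesMatching G W ∧ k ≤ W.card) →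
      (∀ σ s, (∀ i < c * n, ∀ j < c * n, (σ.arr 0 (i * (c * n) + j) ≠ 0 ↔ G.Adj i j)) →
        InducesMatching G (selected (c * n) (σ.arr 3)) →
        σ.var 11 = (selected (c * n) (σ.arr 3)).card → k ≤ σ.var 11 →
        Represents (c * n) (n * n + 1) s (post.run (c * n) (n * n + 1) σ) → Q s) →
      (searchProg c (initCmd e) bodyCmd post 10).HaltsWithin (graphInput H)
        ((rounds (c * n) + 1) * p n) (space.eval n) Q := by
  have hm : PolyBounded fun n => c * n := (PolyBounded.const c).mul .id
  have hB : PolyBounded fun n =>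
      ((c * n) ^ 5 + 1) * (c * n + 1) + c * n * (c * n) + c * n + n + 2 :=
    ((((((hm.pow 5).add (.const 1)).mul (hm.add (.const 1))).add (hm.mul hm)).add hm).add
      .id).add (.const 2)
  obtain ⟨p, space, hp, h⟩ := haltsWithin_searchProg c (initCmd e) bodyCmd post 10 hB
  refine ⟨p, space, hp, fun n H G k col Q hcol he hk hQ => ?_⟩
  obtain ⟨h1, h2⟩ := run_init (N := n * n + 1) (σ := graphStore H) he rfl (fun _ => rfl)
    (fun _ _ => rfl) hk
  refine h n H Q (SearchInv G (c * n) k (graphInput H).mem)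
    (stackPotential (c * n) (701009 / 500000)) _ ?_ (fun σ hσ => hσ.within (graphInput_mem_le H))
    (fun σ _ => stackPotential_nonneg (by norm_num)) (fun σ hσ h0 => hσ.body h0 hcol le_rfl) h1 ?_
    fun σ s hσ h0 hs => ?_
  · refine ⟨fun _ => Nat.zero_le _, fun _ _ => Nat.zero_le _, fun _ _ hi => absurd rfl hi,
      fun i => (graphInput_mem_le H i).trans (by omega)⟩
  -- Initially the stack holds only the root, with all vertices undecided, so its potential is the
  -- number that `rounds` rounds up.
  · refine le_trans (le_of_eq ?_) (Nat.le_ceil _)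
    simp [stackPotential, h2, potential, undecided_rootNode]
  · refine hQ σ s hσ.adj hσ.state.matching hσ.state.card ?_ hs
    -- With an empty stack no node is left to attain `k`, so the best node has attained it.
    have hnil : stack (c * n) σ = [] := List.length_eq_zero_iff.1 ((length_stack _ _).trans h0)
    have := hσ.state.attains
    simpa [hnil] using this

/-- The strict inequality between the bases absorbs both the polynomial cost of a round and the
linear factor in the number of rounds. -/
theorem isBigO_time {c : ℕ} {p : ℕ → ℕ} (hp : PolyBounded p) {r : ℝ}
    (hr : (701009 / 500000 : ℝ) ^ c < r) :
    (fun n : ℕ => (((rounds (c * n) + 1) * p n : ℕ) : ℝ)) =O[Filter.atTop] fun n : ℕ => r ^ n := by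
  have hq : PolyBounded fun n => (c * n + 3) * p n :=
    (((PolyBounded.const c).mul .id).add (.const 3)).mul hp
  refine Asymptotics.IsBigO.trans (Asymptotics.IsBigO.of_bound' ?_)
    (hq.isBigO_mul_pow (by positivity) hr)
  refine Filter.Eventually.of_forall fun n => ?_
  rw [Real.norm_of_nonneg (by positivity), Real.norm_of_nonneg (by positivity), ← pow_mul]
  have h1 : (1 : ℝ) ≤ (701009 / 500000) ^ (c * n) := one_le_pow₀ (by norm_num)
  have h2 : (rounds (c * n) : ℝ) ≤ ((c * n : ℕ) + 1) * (701009 / 500000 : ℝ) ^ (c * n) + 1 :=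
    (Nat.ceil_lt_add_one (by positivity)).le
  push_cast at h2 ⊢
  have h3 : (rounds (c * n) + 1 : ℝ) ≤ (c * n + 3) * (701009 / 500000) ^ (c * n) := by linarith
  calc ((rounds (c * n) : ℝ) + 1) * p n ≤ ((c * n + 3) * (701009 / 500000) ^ (c * n)) * p n :=
        mul_le_mul_of_nonneg_right h3 (Nat.cast_nonneg _)
    _ = (c * n + 3) * p n * (701009 / 500000) ^ (c * n) := by ring

end Search

/-! ## Graphs on initial segments of the natural numbers -/

section Transfer

variable {V : Type*} {K : SimpleGraph V} {φ : V ↪ ℕ} {m : ℕ}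

theorem InducesMatching.map {W : Finset V} (h : InducesMatching K W) (φ : V ↪ ℕ) :
    InducesMatching (K.map φ) (W.map φ) := by
  intro w hw
  obtain ⟨w, hw', rfl⟩ := Finset.mem_map.1 hw
  obtain ⟨u, ⟨hu, hwu⟩, huniq⟩ := h w hw'
  refine ⟨φ u, ⟨Finset.mem_map_of_mem φ hu, SimpleGraph.map_adj_apply.2 hwu⟩, ?_⟩
  rintro z ⟨hz, hwz⟩
  obtain ⟨z, hz', rfl⟩ := Finset.mem_map.1 hz
  rw [huniq z ⟨hz', SimpleGraph.map_adj_apply.1 hwz⟩]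

theorem InducesMatching.of_map {W : Finset V} (h : InducesMatching (K.map φ) (W.map φ)) :
    InducesMatching K W := by
  intro w hw
  obtain ⟨u, ⟨hu, hwu⟩, huniq⟩ := h (φ w) (Finset.mem_map_of_mem φ hw)
  obtain ⟨u, hu', rfl⟩ := Finset.mem_map.1 hu
  refine ⟨u, ⟨hu', SimpleGraph.map_adj_apply.1 hwu⟩, ?_⟩
  rintro z ⟨hz, hwz⟩
  exact φ.injective (huniq (φ z) ⟨Finset.mem_map_of_mem φ hz, SimpleGraph.map_adj_apply.2 hwz⟩)

theorem SimpleGraph.IsBipartite.exists_coloring_map (h : K.IsBipartite) (φ : V ↪ ℕ) :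
    ∃ col : ℕ → Bool, ∀ i j, (K.map φ).Adj i j → col i ≠ col j := by
  obtain ⟨C⟩ := h
  -- Numbers outside the range of `φ` are isolated in the image graph, so their colour is arbitrary.
  refine ⟨Function.extend φ (fun v => decide (C v = 0)) fun _ => false, fun i j hij => ?_⟩
  obtain ⟨a, b, hab, rfl, rfl⟩ := (SimpleGraph.map_adj φ K i j).1 hij
  rw [φ.injective.extend_apply, φ.injective.extend_apply]
  have := C.valid hab
  intro hc
  rw [decide_eq_decide] at hc
  omega

/-- A largest induced matching of the image of `K` is one of `K`. -/
theorem exists_largest_of_selected [Fintype V] (hφ : ∀ i, i < m ↔ ∃ v, φ v = i) {f : ℕ → ℕ} {k : ℕ}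
    (hf : InducesMatching (K.map φ) (selected m f)) (hk : k ≤ (selected m f).card)
    (hmax : ∀ W, InducesMatching K W → W.card ≤ k) :
    ∃ M : Finset (Sym2 V), IsLargestIndepEdgeSet K M ∧ (selected m f).card = 2 * M.card ∧
      (∀ v, f (φ v) = 2 ↔ v ∈ edgeEndpoints M) ∧
      ∀ a b, s(a, b) ∈ M ↔ f (φ a) = 2 ∧ f (φ b) = 2 ∧ K.Adj a b := by
  classical
  have hmap : selected m f = (Finset.univ.filter fun v => f (φ v) = 2).map φ := by
    ext i
    simp only [mem_selected, Finset.mem_map, Finset.mem_filter, Finset.mem_univ, true_and, hφ]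
    constructor
    · rintro ⟨⟨v, rfl⟩, h⟩
      exact ⟨v, h, rfl⟩
    · rintro ⟨v, h, rfl⟩
      exact ⟨⟨v, rfl⟩, h⟩
  rw [hmap] at hf hk ⊢
  rw [Finset.card_map] at hk ⊢
  obtain ⟨M, h1, h2, h3, h4⟩ :=
    hf.of_map.exists_isLargestIndepEdgeSet fun W hW => (hmax W hW).trans hk
  exact ⟨M, h1, h3, fun v => by simpa using h2 v, fun a b => by simpa using h4 a b⟩

/-- As `j < n`, division with remainder recovers `i` and `j` from `i * n + j`, so a cell of the
matrix belongs to one pair only. -/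
theorem graphInput_mem_adj {n : ℕ} (G : SimpleGraph (Fin n)) (i j : Fin n) :
    (graphInput G).mem (1 + i * n + j) ≠ 0 ↔ G.Adj i j := by
  simp only [graphInput, Finsupp.onFinset_apply]
  rw [if_neg (by omega)]
  constructor
  · intro h
    split_ifs at h with h'
    · obtain ⟨i', j', h1, h2⟩ := h'
      have hn : 0 < n := i.pos
      have h3 : (i : ℕ) * n + j = i' * n + j' := by omega
      have hi : (i : ℕ) = i' := by
        have := congrArg (· / n) h3
        simpa [Nat.mul_add_div hn, mul_comm _ n, Nat.div_eq_of_lt] using this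
      have hj : (j : ℕ) = j' := by rw [hi] at h3; omega
      rwa [Fin.ext hi, Fin.ext hj]
    · exact absurd rfl h
  · intro h
    rw [if_pos ⟨i, j, rfl, h⟩]
    exact one_ne_zero

end Transfer

namespace Search

open Expr

/-! ### Edge sets -/

def inputAdjExpr : Expr := io (add (add (const 1) (scale (var 7))) (var 8))

def chosenExpr : Expr :=
  and (adjExpr (var 7) (var 8))
    (and (eq (arr 3 (var 7)) (const 2)) (eq (arr 3 (var 8)) (const 2)))

/-- Write the number of chosen edges and their adjacency matrix. -/
def outputEdgesCmd : Cmd :=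
  .seq (.storeIo (const 0) (half (var 11)))
    (.loop 7 (.loop 8 (.storeIo (add (add (const 1) (scale (var 7))) (var 8))
      (ite chosenExpr (const 1) (const 0)))))

theorem describesAdj_inputAdjExpr {n : ℕ} (H : SimpleGraph (Fin n)) :
    DescribesAdj (H.map Fin.valEmbedding) (1 * n) (graphInput H).mem inputAdjExpr := by
  intro τ hio h7 h8
  rw [one_mul] at *
  have : inputAdjExpr.Holds n τ ↔ (graphInput H).mem (1 + τ.var 7 * n + τ.var 8) ≠ 0 := by
    rw [← hio]; rfl
  rw [this, graphInput_mem_adj H ⟨_, h7⟩ ⟨_, h8⟩]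
  exact (SimpleGraph.map_adj_apply (f := Fin.valEmbedding)).symm

/-- A loop that fills a block of the output. -/
theorem run_fillIo {m N off : ℕ} {x : Fin 16} {idx e : Expr} {v : ℕ → ℕ} {σ : Store}
    (hN : off + m ≤ N)
    (h : ∀ τ : Store, (∀ y, y ≠ x → τ.var y = σ.var y) → τ.arr = σ.arr → τ.var x < m →
      idx.eval m τ = off + τ.var x ∧ e.eval m τ = v (τ.var x)) (q : ℕ) :
    ((Cmd.loop x (.storeIo idx e)).run m N σ).io q =
      if off ≤ q ∧ q < off + m then v (q - off) else σ.io q := by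
  have := Store.iterDown_induction (f := (Cmd.storeIo idx e).run m N) (x := x) (m := m) (σ := σ)
    (P := fun i τ => (∀ y, y ≠ x → τ.var y = σ.var y) ∧ τ.arr = σ.arr ∧ ∀ q, τ.io q =
        if off + i ≤ q ∧ q < off + m then v (q - off) else σ.io q)
    ⟨fun _ _ => rfl, rfl, fun q => by rw [if_neg (by omega)]⟩ ?_
  · exact this.2.2 q
  · rintro i hi τ ⟨h1, h2, h4⟩
    have h1' : ∀ y, y ≠ x → (τ.setVar x i).var y = σ.var y := fun y hy => by
      rw [Store.var_setVar, if_neg hy, h1 y hy]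
    obtain ⟨h5, h6⟩ := h (τ.setVar x i) h1' h2 (by simpa using hi)
    rw [Store.var_setVar, if_pos rfl] at h5 h6
    have hrun : (Cmd.storeIo idx e).run m N (τ.setVar x i) = (τ.setVar x i).setIo (off + i) (v i) := by
      rw [Cmd.run, h5, h6, if_pos (by omega)]
    rw [hrun]
    refine ⟨h1', h2, fun q => ?_⟩
    rw [Store.io_setIo, Function.update_apply, Store.io_setVar, h4]
    split_ifs with h7 h8 h8
    · congr 1; omega
    all_goals first | rfl | omega

/-- Variable `11` counts selected vertices, twice the number of edges, so half of it is written. The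
matrix is read off as adjacency between selected vertices. -/
theorem run_outputEdges {n N : ℕ} (hN : n * n < N) {σ : Store} {P : ℕ → ℕ → Prop}
    [∀ i j, Decidable (P i j)]
    (hP : ∀ τ : Store, τ.arr = σ.arr → τ.var 7 < n → τ.var 8 < n →
      (chosenExpr.Holds n τ ↔ P (τ.var 7) (τ.var 8))) :
    (outputEdgesCmd.run n N σ).io 0 = σ.var 11 / 2 ∧ ∀ i < n, ∀ j < n,
      (outputEdgesCmd.run n N σ).io (1 + i * n + j) = if P i j then 1 else 0 := by
  classical
  have h0 : (Cmd.storeIo (const 0) (half (var 11))).run n N σ = σ.setIo 0 (σ.var 11 / 2) := by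
    rw [Cmd.run]
    exact if_pos (show 0 < N by omega)
  have := Store.iterDown_induction (m := n) (x := 7) (σ := σ.setIo 0 (σ.var 11 / 2))
    (f := (Cmd.loop 8 (.storeIo (add (add (const 1) (scale (var 7))) (var 8))
      (ite chosenExpr (const 1) (const 0)))).run n N)
    (P := fun i₀ τ => τ.arr = σ.arr ∧ τ.io 0 = σ.var 11 / 2 ∧
      ∀ i, i₀ ≤ i → i < n → ∀ j < n, τ.io (1 + i * n + j) = if P i j then 1 else 0)
    ⟨rfl, by simp, fun i hi hi' => by omega⟩ ?_
  · have hrun : outputEdgesCmd.run n N σ = (Cmd.loop 7 (.loop 8 (.storeIo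
        (add (add (const 1) (scale (var 7))) (var 8)) (ite chosenExpr (const 1) (const 0))))).run n N
          ((Cmd.storeIo (const 0) (half (var 11))).run n N σ) := rfl
    rw [hrun, h0]
    exact ⟨this.2.1, fun i hi => this.2.2 i (Nat.zero_le i) hi⟩
  · rintro i₀ hi₀ τ ⟨h1, h2, h3⟩
    have hle := Nat.mul_le_mul_right n (Nat.succ_le_of_lt hi₀)
    rw [Nat.succ_mul] at hle
    have hfill := run_fillIo (m := n) (N := N) (x := 8) (σ := τ.setVar 7 i₀)
      (idx := add (add (const 1) (scale (var 7))) (var 8))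
      (e := ite chosenExpr (const 1) (const 0)) (off := 1 + i₀ * n)
      (v := fun j => if P i₀ j then 1 else 0) (by omega) (fun ρ hv ha hlt => by
        have h7 : ρ.var 7 = i₀ := (hv 7 (by decide)).trans (by simp)
        refine ⟨by simp only [eval, h7], ?_⟩
        have := hP ρ (ha.trans h1) (by omega) hlt
        rw [h7] at this
        rw [eval_ite]
        simp only [this, eval])
    refine ⟨?_, ?_, fun i hi hi' j hj => ?_⟩
    · funext l
      exact (Cmd.arr_run rfl _).trans (congrFun h1 l)
    · rw [hfill, if_neg (by omega)]
      exact h2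
    · rw [hfill]
      rcases hi.eq_or_lt with rfl | hlt
      · rw [if_pos (by omega), Nat.add_sub_cancel_left]
      · have := Nat.mul_le_mul_right n (Nat.succ_le_of_lt hlt)
        rw [Nat.succ_mul] at this
        rw [if_neg (by omega)]
        exact h3 i hlt hi' j hj

/-- The search is run with `k` the size of a maximum induced matching. The exponent base is `701009
/ 500000`, just below `1.40202`. -/
theorem exists_ramProg_isLargestIndepEdgeSet :
    ∃ (P : RamProg) (time : ℕ → ℕ) (space : Polynomial ℕ),
      ((fun n : ℕ => (time n : ℝ)) =O[Filter.atTop] fun n : ℕ => (1.40202 : ℝ) ^ n) ∧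
      ∀ (n : ℕ) (H : SimpleGraph (Fin n)), H.IsBipartite →
        P.HaltsWithin (graphInput H) (time n) (space.eval n) fun s =>
          ∃ M : Finset (Sym2 (Fin n)), IsLargestIndepEdgeSet H M ∧ OutputsEdgeSet s M := by
  classical
  obtain ⟨p, space, hp, h⟩ := haltsWithin_search 1 inputAdjExpr outputEdgesCmd
  refine ⟨searchProg 1 (initCmd inputAdjExpr) bodyCmd outputEdgesCmd 10, _, space,
    isBigO_time (c := 1) hp (by norm_num), fun n H hH => ?_⟩
  obtain ⟨col, hcol⟩ := hH.exists_coloring_map Fin.valEmbedding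
  obtain ⟨W, hW, hmax⟩ := exists_maximum_inducesMatching H
  refine h n H (H.map Fin.valEmbedding) W.card col _ hcol (describesAdj_inputAdjExpr H)
    ⟨W.map Fin.valEmbedding, fun i hi => ?_, hW.map _, (Finset.card_map _).ge⟩
    fun σ s hadj hmatch hcard hk hs => ?_
  · obtain ⟨v, -, rfl⟩ := Finset.mem_map.1 hi
    simp
  · rw [one_mul] at *
    obtain ⟨M, h1, h2, -, h4⟩ := exists_largest_of_selected (φ := Fin.valEmbedding)
      (fun i => ⟨fun hi => ⟨⟨i, hi⟩, rfl⟩, by rintro ⟨v, rfl⟩; exact v.isLt⟩)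
      hmatch (hcard ▸ hk) hmax
    refine ⟨M, h1, ?_⟩
    have hchosen : ∀ τ : Store, τ.arr = σ.arr → τ.var 7 < n → τ.var 8 < n →
        (chosenExpr.Holds n τ ↔ (H.map Fin.valEmbedding).Adj (τ.var 7) (τ.var 8) ∧
          σ.arr 3 (τ.var 7) = 2 ∧ σ.arr 3 (τ.var 8) = 2) := by
      intro τ hτ h7 h8
      rw [chosenExpr, holds_and, holds_and, holds_eq, holds_eq, ← hτ]
      rw [← hτ] at hadj
      exact and_congr_left' (hadj _ h7 _ h8)
    obtain ⟨k1, k2⟩ := run_outputEdges (Nat.lt_add_one (n * n))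
      (P := fun i j => (H.map Fin.valEmbedding).Adj i j ∧ σ.arr 3 i = 2 ∧ σ.arr 3 j = 2) hchosen
    refine ⟨?_, fun i j => ?_⟩
    · rw [hs.io 0 (by omega), k1, hcard, h2, Nat.mul_div_cancel_left _ two_pos]
    · have := Nat.mul_le_mul_right n (Nat.succ_le_of_lt i.isLt)
      rw [Nat.succ_mul] at this
      have := j.isLt
      rw [hs.io _ (by omega), k2 _ i.isLt _ j.isLt]
      refine if_congr ?_ rfl rfl
      rw [h4, ← SimpleGraph.map_adj_apply (f := Fin.valEmbedding) (G := H)]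
      simp only [Fin.valEmbedding_apply]
      tauto

/-! ### Irredundant sets -/

/-- The two copies of `{0, …, n - 1}` as the lower and the upper half of `{0, …, 2 n - 1}`. -/
def sumEmbedding (n : ℕ) : Fin n ⊕ Fin n ↪ ℕ where
  toFun := Sum.elim (fun i => i) fun j => n + j
  inj' := by
    rintro (a | a) (b | b) h <;> simp only [Sum.elim_inl, Sum.elim_inr] at h
    · rw [Fin.ext h]
    · omega
    · omega
    · rw [Fin.ext (Nat.add_left_cancel h)]

theorem lt_two_mul_iff_exists_sumEmbedding {n : ℕ} (i : ℕ) :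
    i < 2 * n ↔ ∃ v, sumEmbedding n v = i := by
  constructor
  · intro hi
    by_cases hn : i < n
    · exact ⟨.inl ⟨i, hn⟩, rfl⟩
    · exact ⟨.inr ⟨i - n, by omega⟩, Nat.add_sub_cancel' (by omega)⟩
  · rintro ⟨v | v, rfl⟩
    · have h : sumEmbedding n (.inl v) = v := rfl
      omega
    · have h : sumEmbedding n (.inr v) = n + v := rfl
      omega

/-- For `i` and `n + j` in the variables `x` and `y`: `i` dominates `j` in the input graph. -/
def dominatesExpr (x y : Fin 16) : Expr :=
  or (eq (add (var x) (half size)) (var y))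
    (io (add (add (const 1) (half (scale (var x)))) (sub (var y) (half size))))

def doubleCoverExpr : Expr :=
  or (and (and (lt (var 7) (half size)) (not (lt (var 8) (half size)))) (dominatesExpr 7 8))
    (and (and (lt (var 8) (half size)) (not (lt (var 7) (half size)))) (dominatesExpr 8 7))

/-- The size parameter is `2 * n`, while the input matrix has rows of length `n`. Halving the size
and the scaled index gives `n` and `i * n`. -/
theorem holds_dominatesExpr {n : ℕ} {G : SimpleGraph (Fin n)} {τ : Store}
    (hio : τ.io = (graphInput G).mem) {x y : Fin 16} (i j : Fin n) (hx : τ.var x = i)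
    (hy : τ.var y = n + j) : (dominatesExpr x y).Holds (2 * n) τ ↔ Dominates G i j := by
  have h1 : (i : ℕ) * (2 * n) / 2 = i * n := by
    rw [Nat.mul_left_comm, Nat.mul_div_cancel_left _ two_pos]
  have h2 : 2 * n / 2 = n := Nat.mul_div_cancel_left _ two_pos
  rw [dominatesExpr, holds_or, holds_eq, Dominates, ← graphInput_mem_adj]
  refine or_congr ?_ ?_
  · simp only [eval, hx, hy, h2, Fin.ext_iff]
    omega
  · unfold Holds
    simp only [eval, hx, hy, h1, h2, hio, Nat.add_sub_cancel_left]

theorem describesAdj_doubleCoverExpr {n : ℕ} (G : SimpleGraph (Fin n)) :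
    DescribesAdj ((closedDoubleCover G).map (sumEmbedding n)) (2 * n) (graphInput G).mem
      doubleCoverExpr := by
  intro τ hio h7 h8
  have h2 : 2 * n / 2 = n := Nat.mul_div_cancel_left _ two_pos
  obtain ⟨a, ha⟩ := (lt_two_mul_iff_exists_sumEmbedding _).1 h7
  obtain ⟨b, hb⟩ := (lt_two_mul_iff_exists_sumEmbedding _).1 h8
  rw [← ha, ← hb, SimpleGraph.map_adj_apply, doubleCoverExpr, holds_or, holds_and, holds_and,
    holds_and, holds_and, holds_not, holds_not, holds_lt, holds_lt]
  simp only [eval, h2]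
  rcases a with a | a <;> rcases b with b | b
  · have ha' : τ.var 7 = a := ha.symm
    have hb' : τ.var 8 = b := hb.symm
    simp [ha', hb', closedDoubleCover_adj_inl]
  · have ha' : τ.var 7 = a := ha.symm
    have hb' : τ.var 8 = n + b := hb.symm
    rw [holds_dominatesExpr hio a b ha' hb']
    simp [ha', hb', closedDoubleCover_adj_inl]
  · have ha' : τ.var 7 = n + a := ha.symm
    have hb' : τ.var 8 = b := hb.symm
    rw [holds_dominatesExpr hio b a hb' ha']
    simp [ha', hb', closedDoubleCover_adj_inr]
  · have ha' : τ.var 7 = n + a := ha.symm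
    have hb' : τ.var 8 = n + b := hb.symm
    simp [ha', hb', closedDoubleCover_adj_inr]

/-- Write half of the number of selected vertices and the indicator vector of the selected vertices in
the lower half. -/
def outputVerticesCmd : Cmd :=
  .seq (.storeIo (const 0) (half (var 11)))
    (.loop 7 (.ite (lt (var 7) (half size)) (.storeIo (add (const 1) (var 7))
      (ite (eq (arr 3 (var 7)) (const 2)) (const 1) (const 0))) .skip))

/-- The loop runs through both copies, but only vertices of the first copy, the lower half, are
written. Half of the selected vertices lie there, one for each edge. -/
theorem run_outputVertices {n N : ℕ} (hN : n < N) {σ : Store} :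
    (outputVerticesCmd.run (2 * n) N σ).io 0 = σ.var 11 / 2 ∧ ∀ i < n,
      (outputVerticesCmd.run (2 * n) N σ).io (1 + i) = if σ.arr 3 i = 2 then 1 else 0 := by
  classical
  have h2n : 2 * n / 2 = n := Nat.mul_div_cancel_left _ two_pos
  have h0 : (Cmd.storeIo (const 0) (half (var 11))).run (2 * n) N σ =
      σ.setIo 0 (σ.var 11 / 2) := by
    rw [Cmd.run]
    exact if_pos (show 0 < N by omega)
  have := Store.iterDown_induction (m := 2 * n) (x := 7) (σ := σ.setIo 0 (σ.var 11 / 2))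
    (f := (Cmd.ite (lt (var 7) (half size)) (.storeIo (add (const 1) (var 7))
      (ite (eq (arr 3 (var 7)) (const 2)) (const 1) (const 0))) .skip).run (2 * n) N)
    (P := fun i₀ τ => τ.arr = σ.arr ∧ τ.io 0 = σ.var 11 / 2 ∧
      ∀ i, i₀ ≤ i → i < n → τ.io (1 + i) = if σ.arr 3 i = 2 then 1 else 0)
    ⟨rfl, by simp, fun i hi hi' => by omega⟩ ?_
  · have hrun : outputVerticesCmd.run (2 * n) N σ = (Cmd.loop 7 (.ite (lt (var 7) (half size))
        (.storeIo (add (const 1) (var 7)) (ite (eq (arr 3 (var 7)) (const 2)) (const 1) (const 0)))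
          .skip)).run (2 * n) N ((Cmd.storeIo (const 0) (half (var 11))).run (2 * n) N σ) := rfl
    rw [hrun, h0]
    exact ⟨this.2.1, fun i hi => this.2.2 i (Nat.zero_le i) hi⟩
  · rintro i₀ hi₀ τ ⟨h1, h2, h3⟩
    have hlt : (lt (var 7) (half size)).eval (2 * n) (τ.setVar 7 i₀) ≠ 0 ↔ i₀ < n :=
      holds_lt.trans (by simp [eval])
    rw [Cmd.run]
    simp only [hlt]
    split_ifs with hi
    · have hval : (ite (eq (arr 3 (var 7)) (const 2)) (const 1) (const 0)).eval (2 * n)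
          (τ.setVar 7 i₀) = if σ.arr 3 i₀ = 2 then 1 else 0 := by
        rw [eval_ite, holds_eq]
        simp [eval, h1]
      have hrun : (Cmd.storeIo (add (const 1) (var 7))
          (ite (eq (arr 3 (var 7)) (const 2)) (const 1) (const 0))).run (2 * n) N (τ.setVar 7 i₀) =
          (τ.setVar 7 i₀).setIo (1 + i₀) (if σ.arr 3 i₀ = 2 then 1 else 0) := by
        have hidx : (add (const 1) (var 7)).eval (2 * n) (τ.setVar 7 i₀) = 1 + i₀ := by simp [eval]
        rw [Cmd.run, hval, hidx, if_pos (by omega)]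
      rw [hrun]
      refine ⟨h1, ?_, fun i hi hi' => ?_⟩
      · rw [Store.io_setIo, Function.update_of_ne (by omega)]
        exact h2
      · rw [Store.io_setIo]
        rcases hi.eq_or_lt with rfl | hlt
        · rw [Function.update_self]
        · rw [Function.update_of_ne (by omega)]
          exact h3 i hlt hi'
    · exact ⟨h1, h2, fun i hi' hi'' => by omega⟩

/-- The double cover is never stored in the input format; `doubleCoverExpr` computes its adjacency
from the matrix of `G`. Doubling the vertices squares the base, and `(701009 / 500000) ^ 2 <
1.9657`. -/
theorem exists_ramProg_maximal_isIrredundant :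
    ∃ (P : RamProg) (time : ℕ → ℕ) (space : Polynomial ℕ),
      ((fun n : ℕ => (time n : ℝ)) =O[Filter.atTop] fun n : ℕ => (1.9657 : ℝ) ^ n) ∧
      ∀ (n : ℕ) (G : SimpleGraph (Fin n)),
        P.HaltsWithin (graphInput G) (time n) (space.eval n) fun s =>
          ∃ S : Finset (Fin n), Maximal (IsIrredundant G) S ∧ S.card = upperIrredundance G ∧
            OutputsVertexSet s S := by
  classical
  obtain ⟨p, space, hp, h⟩ := haltsWithin_search 2 doubleCoverExpr outputVerticesCmd
  refine ⟨searchProg 2 (initCmd doubleCoverExpr) bodyCmd outputVerticesCmd 10, _, space,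
    isBigO_time (c := 2) hp (by norm_num), fun n G => ?_⟩
  obtain ⟨col, hcol⟩ :=
    (isBipartite_closedDoubleCover (G := G)).exists_coloring_map (sumEmbedding n)
  obtain ⟨W, hW, hmax⟩ := exists_maximum_inducesMatching (closedDoubleCover G)
  refine h n G ((closedDoubleCover G).map (sumEmbedding n)) W.card col _ hcol
    (describesAdj_doubleCoverExpr G) ⟨W.map (sumEmbedding n), fun i hi => ?_, hW.map _,
      (Finset.card_map _).ge⟩ fun σ s hadj hmatch hcard hk hs => ?_
  · obtain ⟨v, -, rfl⟩ := Finset.mem_map.1 hi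
    exact Finset.mem_range.2 ((lt_two_mul_iff_exists_sumEmbedding _).2 ⟨v, rfl⟩)
  · obtain ⟨M, h1, h2, h3, -⟩ := exists_largest_of_selected
      lt_two_mul_iff_exists_sumEmbedding hmatch (hcard ▸ hk) hmax
    have hS : ∀ v, v ∈ (Finset.univ.filter fun i : Fin n => σ.arr 3 i = 2) ↔
        Sum.inl v ∈ edgeEndpoints M := fun v => by
      rw [← h3, Finset.mem_filter, and_iff_right (Finset.mem_univ _)]
      rfl
    obtain ⟨h4, h5⟩ := maximal_isIrredundant_of_isLargestIndepEdgeSet h1 hS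
    have hn : n ≤ n * n := Nat.le_mul_self n
    obtain ⟨k1, k2⟩ := run_outputVertices (n := n) (N := n * n + 1) (σ := σ) (by omega)
    refine ⟨_, h4, h5, ?_, fun i => ?_⟩
    · rw [hs.io 0 (by omega), k1, hcard, h2, Nat.mul_div_cancel_left _ two_pos,
        (isIrredundant_of_isIndepEdgeSet h1.1 hS).2]
    · rw [hs.io _ (by omega), k2 i i.isLt]
      exact if_congr (by simp) rfl rfl

end Search
-- The five claims together
theorem mainTheorem5 :
    -- largest independent edge sets of bipartite graphs: time O(1.40202 ^ n), polynomial space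
    (∃ (P : RamProg) (time : ℕ → ℕ) (space : Polynomial ℕ),
      ((fun n : ℕ => (time n : ℝ)) =O[Filter.atTop] fun n : ℕ => (1.40202 : ℝ) ^ n) ∧
      ∀ (n : ℕ) (H : SimpleGraph (Fin n)), H.IsBipartite →
        P.HaltsWithin (graphInput H) (time n) (space.eval n) fun s =>
          ∃ M : Finset (Sym2 (Fin n)), IsLargestIndepEdgeSet H M ∧ OutputsEdgeSet s M) ∧
    -- the recurrences hold for every function `C * 1.40202 ^ n`
    (∀ C : ℝ, 0 < C → SatisfiesRecurrences fun n : ℤ => C * (1.40202 : ℝ) ^ n) ∧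
    -- two adjacent vertices of degree three
    (∀ (W : Type u) [Finite W] (H : SimpleGraph W) (x y x₁ x₂ y₁ y₂ : W),
      H.IsBipartite →
      y ≠ x₁ → y ≠ x₂ → x₁ ≠ x₂ → H.neighborSet x = {y, x₁, x₂} →
      x ≠ y₁ → x ≠ y₂ → y₁ ≠ y₂ → H.neighborSet y = {x, y₁, y₂} →
      ∃ M : Finset (Sym2 W), IsLargestIndepEdgeSet H M ∧
        ((s(x, y) ∈ M ∨ s(x, x₁) ∈ M ∨ s(x, x₂) ∈ M ∨ s(y, y₁) ∈ M ∨ s(y, y₂) ∈ M) ∨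
         (x₁ ∈ edgeEndpoints M ∧ x₂ ∈ edgeEndpoints M) ∨
         (y₁ ∈ edgeEndpoints M ∧ y₂ ∈ edgeEndpoints M ∧
          x₁ ∉ edgeEndpoints M ∧ x₂ ∉ edgeEndpoints M))) ∧
    -- the reduction to the bipartite double cover
    (∀ (V : Type u) [Finite V] (G : SimpleGraph V),
      (closedDoubleCover G).IsBipartite ∧
      Nat.card (V ⊕ V) = 2 * Nat.card V ∧
      (∀ M : Finset (Sym2 (V ⊕ V)), IsIndepEdgeSet (closedDoubleCover G) M →
        ∀ S : Finset V, (∀ v : V, v ∈ S ↔ Sum.inl v ∈ edgeEndpoints M) →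
          IsIrredundant G S ∧ S.card = M.card) ∧
      (∀ S : Finset V, IsIrredundant G S →
        ∃ M : Finset (Sym2 (V ⊕ V)), IsIndepEdgeSet (closedDoubleCover G) M ∧
          (∀ v : V, v ∈ S ↔ Sum.inl v ∈ edgeEndpoints M) ∧ M.card = S.card) ∧
      (∀ M : Finset (Sym2 (V ⊕ V)), IsLargestIndepEdgeSet (closedDoubleCover G) M →
        M.card = upperIrredundance G)) ∧
    -- largest irredundant sets of arbitrary graphs: time O(1.9657 ^ n), polynomial space
    (∃ (P : RamProg) (time : ℕ → ℕ) (space : Polynomial ℕ),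
      ((fun n : ℕ => (time n : ℝ)) =O[Filter.atTop] fun n : ℕ => (1.9657 : ℝ) ^ n) ∧
      ∀ (n : ℕ) (G : SimpleGraph (Fin n)),
        P.HaltsWithin (graphInput G) (time n) (space.eval n) fun s =>
          ∃ S : Finset (Fin n), Maximal (IsIrredundant G) S ∧ S.card = upperIrredundance G ∧
            OutputsVertexSet s S) := by
  refine ⟨Search.exists_ramProg_isLargestIndepEdgeSet,
    fun C hC => satisfiesRecurrences (by norm_num) hC, ?_, ?_,
    Search.exists_ramProg_maximal_isIrredundant⟩
  · intro W _ H x y x₁ x₂ y₁ y₂ _ _ _ _ hx _ _ _ hy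
    exact exists_isLargestIndepEdgeSet_of_degree_three H hx hy
  · intro V _ G
    refine ⟨isBipartite_closedDoubleCover, ?_, fun M hM S hS => isIrredundant_of_isIndepEdgeSet hM hS,
      fun S hS => exists_isIndepEdgeSet_of_isIrredundant hS, fun M hM => card_eq_upperIrredundance hM⟩
    rw [Nat.card_sum, two_mul]
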